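/- **Graph TSP, Subtour LP.** In an instance of graph TSP the cost $c_{\{a,b\}}$ of two vertices of a connected graph $G=(V,E_G)$ is their distance in $G$. A tour is a Hamiltonian cycle of the complete graph on $V$. The Subtour LP is: minimize $\sum_e c_e x_e$ over the edges $e$ of the complete graph, subject to $x(\delta(v))=2$ for all $v\in V$, $x(\delta(S))\ge 2$ for all $\emptyset\ne S\subsetneq V$, and $0\le x_e\le 1$ for all $e$. **Max entropy algorithm.** Given an optimal extreme point $x$ of the Subtour LP and an edge $e^+$ with $x_{e^+}=1$, let $\mathcal X$ be the set of spanning trees in the support of $x$ with $e^+$ removed. Let $p$ be the distribution on $\mathcal X$ that maximizes $-\sum_X p_X\log p_X$ subject to $\sum_{X\ni e}p_X=x_e$ for all $e\ne e^+$. The algorithm samples $X$ from $p$, puts $T=X\cup\{e^+\}$, computes a minimum-cost perfect matching $M$ on the odd-degree vertices of $T$ and an Eulerian tour of $T\uplus M$, and shortcuts this tour by keeping only the first occurrence of every vertex (and returning to the start at the end). **Donuts.** For $k\ge 3$ the $k$-donut is the graph with the $4k+2$ vertices $u_i,v_i$ ($i\in\mathbb Z/2k$), $w_0,w_1$ and the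 edges $u_iu_{i+1}$, $v_iv_{i+1}$, $u_iv_i$ (all $i$), $w_0w_1$, $w_0u_0$, $w_0v_0$, $w_1u_1$, $w_1v_1$. Let $x$ be the point with $x_{w_0w_1}=1$; $x_{u_iv_i}=\frac12$ for all $i$; $x_{u_iu_{i+1}}=x_{v_iv_{i+1}}=1$ for odd $i$ and $\frac12$ for even $i\ne0$; $x_{w_0u_0}=x_{w_0v_0}=x_{w_1u_1}=x_{w_1v_1}=\frac12$; and $x_e=0$ otherwise. Let $e^+=w_0w_1$. **Theorem.** There is a sequence $\varepsilon_k\to0$ such that the following holds for every $k\ge3$, for the graph TSP instance given by the $k$-donut (which is connected). 1. The cost of an optimal tour and the optimal value of the Subtour LP are both equal to $4k+2$, and $x$ is an optimal extreme point of the Subtour LP. 2. The maximum entropy distribution $p$ for $x$ and $e^+$ exists and is unique. 3. For a 1-tree $T$, let $o_i$ be the vertex of $\{u_i,v_i\}$ that has odd degree in $T$, and let $M_1=\{o_0o_1,o_2o_3,\dots,o_{2k-2}o_{2k-1}\}$ and $M_2=\{o_1o_2,o_3o_4,\dots,o_{2k-1}o_0\}$. For every $T$ that is sampled with positive probability, $M_1$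 or $M_2$ is a minimum-cost perfect matching on the odd-degree vertices of $T$. 4. Whenever the algorithm, run with $x$ and $e^+$, always selects a minimum-cost perfect matching $M\in\{M_1,M_2\}$, there is a choice of an Eulerian tour of $T\uplus M$ for every sampled $T$ such that the expected cost of the tour output after shortcutting is at least $(1.375-\varepsilon_k)(4k+2)$, that is, at least $1.375-\varepsilon_k$ times the optimum. -/

import Mathlib

/-! ### The symmetric TSP on a finite vertex set

The edges of the complete graph on `V` are the non-loop elements of `Sym2 V`; a cost function is a
function `c : Sym2 V → ℝ` (its values on loops are never used). -/

/-- The costs of the graph TSP instance given by `G`: shortest path distances in `G`. -/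
noncomputable def graphCost {V : Type*} (G : SimpleGraph V) : Sym2 V → ℝ :=
  Sym2.lift ⟨fun a b => (G.dist a b : ℝ), fun a b => congrArg Nat.cast G.dist_comm⟩

/-- A tour, listed as the cyclic sequence of its vertices: every vertex occurs exactly once. -/
def IsTour {V : Type*} (h : List V) : Prop :=
  h.Nodup ∧ ∀ v, v ∈ h

/-- The cost of the closed tour through the vertices of `h` in this cyclic order. -/
def tourCost {V : Type*} (c : Sym2 V → ℝ) (h : List V) : ℝ :=
  (List.zipWith (fun a b => c s(a, b)) h (h.rotate 1)).sum

/-! ### The Subtour LP -/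

open Classical in
/-- `δ(S)`: the set of edges with exactly one endpoint in `S`. -/
noncomputable def edgeCut {V : Type*} [Fintype V] [DecidableEq V] (S : Finset V) :
    Finset (Sym2 V) :=
  Finset.univ.filter fun e => ∃ a ∈ S, ∃ b ∉ S, e = s(a, b)

/-- The feasible region of the Subtour LP. Loops are not edges, so their coordinates are `0`. -/
def subtourPolytope (V : Type*) [Fintype V] [DecidableEq V] : Set (Sym2 V → ℝ) :=
  {x | (∀ e, e.IsDiag → x e = 0) ∧
    (∀ v : V, ∑ e ∈ edgeCut {v}, x e = 2) ∧
    (∀ S : Finset V, S.Nonempty → S ≠ Finset.univ → 2 ≤ ∑ e ∈ edgeCut S, x e) ∧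
    ∀ e, 0 ≤ x e ∧ x e ≤ 1}

/-- The objective function of the Subtour LP. -/
def lpCost {V : Type*} [Fintype V] [DecidableEq V] (c x : Sym2 V → ℝ) : ℝ :=
  ∑ e, c e * x e

/-! ### The max entropy algorithm -/

/-- `X` is the edge set of a spanning tree of the complete graph on `V`. -/
def IsSpanningTree {V : Type*} (X : Finset (Sym2 V)) : Prop :=
  (∀ e ∈ X, ¬ e.IsDiag) ∧ (SimpleGraph.fromEdgeSet (X : Set (Sym2 V))).IsTree

open Classical in
/-- `p` is a probability distribution on the spanning trees of the support of `x` with the edge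
`e₀` removed, whose marginal at every edge `e ≠ e₀` is exactly `x e`. -/
def IsTreeDistribution {V : Type*} [Fintype V] [DecidableEq V] (x : Sym2 V → ℝ) (e₀ : Sym2 V)
    (p : Finset (Sym2 V) → ℝ) : Prop :=
  (∀ X, 0 ≤ p X) ∧ ∑ X, p X = 1 ∧
    (∀ X, p X ≠ 0 → IsSpanningTree X ∧ ∀ e ∈ X, x e ≠ 0 ∧ e ≠ e₀) ∧
    ∀ e, e ≠ e₀ → ∑ X with e ∈ X, p X = x e

/-- The entropy `- ∑ X, p X * log (p X)`, where `0 * log 0 = 0`. -/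
noncomputable def treeEntropy {V : Type*} [Fintype V] [DecidableEq V]
    (p : Finset (Sym2 V) → ℝ) : ℝ :=
  - ∑ X, p X * Real.log (p X)

/-- `p` is a maximum entropy distribution with marginals `x`, the edge `e₀` being removed. -/
def IsMaxEntropyDistribution {V : Type*} [Fintype V] [DecidableEq V] (x : Sym2 V → ℝ)
    (e₀ : Sym2 V) (p : Finset (Sym2 V) → ℝ) : Prop :=
  IsTreeDistribution x e₀ p ∧ ∀ q, IsTreeDistribution x e₀ q → treeEntropy q ≤ treeEntropy p

/-- The vertices of odd degree in the graph with edge set `T`. -/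
def oddVertices {V : Type*} [Fintype V] [DecidableEq V] (T : Finset (Sym2 V)) : Finset V :=
  Finset.univ.filter fun v => Odd (T.filter fun e => v ∈ e).card

/-- `M` is a perfect matching of the complete graph on the vertex set `O`. -/
def IsPerfectMatchingOn {V : Type*} (O : Finset V) (M : Finset (Sym2 V)) : Prop :=
  (∀ e ∈ M, ¬ e.IsDiag ∧ ∀ v ∈ e, v ∈ O) ∧ ∀ v ∈ O, ∃! e, e ∈ M ∧ v ∈ e

/-- `M` is a perfect matching on `O` of minimum cost. -/
def IsMinCostPerfectMatchingOn {V : Type*} (c : Sym2 V → ℝ) (O : Finset V)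
    (M : Finset (Sym2 V)) : Prop :=
  IsPerfectMatchingOn O M ∧ ∀ N, IsPerfectMatchingOn O N → ∑ e ∈ M, c e ≤ ∑ e ∈ N, c e

/-- `t = (t₀, …, t_ℓ)` is an Eulerian tour of the multigraph with edge multiset `A`: a closed walk
(`t₀ = t_ℓ`) that traverses every edge of `A` exactly once. -/
def IsEulerianTour {V : Type*} (A : Multiset (Sym2 V)) (t : List V) : Prop :=
  t ≠ [] ∧ t.head? = t.getLast? ∧
    ((List.zipWith (fun a b => s(a, b)) t t.tail : List (Sym2 V)) : Multiset (Sym2 V)) = A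

/-- Shortcutting: keep the first occurrence of every vertex (the closing return to `t₀` is
implicit in the cyclic sequence). -/
def shortcut {V : Type*} [DecidableEq V] (t : List V) : List V :=
  t.eraseDups

/-- A legal execution of the max entropy algorithm on the instance `c`. The algorithm takes an
optimal extreme point `x` of the Subtour LP and an edge `e₀` with `x e₀ = 1`, samples a spanning
tree `X` from the maximum entropy distribution `p`, and forms the 1-tree `T = X ∪ {e₀}`. It then
computes a minimum-cost perfect matching `M X` on the odd vertices of `T`, and an Eulerian tour
`t X` of `T ⊎ M X`; its output is `shortcut (t X)`. -/
structure IsMaxEntropyRun {V : Type*} [Fintype V] [DecidableEq V] (c x : Sym2 V → ℝ)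
    (e₀ : Sym2 V) (p : Finset (Sym2 V) → ℝ) (M : Finset (Sym2 V) → Finset (Sym2 V))
    (t : Finset (Sym2 V) → List V) : Prop where
  extreme : x ∈ (subtourPolytope V).extremePoints ℝ
  optimal : ∀ y ∈ subtourPolytope V, lpCost c x ≤ lpCost c y
  edge_one : x e₀ = 1
  maxEntropy : IsMaxEntropyDistribution x e₀ p
  matching : ∀ X, p X ≠ 0 → IsMinCostPerfectMatchingOn c (oddVertices (insert e₀ X)) (M X)
  eulerian : ∀ X, p X ≠ 0 → IsEulerianTour ((insert e₀ X).val + (M X).val) (t X)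

/-- The expected cost of the output `shortcut (t X)`, where `X` has distribution `p`. -/
def expectedTourCost {V : Type*} [Fintype V] [DecidableEq V] (c : Sym2 V → ℝ)
    (p : Finset (Sym2 V) → ℝ) (t : Finset (Sym2 V) → List V) : ℝ :=
  ∑ X, p X * tourCost c (shortcut (t X))

/-! ### The `k`-donut -/

/-- The `4k + 2` vertices of the `k`-donut. -/
abbrev DonutVertex (k : ℕ) : Type := (Bool × Fin (2 * k)) ⊕ Bool

namespace DonutVertex

/-- The vertices of the two rings: `ring true i = u i` (outer), `ring false i = v i` (inner). -/
def ring {k : ℕ} (b : Bool) (i : Fin (2 * k)) : DonutVertex k := Sum.inl (b, i)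

/-- The outer vertices. -/
def u {k : ℕ} (i : Fin (2 * k)) : DonutVertex k := ring true i

/-- The inner vertices. -/
def v {k : ℕ} (i : Fin (2 * k)) : DonutVertex k := ring false i

/-- The special vertex `w₀`. -/
def w₀ {k : ℕ} : DonutVertex k := Sum.inr false

/-- The special vertex `w₁`. -/
def w₁ {k : ℕ} : DonutVertex k := Sum.inr true

end DonutVertex

open DonutVertex

/-- `i + 1` modulo `2k`. -/
def nextIdx {k : ℕ} (i : Fin (2 * k)) : Fin (2 * k) :=
  ⟨(i.val + 1) % (2 * k), Nat.mod_lt _ (by have := i.isLt; omega)⟩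

/-- The `k`-donut graph (for `k ≥ 3`). -/
def donutGraph (k : ℕ) : SimpleGraph (DonutVertex k) :=
  SimpleGraph.fromEdgeSet
    {e | (∃ b i, e = s(ring b i, ring b (nextIdx i))) ∨ (∃ i, e = s(u i, v i)) ∨
      e = s(w₀, w₁) ∨
      (∃ b i, i.val = 0 ∧ e = s(w₀, ring b i)) ∨ (∃ b i, i.val = 1 ∧ e = s(w₁, ring b i))}

/-- The costs of the graphic `k`-donut instance. -/
noncomputable def donutCost (k : ℕ) : Sym2 (DonutVertex k) → ℝ :=
  graphCost (donutGraph k)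

open Classical in
/-- The half-integral solution of the Subtour LP on the `k`-donut. -/
noncomputable def donutPoint (k : ℕ) (e : Sym2 (DonutVertex k)) : ℝ :=
  if e = s(w₀, w₁) ∨ ∃ b i, Odd i.val ∧ e = s(ring b i, ring b (nextIdx i)) then 1
  else if (∃ i, e = s(u i, v i)) ∨
      (∃ b i, Even i.val ∧ i.val ≠ 0 ∧ e = s(ring b i, ring b (nextIdx i))) ∨
      (∃ b i, i.val = 0 ∧ e = s(w₀, ring b i)) ∨
      (∃ b i, i.val = 1 ∧ e = s(w₁, ring b i)) then 1 / 2
  else 0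

/-- The edge `e⁺ = {w₀, w₁}`. -/
def donutEdge (k : ℕ) : Sym2 (DonutVertex k) := s(w₀, w₁)

/-- `oᵢ`: the odd vertex of the 1-tree `T` in the pair `{uᵢ, vᵢ}` (when exactly one is odd). -/
def donutOdd {k : ℕ} (T : Finset (Sym2 (DonutVertex k))) (i : Fin (2 * k)) : DonutVertex k :=
  if u i ∈ oddVertices T then u i else v i

/-- `M₁ = {o₀o₁, o₂o₃, …, o₂ₖ₋₂o₂ₖ₋₁}`. -/
def donutMatching₁ {k : ℕ} (T : Finset (Sym2 (DonutVertex k))) : Finset (Sym2 (DonutVertex k)) :=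
  (Finset.univ.filter fun i : Fin (2 * k) => Even i.val).image
    fun i => s(donutOdd T i, donutOdd T (nextIdx i))

/-- `M₂ = {o₁o₂, o₃o₄, …, o₂ₖ₋₁o₀}`. -/
def donutMatching₂ {k : ℕ} (T : Finset (Sym2 (DonutVertex k))) : Finset (Sym2 (DonutVertex k)) :=
  (Finset.univ.filter fun i : Fin (2 * k) => Odd i.val).image
    fun i => s(donutOdd T i, donutOdd T (nextIdx i))

/-- `M` is a rule that chooses, for every 1-tree `T = X ∪ {e⁺}` that can be sampled, a
minimum-cost perfect matching on the odd vertices of `T` that is one of `M₁`, `M₂`. -/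
def IsDonutMatchingRule (k : ℕ) (p : Finset (Sym2 (DonutVertex k)) → ℝ)
    (M : Finset (Sym2 (DonutVertex k)) → Finset (Sym2 (DonutVertex k))) : Prop :=
  ∀ X, p X ≠ 0 →
    IsMinCostPerfectMatchingOn (donutCost k) (oddVertices (insert (donutEdge k) X)) (M X) ∧
    (M X = donutMatching₁ (insert (donutEdge k) X) ∨
      M X = donutMatching₂ (insert (donutEdge k) X))

/-! Without $e^+$ the support of $x$ is a ladder. Height 0 is $w_1$, heights $1,\dots,2k-1$ are the
pairs with these indices, height $2k$ is the pair $u_0,v_0$, and height $2k+1$ is $w_0$. Heights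
$2m+1$ and $2m+2$ form a block, a square whose two rails have value 1; all other ladder edges have
value 1/2.

LP: the degree constraints fix the total weight at $4k+2$ and every edge costs at least 1, while the
support of $x$ and an explicit Hamiltonian cycle use edges of cost 1. Twice $x$ is a sum of cycles,
which gives the cut constraints. The constraints tight at $x$ determine it
(`eq_donutPoint_of_tight`), so it is extreme.

Entropy: a spanning tree has at least one rail at every even height. Since it contains the block
rails, it has at most one rung per block. The marginals make both expected numbers 1, so equality
holds on every sampled tree (`exists_config_of_ne_zero`). The possible trees are thus described by
$2k+1$ free bits. All $2^{2k+1}$ choices are spanning trees, their uniform distribution has the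
right marginals, and it is the unique entropy maximizer.

Matching: the 1-tree has exactly one odd vertex at each height $1,\dots,2k$. Route the edges of any
perfect matching along shorter arcs of the cycle of heights. The number of edges covering a step
changes parity at every height, so every second step is covered an odd number of times. A charging
argument (`two_add_switch_le`, `exists_le_cost`) bounds the cost below by that of the parity
matching on these steps.

Tours: for $M_2$ the matching edges lie inside the blocks, and a zigzag through the blocks costs,
after shortcutting, $5+[a=b]$ per block, where $a,b$ are the sides of the rails before and after it.
For $M_1$ the tour makes two rounds through the blocks and costs $5+[r=r']$ per block up to
telescoping, where $r,r'$ are the rung bits of consecutive blocks. Either way the mean is 5.5 for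
four vertices, a ratio of 1.375.

The choice between $M_1$ and $M_2$ may depend on the tree, so separate averages do not suffice. Both
indicator sums are written through correlations of random signs with second moment $k-1$.
`tourBound` lies below both costs and loses only $O(\sqrt k)$ in the mean, whence
$\varepsilon_k=4/\sqrt k$. -/

/-! ### Sums along lists -/

/-- The sum of `g a b` over the consecutive pairs `a, b` of a list. -/
def pathSum {V α : Type*} [AddCommMonoid α] (g : V → V → α) : List V → α
  | [] => 0
  | [_] => 0
  | a :: b :: l => g a b + pathSum g (b :: l)

section PathSum

variable {V α : Type*} [AddCommMonoid α] (g : V → V → α)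

@[simp] theorem pathSum_nil : pathSum g [] = 0 := rfl

@[simp] theorem pathSum_singleton (a : V) : pathSum g [a] = 0 := rfl

@[simp] theorem pathSum_cons_cons (a b : V) (l : List V) :
    pathSum g (a :: b :: l) = g a b + pathSum g (b :: l) := rfl

theorem pathSum_eq_sum_zipWith (l : List V) : pathSum g l = (List.zipWith g l l.tail).sum := by
  induction l with
  | nil => rfl
  | cons a l ih =>
    cases l with
    | nil => rfl
    | cons b l => simp [ih]

theorem pathSum_append {l l' : List V} {a b : V} (ha : l.getLast? = some a)
    (hb : l'.head? = some b) :
    pathSum g (l ++ l') = pathSum g l + g a b + pathSum g l' := by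
  induction l with
  | nil => simp at ha
  | cons c l ih =>
    cases l with
    | nil =>
      cases l' with
      | nil => simp at hb
      | cons d l' =>
        simp only [List.getLast?_singleton, Option.some.injEq, List.head?_cons] at ha hb
        subst ha hb
        simp
    | cons d l =>
      rw [List.getLast?_cons_cons] at ha
      have := ih ha
      simp only [List.cons_append, pathSum_cons_cons] at this ⊢
      rw [this]
      simp only [add_assoc]

theorem pathSum_cons {l : List V} {a b : V} (hb : l.head? = some b) :
    pathSum g (a :: l) = g a b + pathSum g l := by
  cases l with
  | nil => simp at hb
  | cons d l =>
    simp only [List.head?_cons, Option.some.injEq] at hb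
    subst hb
    rfl

variable {f : ℕ → List V} {fst lst : ℕ → V} {n : ℕ}

theorem getLast?_flatMap_range (hn : 0 < n) (hl : ∀ m < n, (f m).getLast? = some (lst m)) :
    ((List.range n).flatMap f).getLast? = some (lst (n - 1)) := by
  obtain ⟨n, rfl⟩ : ∃ r, n = r + 1 := ⟨n - 1, by omega⟩
  simp [List.range_succ, hl n (by omega)]

theorem head?_flatMap_range (hn : 0 < n) (hf : ∀ m < n, (f m).head? = some (fst m)) :
    ((List.range n).flatMap f).head? = some (fst 0) := by
  obtain ⟨n, rfl⟩ : ∃ r, n = r + 1 := ⟨n - 1, by omega⟩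
  simp [List.range_succ_eq_map, hf 0 (by omega)]

/-- The tours are concatenations of one list per block. Their sums split into the parts inside
blocks and the links between consecutive blocks. The monoid is arbitrary because this serves both
edge multisets and costs. -/
theorem pathSum_flatMap_range (hf : ∀ m < n, (f m).head? = some (fst m))
    (hl : ∀ m < n, (f m).getLast? = some (lst m)) :
    pathSum g ((List.range n).flatMap f) =
      ∑ m ∈ Finset.range n, pathSum g (f m) +
        ∑ m ∈ Finset.range (n - 1), g (lst m) (fst (m + 1)) := by
  induction n with
  | zero => simp
  | succ n ih =>
    rcases Nat.eq_zero_or_pos n with rfl | hn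
    · simp [List.range_succ]
    · rw [List.range_succ, List.flatMap_append, List.flatMap_singleton,
        pathSum_append g (getLast?_flatMap_range hn fun m hm => hl m (by omega))
          (hf n (by omega)), ih (fun m hm => hf m (by omega)) fun m hm => hl m (by omega),
        Finset.sum_range_succ]
      obtain ⟨n, rfl⟩ : ∃ r, n = r + 1 := ⟨n - 1, by omega⟩
      simp only [Nat.add_sub_cancel, Finset.sum_range_succ _ n]
      abel

end PathSum

/-- Appending the start turns the cyclic sum into a path sum; `zipWith` ignores the surplus last
entry. -/
theorem tourCost_cons {V : Type*} (c : Sym2 V → ℝ) (a : V) (l : List V) :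
    tourCost c (a :: l) = pathSum (fun a b => c s(a, b)) (a :: l ++ [a]) := by
  have h : ∀ (l l' : List V) (x : V), l.length = l'.length →
      List.zipWith (fun a b => c s(a, b)) (l ++ [x]) l' =
        List.zipWith (fun a b => c s(a, b)) l l' := by
    intro l
    induction l with
    | nil => intro l' x hl; cases l' <;> simp at hl ⊢
    | cons b l ih =>
      intro l' x hl
      cases l' with
      | nil => simp at hl
      | cons d l' => simpa using ih l' x (by simpa using hl)
  rw [pathSum_eq_sum_zipWith, List.cons_append, List.tail_cons, ← List.cons_append,
    h _ _ _ (by simp)]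
  simp [tourCost]

theorem isEulerianTour_iff_pathSum {V : Type*} (A : Multiset (Sym2 V)) (t : List V) :
    IsEulerianTour A t ↔ t ≠ [] ∧ t.head? = t.getLast? ∧
      pathSum (fun a b => ({s(a, b)} : Multiset (Sym2 V))) t = A := by
  have h : ∀ l : List V, ((List.zipWith (fun a b => s(a, b)) l l.tail : List (Sym2 V)) :
      Multiset (Sym2 V)) = pathSum (fun a b => ({s(a, b)} : Multiset (Sym2 V))) l := by
    intro l
    induction l with
    | nil => rfl
    | cons a l ih =>
      cases l with
      | nil => rfl
      | cons b l =>
        rw [pathSum_cons_cons, ← ih]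
        simp
  rw [IsEulerianTour, h]

/-! ### Shortcutting -/

section Shortcut

variable {V : Type*} [DecidableEq V]

theorem mem_shortcut {l : List V} {a : V} : a ∈ shortcut l ↔ a ∈ l := List.mem_eraseDups

theorem nodup_shortcut (l : List V) : (shortcut l).Nodup := by
  induction hn : l.length using Nat.strong_induction_on generalizing l with
  | _ n ih =>
    cases l with
    | nil => simp [shortcut]
    | cons a l =>
      rw [shortcut, List.eraseDups_cons, List.nodup_cons]
      refine ⟨by simp [List.mem_eraseDups], ih _ ?_ _ rfl⟩
      rw [← hn]
      exact Nat.lt_succ_of_le (List.length_filter_le _ _)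

theorem shortcut_append (l l' : List V) :
    shortcut (l ++ l') = shortcut l ++ shortcut (l'.filter fun a => a ∉ l) := by
  have : l'.removeAll l = l'.filter fun a => a ∉ l := by
    simp [List.removeAll]
  rw [shortcut, List.eraseDups_append, this]
  rfl

theorem shortcut_eq_self {l : List V} (h : l.Nodup) : shortcut l = l := by
  induction l with
  | nil => rfl
  | cons a l ih =>
    rw [List.nodup_cons] at h
    rw [shortcut, List.eraseDups_cons, List.filter_eq_self.2, ← shortcut, ih h.2]
    intro b hb
    simpa using fun hba : b = a => h.1 (hba ▸ hb)

theorem shortcut_append_of_disjoint {l l' : List V} (h : ∀ a ∈ l', a ∉ l) :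
    shortcut (l ++ l') = shortcut l ++ shortcut l' := by
  rw [shortcut_append, List.filter_eq_self.2]
  simpa using h

/-- Lists without common elements do not influence each other under shortcutting. The lists will be
walks through different blocks. -/
theorem shortcut_flatMap_range {f : ℕ → List V} {n : ℕ}
    (h : ∀ m < n, ∀ m' < m, ∀ a ∈ f m, a ∉ f m') :
    shortcut ((List.range n).flatMap f) = (List.range n).flatMap fun m => shortcut (f m) := by
  induction n with
  | zero => rfl
  | succ n ih =>
    rw [List.range_succ, List.flatMap_append, List.flatMap_append, List.flatMap_singleton,
      List.flatMap_singleton, shortcut_append_of_disjoint,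
      ih fun m hm => h m (by omega)]
    intro a ha hmem
    obtain ⟨m', hm', ha'⟩ := List.mem_flatMap.1 hmem
    exact h n (by omega) m' (List.mem_range.1 hm') a ha ha'

end Shortcut

/-! ### Sums over ranges -/

theorem sum_range_two_mul_add_one {α : Type*} [AddCommMonoid α] (f : ℕ → α) (k : ℕ) :
    ∑ j ∈ Finset.range (2 * k + 1), f j =
      ∑ m ∈ Finset.range k, f (2 * m + 1) + ∑ m ∈ Finset.range (k + 1), f (2 * m) := by
  induction k with
  | zero => simp
  | succ k ih =>
    rw [show 2 * (k + 1) + 1 = (2 * k + 1) + 1 + 1 by ring, Finset.sum_range_succ,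
      Finset.sum_range_succ, ih, Finset.sum_range_succ (fun m => f (2 * m + 1)) k,
      Finset.sum_range_succ (fun m => f (2 * m)) (k + 1),
      show 2 * (k + 1) = 2 * k + 1 + 1 by ring]
    abel

theorem sum_Icc_two_mul {α : Type*} [AddCommMonoid α] (f : ℕ → α) (k : ℕ) :
    ∑ j ∈ Finset.Icc 1 (2 * k), f j = ∑ m ∈ Finset.range k, (f (2 * m + 1) + f (2 * m + 2)) := by
  induction k with
  | zero => simp
  | succ k ih =>
    rw [show 2 * (k + 1) = (2 * k + 1) + 1 by ring, Finset.sum_Icc_succ_top (by omega),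
      Finset.sum_Icc_succ_top (by omega), ih, Finset.sum_range_succ]
    abel

/-! ### The donut as a ladder

After removal of `{w₀, w₁}`, the support of `donutPoint k` is a ladder with the rungs
`{uᵢ, vᵢ}`, `i = 1, …, 2k - 1, 0`, whose two ends are closed up by `w₁` and `w₀`. -/

namespace Donut

variable {k : ℕ}

/-- The vertex at height `j` on side `b`: `w₁` at height `0`, then the pairs `1, …, 2k - 1, 0`,
then `w₀`. -/
def ladder (b : Bool) (j : ℕ) : DonutVertex k :=
  if h : 0 < j ∧ j ≤ 2 * k then ring b ⟨j % (2 * k), Nat.mod_lt _ (by omega)⟩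
  else if j = 0 then w₁ else w₀

/-- The height of a vertex on the ladder. -/
def height : DonutVertex k → ℕ
  | Sum.inl (_, i) => if i.val = 0 then 2 * k else i.val
  | Sum.inr true => 0
  | Sum.inr false => 2 * k + 1

/-- The side of a vertex of the ladder. -/
def side : DonutVertex k → Bool
  | Sum.inl (b, _) => b
  | Sum.inr _ => true

theorem ladder_zero (b : Bool) : (ladder b 0 : DonutVertex k) = w₁ := by simp [ladder]

theorem ladder_top (b : Bool) : (ladder b (2 * k + 1) : DonutVertex k) = w₀ := by simp [ladder]

theorem ring_eq_ladder (b : Bool) {i : Fin (2 * k)} (hi : i.val ≠ 0) :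
    ring b i = ladder b i.val := by
  have := i.isLt
  rw [ladder, dif_pos ⟨by omega, by omega⟩]
  congr
  exact Fin.ext (Nat.mod_eq_of_lt this).symm

theorem ring_eq_ladder_of_zero (b : Bool) {i : Fin (2 * k)} (hi : i.val = 0) :
    ring b i = ladder b (2 * k) := by
  have := i.isLt
  rw [ladder, dif_pos ⟨by omega, by omega⟩]
  congr
  apply Fin.ext
  simp [hi]

theorem ring_eq_ladder_height (b : Bool) (i : Fin (2 * k)) :
    ring b i = ladder b (height (ring b i)) := by
  by_cases hi : i.val = 0
  · rw [ring_eq_ladder_of_zero b hi]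
    congr
    simp [← ring_eq_ladder_of_zero b hi, ring, height, hi]
  · rw [ring_eq_ladder b hi]
    congr
    simp [← ring_eq_ladder b hi, ring, height, hi]

theorem ring_nextIdx (b : Bool) (i : Fin (2 * k)) :
    ring b (nextIdx i) = ladder b (i.val + 1) := by
  have := i.isLt
  rw [ladder, dif_pos ⟨by omega, by omega⟩]
  rfl

theorem height_ladder (b : Bool) {j : ℕ} (hj : j ≤ 2 * k + 1) :
    height (ladder b j : DonutVertex k) = j := by
  rw [ladder]
  split_ifs with h h'
  · rcases Nat.lt_or_ge j (2 * k) with hlt | hge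
    · simp [ring, height, Nat.mod_eq_of_lt hlt]
      omega
    · obtain rfl : j = 2 * k := by omega
      simp [ring, height]
  · simp [w₁, height, h']
  · simp only [w₀, height]
    omega

theorem side_ladder (b : Bool) {j : ℕ} (h1 : 1 ≤ j) (h2 : j ≤ 2 * k) :
    side (ladder b j : DonutVertex k) = b := by
  rw [ladder, dif_pos ⟨h1, h2⟩]
  rfl

theorem height_le (v : DonutVertex k) : height v ≤ 2 * k + 1 := by
  rcases v with ⟨b, i⟩ | b
  · have := i.isLt
    simp only [height]
    split_ifs <;> omega
  · cases b <;> simp [height]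

theorem ladder_side_height (v : DonutVertex k) : ladder (side v) (height v) = v := by
  rcases v with ⟨b, i⟩ | b
  · exact (ring_eq_ladder_height b i).symm
  · cases b
    · exact ladder_top _
    · exact ladder_zero _

theorem exists_eq_ladder (v : DonutVertex k) : ∃ b, ∃ j ≤ 2 * k + 1, v = ladder b j :=
  ⟨side v, height v, height_le v, (ladder_side_height v).symm⟩

/-- The two sides are identified exactly at the two ends, where the ladder closes up. -/
theorem ladder_inj {b b' : Bool} {j j' : ℕ} (hj : j ≤ 2 * k + 1) (hj' : j' ≤ 2 * k + 1) :
    (ladder b j : DonutVertex k) = ladder b' j' ↔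
      j = j' ∧ (b = b' ∨ j = 0 ∨ j = 2 * k + 1) := by
  constructor
  · intro h
    have hh := congrArg height h
    rw [height_ladder b hj, height_ladder b' hj'] at hh
    subst hh
    refine ⟨rfl, ?_⟩
    by_contra! hc
    have hs := congrArg side h
    rw [side_ladder b (by omega) (by omega), side_ladder b' (by omega) (by omega)] at hs
    exact hc.1 hs
  · rintro ⟨rfl, rfl | rfl | rfl⟩
    · rfl
    · rw [ladder_zero, ladder_zero]
    · rw [ladder_top, ladder_top]

/-- The edge between the heights `j` and `j + 1` on side `b`. -/
def rail (b : Bool) (j : ℕ) : Sym2 (DonutVertex k) := s(ladder b j, ladder b (j + 1))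

/-- The edge between the two sides at height `j`. -/
def rung (j : ℕ) : Sym2 (DonutVertex k) := s(ladder true j, ladder false j)

theorem rung_eq (b : Bool) (j : ℕ) : (rung j : Sym2 (DonutVertex k)) =
    s(ladder b j, ladder (!b) j) := by
  cases b
  · exact Sym2.eq_swap
  · rfl

theorem donutEdge_eq (b b' : Bool) : donutEdge k = s(ladder b 0, ladder b' (2 * k + 1)) := by
  rw [donutEdge, ladder_zero, ladder_top, Sym2.eq_swap]

theorem rail_inj {b b' : Bool} {j j' : ℕ} (hk : 0 < k) (hj : j ≤ 2 * k) (hj' : j' ≤ 2 * k) :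
    (rail b j : Sym2 (DonutVertex k)) = rail b' j' ↔ j = j' ∧ b = b' := by
  constructor
  · intro h
    rw [rail, rail, Sym2.eq_iff, ladder_inj (by omega) (by omega),
      ladder_inj (by omega) (by omega), ladder_inj (by omega) (by omega),
      ladder_inj (by omega) (by omega)] at h
    rcases h with ⟨⟨rfl, h1⟩, -, h2⟩ | ⟨⟨h1, -⟩, h2, -⟩
    · refine ⟨rfl, ?_⟩
      rcases h1 with h1 | h1 | h1
      · exact h1
      · rcases h2 with h2 | h2 | h2
        · exact h2
        · omega
        · omega
      · omega
    · omega
  · rintro ⟨rfl, rfl⟩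
    rfl

theorem rung_inj {j j' : ℕ} (hj : j ≤ 2 * k + 1) (hj' : j' ≤ 2 * k + 1) :
    (rung j : Sym2 (DonutVertex k)) = rung j' ↔ j = j' := by
  constructor
  · intro h
    rw [rung, rung, Sym2.eq_iff, ladder_inj hj hj', ladder_inj hj hj', ladder_inj hj hj',
      ladder_inj hj hj'] at h
    rcases h with h | h
    · exact h.1.1
    · exact h.1.1
  · rintro rfl
    rfl

theorem rail_ne_rung {b : Bool} {j j' : ℕ} (hj : j ≤ 2 * k) (hj' : j' ≤ 2 * k + 1) :
    (rail b j : Sym2 (DonutVertex k)) ≠ rung j' := by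
  intro h
  rw [rail, rung, Sym2.eq_iff, ladder_inj (by omega) (by omega),
      ladder_inj (by omega) (by omega), ladder_inj (by omega) (by omega),
      ladder_inj (by omega) (by omega)] at h
  omega

theorem rail_ne_donutEdge {b : Bool} {j : ℕ} (hk : 0 < k) (hj : j ≤ 2 * k) :
    rail b j ≠ donutEdge k := by
  intro h
  rw [donutEdge_eq true true, rail, Sym2.eq_iff, ladder_inj (by omega) (by omega),
      ladder_inj (by omega) (by omega), ladder_inj (by omega) (by omega),
      ladder_inj (by omega) (by omega)] at h
  omega

theorem rung_ne_donutEdge {j : ℕ} (hj : j ≤ 2 * k + 1) : rung j ≠ donutEdge k := by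
  intro h
  rw [donutEdge_eq true true, rung, Sym2.eq_iff, ladder_inj (by omega) (by omega),
      ladder_inj (by omega) (by omega), ladder_inj (by omega) (by omega),
      ladder_inj (by omega) (by omega)] at h
  omega

theorem rail_not_isDiag {b : Bool} {j : ℕ} (hj : j ≤ 2 * k) :
    ¬ (rail b j : Sym2 (DonutVertex k)).IsDiag := by
  rw [rail, Sym2.mk_isDiag_iff, ladder_inj (by omega) (by omega)]
  omega

theorem rung_not_isDiag {j : ℕ} (h1 : 1 ≤ j) (hj : j ≤ 2 * k) :
    ¬ (rung j : Sym2 (DonutVertex k)).IsDiag := by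
  rw [rung, Sym2.mk_isDiag_iff, ladder_inj (by omega) (by omega)]
  simp
  omega

theorem donutEdge_not_isDiag : ¬ (donutEdge k).IsDiag := by
  rw [donutEdge_eq true true, Sym2.mk_isDiag_iff, ladder_inj (by omega) (by omega)]
  omega

theorem card_donutVertex : Fintype.card (DonutVertex k) = 4 * k + 2 := by
  simp only [Fintype.card_sum, Fintype.card_prod, Fintype.card_bool, Fintype.card_fin]
  omega

/-! ### The edges of the donut and the support of `donutPoint` -/

theorem ring_edge_eq_rail (b : Bool) {i : Fin (2 * k)} (hi : i.val ≠ 0) :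
    s(ring b i, ring b (nextIdx i)) = rail b i.val := by
  rw [ring_eq_ladder b hi, ring_nextIdx, rail]

/-- In ladder coordinates the edges at $w_0$ and $w_1$ other than $e^+$ become the end rails.
Besides the ladder and $e^+$ there are only $u_0u_1$ and $v_0v_1$, the seam from height $2k$ to
height 1, where $x$ vanishes. -/
theorem donutGraph_adj_iff (hk : 0 < k) {a b : DonutVertex k} :
    (donutGraph k).Adj a b ↔ a ≠ b ∧ ((∃ c, ∃ j ≤ 2 * k, s(a, b) = rail c j) ∨
      (∃ j, 1 ≤ j ∧ j ≤ 2 * k ∧ s(a, b) = rung j) ∨ s(a, b) = donutEdge k ∨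
      ∃ c, s(a, b) = s(ladder c (2 * k), ladder c 1)) := by
  rw [donutGraph, SimpleGraph.fromEdgeSet_adj, and_comm, Set.mem_ofPred_eq]
  refine and_congr_right fun _ => ⟨?_, ?_⟩
  · rintro (⟨c, i, h⟩ | ⟨i, h⟩ | h | ⟨c, i, hi, h⟩ | ⟨c, i, hi, h⟩)
    · by_cases hi : i.val = 0
      · right; right; right
        refine ⟨c, ?_⟩
        rw [h, ring_eq_ladder_of_zero c hi, ring_nextIdx, hi]
      · left
        refine ⟨c, i.val, i.isLt.le, ?_⟩
        rw [h, ring_edge_eq_rail c hi]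
    · right; left
      by_cases hi : i.val = 0
      · refine ⟨2 * k, by omega, le_rfl, ?_⟩
        rw [h, u, v, ring_eq_ladder_of_zero _ hi, ring_eq_ladder_of_zero _ hi, rung]
      · refine ⟨i.val, by omega, i.isLt.le, ?_⟩
        rw [h, u, v, ring_eq_ladder _ hi, ring_eq_ladder _ hi, rung]
    · right; right; left
      exact h
    · left
      refine ⟨c, 2 * k, le_rfl, ?_⟩
      rw [h, ring_eq_ladder_of_zero c hi, rail, ladder_top, Sym2.eq_swap]
    · left
      refine ⟨c, 0, by omega, ?_⟩
      rw [h, ring_eq_ladder c (by omega), rail, ladder_zero, hi]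
  · rintro (⟨c, j, hj, h⟩ | ⟨j, h1, hj, h⟩ | h | ⟨c, h⟩)
    · rcases Nat.eq_zero_or_pos j with rfl | hj0
      · right; right; right; right
        refine ⟨c, ⟨1, by omega⟩, rfl, ?_⟩
        rw [h, ring_eq_ladder c (by simp), rail, ladder_zero]
      rcases Nat.lt_or_ge j (2 * k) with hlt | hge
      · left
        refine ⟨c, ⟨j, hlt⟩, ?_⟩
        rw [h, ring_edge_eq_rail c (by simp; omega)]
      · right; right; right; left
        obtain rfl : j = 2 * k := by omega
        refine ⟨c, ⟨0, by omega⟩, rfl, ?_⟩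
        rw [h, ring_eq_ladder_of_zero c (by simp), rail, ladder_top, Sym2.eq_swap]
    · right; left
      rcases Nat.lt_or_ge j (2 * k) with hlt | hge
      · refine ⟨⟨j, hlt⟩, ?_⟩
        rw [h, u, v, ring_eq_ladder _ (by simp; omega), ring_eq_ladder _ (by simp; omega), rung]
      · obtain rfl : j = 2 * k := by omega
        refine ⟨⟨0, by omega⟩, ?_⟩
        rw [h, u, v, ring_eq_ladder_of_zero _ (by simp), ring_eq_ladder_of_zero _ (by simp),
          rung]
    · right; right; left
      exact h
    · left
      refine ⟨c, ⟨0, by omega⟩, ?_⟩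
      rw [h, ring_eq_ladder_of_zero c (by simp), ring_nextIdx]

theorem adj_rail (hk : 0 < k) (b : Bool) {j : ℕ} (hj : j ≤ 2 * k) :
    (donutGraph k).Adj (ladder b j) (ladder b (j + 1)) :=
  (donutGraph_adj_iff hk).2 ⟨fun h => rail_not_isDiag hj (Sym2.mk_isDiag_iff.2 h),
    Or.inl ⟨b, j, hj, rfl⟩⟩

theorem adj_rung (hk : 0 < k) (b : Bool) {j : ℕ} (h1 : 1 ≤ j) (hj : j ≤ 2 * k) :
    (donutGraph k).Adj (ladder b j) (ladder (!b) j) :=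
  (donutGraph_adj_iff hk).2
    ⟨fun h => rung_not_isDiag h1 hj (by rw [rung_eq b]; exact Sym2.mk_isDiag_iff.2 h),
    Or.inr (Or.inl ⟨j, h1, hj, (rung_eq b j).symm⟩)⟩

theorem adj_donutEdge (hk : 0 < k) (b b' : Bool) :
    (donutGraph k).Adj (ladder b 0) (ladder b' (2 * k + 1)) :=
  (donutGraph_adj_iff hk).2
    ⟨fun h => donutEdge_not_isDiag (by rw [donutEdge_eq b b']; exact Sym2.mk_isDiag_iff.2 h),
    Or.inr (Or.inr (Or.inl (donutEdge_eq b b').symm))⟩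

theorem adj_seam (hk : 0 < k) (b : Bool) :
    (donutGraph k).Adj (ladder b (2 * k)) (ladder b 1) := by
  refine (donutGraph_adj_iff hk).2 ⟨fun h => ?_, Or.inr (Or.inr (Or.inr ⟨b, rfl⟩))⟩
  rw [ladder_inj (by omega) (by omega)] at h
  omega

theorem connected_donutGraph (hk : 0 < k) : (donutGraph k).Connected := by
  have h : ∀ b, ∀ j ≤ 2 * k + 1, (donutGraph k).Reachable (ladder b 0) (ladder b j) := by
    intro b j
    induction j with
    | zero => intro _; rfl
    | succ j ih => exact fun hj => (ih (by omega)).trans (adj_rail hk b (by omega)).reachable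
  have : Nonempty (DonutVertex k) := ⟨w₁⟩
  have h' : ∀ v, (donutGraph k).Reachable w₁ v := by
    intro v
    obtain ⟨b, j, hj, rfl⟩ := exists_eq_ladder v
    rw [← ladder_zero b]
    exact h b j hj
  exact ⟨fun a b => (h' a).symm.trans (h' b)⟩

/-- The edges with `donutPoint` equal to `1`, and those with `donutPoint` equal to `1 / 2`. -/
theorem donutPoint_eq (hk : 0 < k) (e : Sym2 (DonutVertex k)) [Decidable (e = donutEdge k ∨
      ∃ b j, Odd j ∧ j ≤ 2 * k ∧ e = rail b j)] [Decidable ((∃ j, 1 ≤ j ∧ j ≤ 2 * k ∧ e = rung j) ∨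
      ∃ b j, Even j ∧ j ≤ 2 * k ∧ e = rail b j)] :
    donutPoint k e = if e = donutEdge k ∨ ∃ b j, Odd j ∧ j ≤ 2 * k ∧ e = rail b j then 1
      else if (∃ j, 1 ≤ j ∧ j ≤ 2 * k ∧ e = rung j) ∨
        ∃ b j, Even j ∧ j ≤ 2 * k ∧ e = rail b j then 1 / 2 else 0 := by
  rw [donutPoint]
  have hr : (∃ i : Fin (2 * k), e = s(u i, v i)) ↔ ∃ j, 1 ≤ j ∧ j ≤ 2 * k ∧ e = rung j := by
    constructor
    · rintro ⟨i, h⟩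
      by_cases hi : i.val = 0
      · refine ⟨2 * k, by omega, le_rfl, ?_⟩
        rw [h, u, v, ring_eq_ladder_of_zero _ hi, ring_eq_ladder_of_zero _ hi, rung]
      · refine ⟨i.val, by omega, i.isLt.le, ?_⟩
        rw [h, u, v, ring_eq_ladder _ hi, ring_eq_ladder _ hi, rung]
    · rintro ⟨j, h1, hj, h⟩
      rcases Nat.lt_or_ge j (2 * k) with hlt | hge
      · refine ⟨⟨j, hlt⟩, ?_⟩
        rw [h, u, v, ring_eq_ladder _ (by simp; omega), ring_eq_ladder _ (by simp; omega), rung]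
      · obtain rfl : j = 2 * k := by omega
        refine ⟨⟨0, by omega⟩, ?_⟩
        rw [h, u, v, ring_eq_ladder_of_zero _ (by simp), ring_eq_ladder_of_zero _ (by simp),
          rung]
  congr 1
  · refine propext (or_congr Iff.rfl ⟨?_, ?_⟩)
    · rintro ⟨b, i, hi, h⟩
      exact ⟨b, i.val, hi, i.isLt.le, by rw [h, ring_edge_eq_rail b hi.pos.ne']⟩
    · rintro ⟨b, j, hi, hj, h⟩
      have hlt : j < 2 * k := by
        have := Nat.odd_iff.1 hi
        omega
      refine ⟨b, ⟨j, hlt⟩, hi, ?_⟩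
      · rw [h, ring_edge_eq_rail b hi.pos.ne']
  · congr 1
    refine propext (or_congr hr ⟨?_, ?_⟩)
    · rintro (⟨b, i, hi, h0, h⟩ | ⟨b, i, hi, h⟩ | ⟨b, i, hi, h⟩)
      · exact ⟨b, i.val, hi, i.isLt.le, by rw [h, ring_edge_eq_rail b h0]⟩
      · refine ⟨b, 2 * k, even_two_mul k, le_rfl, ?_⟩
        rw [h, ring_eq_ladder_of_zero b hi, rail, ladder_top, Sym2.eq_swap]
      · refine ⟨b, 0, by simp, by omega, ?_⟩
        rw [h, ring_eq_ladder b (by omega), rail, ladder_zero, hi]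
    · rintro ⟨b, j, hi, hj, h⟩
      rcases Nat.eq_zero_or_pos j with rfl | hj0
      · right; right
        refine ⟨b, ⟨1, by omega⟩, rfl, ?_⟩
        rw [h, ring_eq_ladder b (by simp), rail, ladder_zero]
      rcases Nat.lt_or_ge j (2 * k) with hlt | hge
      · left
        exact ⟨b, ⟨j, hlt⟩, hi, hj0.ne', by rw [h, ring_edge_eq_rail b hj0.ne']⟩
      · right; left
        obtain rfl : j = 2 * k := by omega
        refine ⟨b, ⟨0, by omega⟩, rfl, ?_⟩
        rw [h, ring_eq_ladder_of_zero b (by simp), rail, ladder_top, Sym2.eq_swap]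

theorem donutPoint_donutEdge (hk : 0 < k) : donutPoint k (donutEdge k) = 1 := by
  classical
  rw [donutPoint_eq hk, if_pos (Or.inl rfl)]

theorem donutPoint_rail_odd (hk : 0 < k) (b : Bool) {j : ℕ} (hj : j ≤ 2 * k) (h : Odd j) :
    donutPoint k (rail b j) = 1 := by
  classical
  rw [donutPoint_eq hk, if_pos (Or.inr ⟨b, j, h, hj, rfl⟩)]

theorem donutPoint_rail_even (hk : 0 < k) (b : Bool) {j : ℕ} (hj : j ≤ 2 * k) (h : Even j) :
    donutPoint k (rail b j) = 1 / 2 := by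
  classical
  rw [donutPoint_eq hk, if_neg, if_pos (Or.inr ⟨b, j, h, hj, rfl⟩)]
  rintro (h' | ⟨b', j', ho, hj', h'⟩)
  · exact rail_ne_donutEdge hk hj h'
  · rw [rail_inj hk hj hj'] at h'
    exact Nat.not_even_iff_odd.2 ho (h'.1 ▸ h)

theorem donutPoint_rung (hk : 0 < k) {j : ℕ} (h1 : 1 ≤ j) (hj : j ≤ 2 * k) :
    donutPoint k (rung j) = 1 / 2 := by
  classical
  rw [donutPoint_eq hk, if_neg, if_pos (Or.inl ⟨j, h1, hj, rfl⟩)]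
  rintro (h' | ⟨b', j', ho, hj', h'⟩)
  · exact rung_ne_donutEdge (by omega) h'
  · exact rail_ne_rung hj' (by omega) h'.symm

/-- `e` is an edge of the ladder. -/
def IsLadderEdge (e : Sym2 (DonutVertex k)) : Prop :=
  (∃ b, ∃ j ≤ 2 * k, e = rail b j) ∨ ∃ j, 1 ≤ j ∧ j ≤ 2 * k ∧ e = rung j

theorem donutPoint_eq_zero (hk : 0 < k) {e : Sym2 (DonutVertex k)} (h : ¬ IsLadderEdge e)
    (h0 : e ≠ donutEdge k) : donutPoint k e = 0 := by
  classical
  rw [IsLadderEdge] at h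
  push Not at h
  rw [donutPoint_eq hk, if_neg, if_neg]
  · rintro (⟨j, h1, hj, he⟩ | ⟨b, j, -, hj, he⟩)
    · exact h.2 j h1 hj he
    · exact h.1 b j hj he
  · rintro (he | ⟨b, j, -, hj, he⟩)
    · exact h0 he
    · exact h.1 b j hj he

theorem donutPoint_nonneg (e : Sym2 (DonutVertex k)) : 0 ≤ donutPoint k e := by
  rw [donutPoint]
  split_ifs <;> norm_num

theorem donutPoint_le_one (e : Sym2 (DonutVertex k)) : donutPoint k e ≤ 1 := by
  rw [donutPoint]
  split_ifs <;> norm_num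

theorem IsLadderEdge.ne_donutEdge (hk : 0 < k) {e : Sym2 (DonutVertex k)} (h : IsLadderEdge e) :
    e ≠ donutEdge k := by
  rcases h with ⟨b, j, hj, rfl⟩ | ⟨j, h1, hj, rfl⟩
  · exact rail_ne_donutEdge hk hj
  · exact rung_ne_donutEdge (by omega)

theorem IsLadderEdge.not_isDiag {e : Sym2 (DonutVertex k)} (h : IsLadderEdge e) :
    ¬ e.IsDiag := by
  rcases h with ⟨b, j, hj, rfl⟩ | ⟨j, h1, hj, rfl⟩
  · exact rail_not_isDiag hj
  · exact rung_not_isDiag h1 hj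

theorem isLadderEdge_of_donutPoint_ne_zero (hk : 0 < k) {e : Sym2 (DonutVertex k)}
    (h : donutPoint k e ≠ 0) (h0 : e ≠ donutEdge k) : IsLadderEdge e := by
  by_contra hc
  exact h (donutPoint_eq_zero hk hc h0)

theorem IsLadderEdge.donutPoint_ne_zero (hk : 0 < k) {e : Sym2 (DonutVertex k)}
    (h : IsLadderEdge e) : donutPoint k e ≠ 0 := by
  rcases h with ⟨b, j, hj, rfl⟩ | ⟨j, h1, hj, rfl⟩
  · rcases Nat.even_or_odd j with h | h
    · rw [donutPoint_rail_even hk b hj h]; norm_num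
    · rw [donutPoint_rail_odd hk b hj h]; norm_num
  · rw [donutPoint_rung hk h1 hj]; norm_num

end Donut

/-! ### Distances in the donut -/

namespace Donut

variable {k : ℕ}

/-- The distance of `i` and `j` in a cycle of length `2k`. -/
def cycDist (k i j : ℕ) : ℕ := min ((i - j) + (j - i)) (2 * k - ((i - j) + (j - i)))

/-- The distance of a vertex from the vertex at height `i₀` on side `b₀` after the donut is retracted
to the prism that is spanned by the vertices at heights `1, …, 2k`. -/
def prismDist (b₀ : Bool) (i₀ : ℕ) (a : DonutVertex k) : ℕ :=
  cycDist k (max 1 (min (2 * k) (height a))) i₀ + if side a = b₀ then 0 else 1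

theorem prismDist_ladder (b₀ : Bool) (i₀ : ℕ) (b : Bool) {j : ℕ} (h1 : 1 ≤ j) (hj : j ≤ 2 * k) :
    prismDist b₀ i₀ (ladder b j : DonutVertex k) = cycDist k j i₀ + if b = b₀ then 0 else 1 := by
  rw [prismDist, height_ladder b (by omega), side_ladder b h1 hj, min_eq_right hj,
    max_eq_right h1]

theorem prismDist_bounds (b₀ : Bool) (i₀ : ℕ) (b : Bool) {j : ℕ} (hj : j ≤ 2 * k + 1) :
    cycDist k (max 1 (min (2 * k) j)) i₀ ≤ prismDist b₀ i₀ (ladder b j : DonutVertex k) ∧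
      prismDist b₀ i₀ (ladder b j : DonutVertex k) ≤
        cycDist k (max 1 (min (2 * k) j)) i₀ + 1 := by
  rw [prismDist, height_ladder b hj]
  split_ifs <;> omega

theorem cycDist_succ {i₀ j : ℕ} (h1 : 1 ≤ i₀) (h2 : i₀ ≤ 2 * k) (hj : j + 1 ≤ 2 * k) :
    cycDist k j i₀ ≤ cycDist k (j + 1) i₀ + 1 ∧ cycDist k (j + 1) i₀ ≤ cycDist k j i₀ + 1 := by
  simp only [cycDist]
  omega

theorem cycDist_seam {i₀ : ℕ} (h1 : 1 ≤ i₀) (h2 : i₀ ≤ 2 * k) :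
    cycDist k (2 * k) i₀ ≤ cycDist k 1 i₀ + 1 ∧ cycDist k 1 i₀ ≤ cycDist k (2 * k) i₀ + 1 := by
  simp only [cycDist]
  omega

/-- The retraction that clamps heights to $1,\dots,2k$ stretches no edge: end rails become a rung or
a point, and $e^+$ becomes a seam edge. -/
theorem prismDist_le_of_adj (hk : 0 < k) (b₀ : Bool) {i₀ : ℕ} (h1 : 1 ≤ i₀) (h2 : i₀ ≤ 2 * k)
    {a b : DonutVertex k} (h : (donutGraph k).Adj a b) :
    prismDist b₀ i₀ b ≤ prismDist b₀ i₀ a + 1 := by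
  have key : ∀ a' b' : DonutVertex k, s(a, b) = s(a', b') →
      (prismDist b₀ i₀ b' ≤ prismDist b₀ i₀ a' + 1 ∧
        prismDist b₀ i₀ a' ≤ prismDist b₀ i₀ b' + 1) →
      prismDist b₀ i₀ b ≤ prismDist b₀ i₀ a + 1 := by
    intro a' b' he hh
    rcases Sym2.eq_iff.1 he with ⟨rfl, rfl⟩ | ⟨rfl, rfl⟩
    · exact hh.1
    · exact hh.2
  rcases ((donutGraph_adj_iff hk).1 h).2 with ⟨c, j, hj, he⟩ | ⟨j, hj1, hj, he⟩ | he | ⟨c, he⟩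
  · refine key _ _ he ?_
    by_cases hj0 : j = 0 ∨ j = 2 * k
    · have ha := prismDist_bounds b₀ i₀ c (k := k) (j := j) (by omega)
      have hb := prismDist_bounds b₀ i₀ c (k := k) (j := j + 1) (by omega)
      have hc : max 1 (min (2 * k) (j + 1)) = max 1 (min (2 * k) j) := by omega
      rw [hc] at hb
      omega
    · rw [prismDist_ladder b₀ i₀ c (by omega) (by omega),
        prismDist_ladder b₀ i₀ c (by omega) (by omega)]
      have := cycDist_succ (k := k) h1 h2 (j := j) (by omega)
      omega
  · refine key _ _ he ?_
    rw [prismDist_ladder b₀ i₀ _ (by omega) (by omega),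
        prismDist_ladder b₀ i₀ _ (by omega) (by omega)]
    constructor <;> split_ifs <;> omega
  · refine key _ _ (he.trans (donutEdge_eq true true)) ?_
    have := cycDist_seam (k := k) h1 h2
    rw [prismDist, prismDist, height_ladder _ (by omega), height_ladder _ (by omega),
      ladder_zero, ladder_top, show side (w₁ : DonutVertex k) = true from rfl,
      show side (w₀ : DonutVertex k) = true from rfl,
      show max 1 (min (2 * k) 0) = 1 by omega, show max 1 (min (2 * k) (2 * k + 1)) = 2 * k by omega]
    omega
  · refine key _ _ he ?_
    have := cycDist_seam (k := k) h1 h2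
    rw [prismDist_ladder b₀ i₀ _ (by omega) (by omega),
        prismDist_ladder b₀ i₀ _ (by omega) (by omega)]
    omega

theorem le_add_dist_of_lipschitz {V : Type*} {G : SimpleGraph V} (hG : G.Connected) (f : V → ℕ)
    (hf : ∀ a b, G.Adj a b → f b ≤ f a + 1) (a b : V) : f b ≤ f a + G.dist a b := by
  obtain ⟨p, hp⟩ := hG.exists_walk_length_eq_dist a b
  rw [← hp]
  clear hp
  induction p with
  | nil => simp
  | cons h p ih =>
    have := hf _ _ h
    rw [SimpleGraph.Walk.length_cons]
    omega

/-- The 1-Lipschitz function `prismDist` vanishes at one end, so its value at the other bounds the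
distance. In other words, $w_0$ and $w_1$ offer no shorter way than the prism. -/
theorem le_donutCost (hk : 0 < k) (b b' : Bool) {i i' : ℕ} (h1 : 1 ≤ i) (h2 : i ≤ 2 * k)
    (h1' : 1 ≤ i') (h2' : i' ≤ 2 * k) :
    (cycDist k i i' : ℝ) + (if b = b' then 0 else 1) ≤
      donutCost k s(ladder b i, ladder b' i') := by
  have := le_add_dist_of_lipschitz (connected_donutGraph hk) (prismDist b' i')
    (fun _ _ => prismDist_le_of_adj hk b' h1' h2') (ladder b' i') (ladder b i)
  rw [prismDist_ladder _ _ _ h1 h2, prismDist_ladder _ _ _ h1' h2', if_pos rfl,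
    show cycDist k i' i' = 0 by simp [cycDist], SimpleGraph.dist_comm] at this
  change _ ≤ (((donutGraph k).dist (ladder b i) (ladder b' i') : ℕ) : ℝ)
  have h : ((cycDist k i i' + if b = b' then 0 else 1 : ℕ) : ℝ) ≤
    ((donutGraph k).dist (ladder b i) (ladder b' i') : ℕ) := by
    exact_mod_cast (by omega)
  push_cast at h
  exact h

theorem donutCost_mk (a b : DonutVertex k) :
    donutCost k s(a, b) = ((donutGraph k).dist a b : ℝ) := rfl

theorem donutCost_nonneg (e : Sym2 (DonutVertex k)) : 0 ≤ donutCost k e := by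
  induction e with
  | _ a b =>
    rw [donutCost_mk]
    positivity

theorem one_le_donutCost (hk : 0 < k) {e : Sym2 (DonutVertex k)} (h : ¬ e.IsDiag) :
    1 ≤ donutCost k e := by
  induction e with
  | _ a b =>
    rw [donutCost_mk]
    exact_mod_cast (connected_donutGraph hk).pos_dist_of_ne fun hab =>
      h (Sym2.mk_isDiag_iff.2 hab)

theorem donutCost_eq_one {a b : DonutVertex k} (h : (donutGraph k).Adj a b) :
    donutCost k s(a, b) = 1 := by
  rw [donutCost_mk, SimpleGraph.dist_eq_one_iff_adj.2 h, Nat.cast_one]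

theorem donutCost_triangle (hk : 0 < k) (a b c : DonutVertex k) :
    donutCost k s(a, c) ≤ donutCost k s(a, b) + donutCost k s(b, c) := by
  simp only [donutCost_mk]
  exact_mod_cast (connected_donutGraph hk).dist_triangle

theorem donutCost_le_of_adj (hk : 0 < k) (b b' : Bool) {i i' : ℕ} (h1 : 1 ≤ i') (h2 : i' ≤ 2 * k)
    (h : (donutGraph k).Adj (ladder b i) (ladder b i')) :
    donutCost k s(ladder b i, ladder b' i') ≤ 1 + if b = b' then 0 else 1 := by
  split_ifs with hb
  · subst hb
    rw [donutCost_eq_one h, add_zero]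
  · obtain rfl : b' = !b := by cases b <;> cases b' <;> simp at hb ⊢
    refine (donutCost_triangle hk _ (ladder b i') _).trans ?_
    rw [donutCost_eq_one h, donutCost_eq_one (adj_rung hk b h1 h2)]

theorem donutCost_eq_one_of_ladderEdge (hk : 0 < k) {e : Sym2 (DonutVertex k)}
    (h : IsLadderEdge e) : donutCost k e = 1 := by
  rcases h with ⟨b, j, hj, rfl⟩ | ⟨j, h1, hj, rfl⟩
  · exact donutCost_eq_one (adj_rail hk b hj)
  · exact donutCost_eq_one (adj_rung hk true h1 hj)

theorem donutCost_donutEdge (hk : 0 < k) : donutCost k (donutEdge k) = 1 := by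
  rw [donutEdge_eq true true]
  exact donutCost_eq_one (adj_donutEdge hk true true)

end Donut

/-! ### The Subtour LP of the donut -/

theorem mem_edgeCut {V : Type*} [Fintype V] [DecidableEq V] {S : Finset V} {a b : V} :
    s(a, b) ∈ edgeCut S ↔ ¬ (a ∈ S ↔ b ∈ S) := by
  rw [edgeCut, Finset.mem_filter]
  constructor
  · rintro ⟨-, c, hc, d, hd, h⟩
    rcases Sym2.eq_iff.1 h with ⟨rfl, rfl⟩ | ⟨rfl, rfl⟩ <;> tauto
  · intro h
    refine ⟨Finset.mem_univ _, ?_⟩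
    by_cases ha : a ∈ S
    · exact ⟨a, ha, b, by tauto, rfl⟩
    · exact ⟨b, by tauto, a, ha, Sym2.eq_swap⟩

/-- Every edge has two ends. -/
theorem sum_edgeCut_singleton {V : Type*} [Fintype V] [DecidableEq V] (y : Sym2 V → ℝ)
    (h : ∀ e, e.IsDiag → y e = 0) : ∑ a : V, ∑ e ∈ edgeCut {a}, y e = 2 * ∑ e, y e := by
  classical
  have h1 : ∀ a : V, ∑ e ∈ edgeCut {a}, y e = ∑ e, if e ∈ edgeCut {a} then y e else 0 := by
    intro a
    rw [← Finset.sum_filter]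
    simp
  rw [Finset.sum_congr rfl fun a _ => h1 a, Finset.sum_comm, Finset.mul_sum]
  refine Finset.sum_congr rfl fun e _ => ?_
  rw [← Finset.sum_filter, Finset.sum_const, nsmul_eq_mul]
  induction e with
  | _ a b =>
    by_cases hab : a = b
    · rw [h _ (Sym2.mk_isDiag_iff.2 hab)]
      simp
    · have : Finset.univ.filter (fun c => s(a, b) ∈ edgeCut {c}) = {a, b} := by
        ext c
        simp only [mem_edgeCut, Finset.mem_filter, Finset.mem_univ, true_and,
          Finset.mem_singleton, Finset.mem_insert]
        constructor
        · tauto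
        · rintro (rfl | rfl)
          · simpa using fun h => hab h.symm
          · simpa using hab
      rw [this, Finset.card_pair hab]
      norm_num

theorem sum_of_mem_subtourPolytope {V : Type*} [Fintype V] [DecidableEq V] {y : Sym2 V → ℝ}
    (hy : y ∈ subtourPolytope V) : ∑ e, y e = Fintype.card V := by
  have := sum_edgeCut_singleton y hy.1
  rw [Finset.sum_congr rfl fun a _ => hy.2.1 a] at this
  simp only [Finset.sum_const, Finset.card_univ, nsmul_eq_mul] at this
  linarith

/-- A cyclic sequence of truth values that is not constant changes at least twice. -/
theorem two_le_sum_changes (g : ℕ → Prop) [DecidablePred g] {n i : ℕ} (hi : i ≤ n)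
    (h : ¬ (g 0 ↔ g i)) :
    (2 : ℝ) ≤ ∑ j ∈ Finset.range n, (if (g j ↔ g (j + 1)) then 0 else 1) +
      if (g 0 ↔ g n) then 0 else 1 := by
  have key : ∀ a m : ℕ, (if (g a ↔ g (a + m)) then (0 : ℝ) else 1) ≤
      ∑ j ∈ Finset.range m, (if (g (a + j) ↔ g (a + j + 1)) then 0 else 1) := by
    intro a m
    induction m with
    | zero => simp
    | succ m ih =>
      rw [Finset.sum_range_succ, ← add_assoc]
      by_cases h1 : (g a ↔ g (a + m))
      · rw [if_pos h1] at ih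
        by_cases h2 : (g a ↔ g (a + m + 1))
        · rw [if_pos h2]
          have : (0 : ℝ) ≤ if (g (a + m) ↔ g (a + m + 1)) then (0 : ℝ) else 1 := by
            split_ifs <;> norm_num
          linarith
        · rw [if_neg h2, if_neg (c := (g (a + m) ↔ g (a + m + 1))) (by tauto)]
          linarith
      · rw [if_neg h1] at ih
        have : (0 : ℝ) ≤ if (g (a + m) ↔ g (a + m + 1)) then (0 : ℝ) else 1 := by
          split_ifs <;> norm_num
        split_ifs at this ⊢ <;> linarith
  obtain ⟨m, rfl⟩ := Nat.exists_eq_add_of_le hi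
  have h1 := key 0 i
  have h2 := key i m
  simp only [zero_add] at h1
  rw [if_neg h] at h1
  rw [Finset.sum_range_add]
  -- One change lies before `i`. The second lies after `i` or, if there is none there, in the
  -- closing pair.
  by_cases h3 : (g i ↔ g (i + m))
  · rw [if_neg (c := (g 0 ↔ g (i + m))) (by tauto)]
    rw [if_pos h3] at h2
    linarith
  · rw [if_neg h3] at h2
    have : (0 : ℝ) ≤ if (g 0 ↔ g (i + m)) then (0 : ℝ) else 1 := by split_ifs <;> norm_num
    linarith

/-- The four pairs are the sides of a square, and a cut that splits its corners crosses at least two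
sides. -/
theorem two_le_sum_square (p q r s : Prop) [Decidable p] [Decidable q] [Decidable r] [Decidable s]
    (h : ¬ (p ↔ q) ∨ ¬ (r ↔ s)) :
    (2 : ℝ) ≤ (if (p ↔ q) then 0 else 1) + (if (r ↔ s) then 0 else 1) +
      (if (p ↔ r) then 0 else 1) + if (q ↔ s) then 0 else 1 := by
  by_cases p <;> by_cases q <;> by_cases r <;> by_cases s <;> simp_all <;> norm_num

/-! ### Cuts of the donut, and feasibility and extremality of the half-integral point -/

namespace Donut

variable {k : ℕ}

/-- The edges of the ladder. -/
def ladderEdges (k : ℕ) : Finset (Sym2 (DonutVertex k)) :=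
  (Finset.range (2 * k + 1) ×ˢ Finset.univ).image (fun q : ℕ × Bool => rail q.2 q.1) ∪
    (Finset.Icc 1 (2 * k)).image rung

theorem mem_ladderEdges {e : Sym2 (DonutVertex k)} : e ∈ ladderEdges k ↔ IsLadderEdge e := by
  simp only [ladderEdges, Finset.mem_union, Finset.mem_image, Finset.mem_product,
    Finset.mem_range, Finset.mem_univ, and_true, Prod.exists, Finset.mem_Icc, IsLadderEdge,
    Nat.lt_succ_iff]
  refine or_congr ⟨?_, ?_⟩ ⟨?_, ?_⟩
  · rintro ⟨j, b, hj, rfl⟩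
    exact ⟨b, j, hj, rfl⟩
  · rintro ⟨b, j, hj, rfl⟩
    exact ⟨j, b, hj, rfl⟩
  · rintro ⟨j, ⟨h1, hj⟩, rfl⟩
    exact ⟨j, h1, hj, rfl⟩
  · rintro ⟨j, h1, hj, rfl⟩
    exact ⟨j, ⟨h1, hj⟩, rfl⟩

theorem sum_ladderEdges {α : Type*} [AddCommMonoid α] (hk : 0 < k) (f : Sym2 (DonutVertex k) → α) :
    ∑ e ∈ ladderEdges k, f e =
      ∑ j ∈ Finset.range (2 * k + 1), (f (rail true j) + f (rail false j)) +
        ∑ j ∈ Finset.Icc 1 (2 * k), f (rung j) := by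
  rw [ladderEdges, Finset.sum_union, Finset.sum_image, Finset.sum_image, Finset.sum_product]
  · simp
  · intro j hj j' hj' h
    simp only [Finset.coe_Icc, Set.mem_Icc] at hj hj'
    exact (rung_inj (by omega) (by omega)).1 h
  · rintro ⟨j, b⟩ hj ⟨j', b'⟩ hj' h
    simp at hj hj'
    obtain ⟨rfl, rfl⟩ := (rail_inj hk (by omega) (by omega)).1 h
    rfl
  · rw [Finset.disjoint_left]
    intro e he he'
    simp only [Finset.mem_image, Finset.mem_product, Finset.mem_range, Prod.exists,
      Finset.mem_Icc] at he he'
    obtain ⟨j, b, hj, rfl⟩ := he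
    obtain ⟨j', hj', h⟩ := he'
    exact rail_ne_rung (by omega) (by omega) h.symm

/-- The coordinate of `y` is `0` outside of the support of `donutPoint k`. -/
def VanishesOff (y : Sym2 (DonutVertex k) → ℝ) : Prop :=
  ∀ e, ¬ IsLadderEdge e → e ≠ donutEdge k → y e = 0

theorem sum_eq_of_vanishesOff (hk : 0 < k) {y : Sym2 (DonutVertex k) → ℝ} (hy : VanishesOff y) :
    ∑ e, y e = y (donutEdge k) +
      (∑ j ∈ Finset.range (2 * k + 1), (y (rail true j) + y (rail false j)) +
        ∑ j ∈ Finset.Icc 1 (2 * k), y (rung j)) := by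
  rw [← sum_ladderEdges hk, ← Finset.sum_insert]
  · refine (Finset.sum_subset (Finset.subset_univ _) fun e _ he => ?_).symm
    rw [Finset.mem_insert, not_or, mem_ladderEdges] at he
    exact hy e he.2 he.1
  · rw [mem_ladderEdges]
    exact fun h => h.ne_donutEdge hk rfl

theorem IsLadderEdge.of_mem {e : Sym2 (DonutVertex k)} (h : IsLadderEdge e) {b : Bool} {i : ℕ}
    (hi : i ≤ 2 * k + 1) (hmem : ladder b i ∈ e) :
    (∃ c j, j ≤ 2 * k ∧ (i = j ∨ i = j + 1) ∧ (b = c ∨ i = 0 ∨ i = 2 * k + 1) ∧ e = rail c j) ∨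
      (1 ≤ i ∧ i ≤ 2 * k ∧ e = rung i) := by
  rcases h with ⟨c, j, hj, rfl⟩ | ⟨j, h1, hj, rfl⟩
  · left
    rw [rail, Sym2.mem_iff, ladder_inj hi (by omega), ladder_inj hi (by omega)] at hmem
    rcases hmem with ⟨h, h'⟩ | ⟨h, h'⟩
    · exact ⟨c, j, hj, Or.inl h, h', rfl⟩
    · exact ⟨c, j, hj, Or.inr h, h', rfl⟩
  · right
    rw [rung, Sym2.mem_iff, ladder_inj hi (by omega), ladder_inj hi (by omega)] at hmem
    obtain rfl : i = j := by omega
    exact ⟨h1, hj, rfl⟩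

theorem eq_of_ladder_mem {e : Sym2 (DonutVertex k)} (h : IsLadderEdge e ∨ e = donutEdge k)
    {b : Bool} {i : ℕ} (h1 : 1 ≤ i) (hi : i ≤ 2 * k) (hmem : ladder b i ∈ e) :
    e = rail b (i - 1) ∨ e = rail b i ∨ e = rung i := by
  rcases h with h | rfl
  · rcases h.of_mem (by omega) hmem with ⟨c, j, hj, hij, hc, rfl⟩ | ⟨-, -, rfl⟩
    · obtain rfl : b = c := by
        rcases hc with hc | hc | hc
        · exact hc
        all_goals omega
      rcases hij with rfl | rfl
      · tauto
      · left; rw [Nat.add_sub_cancel]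
    · tauto
  · rw [donutEdge_eq true true, Sym2.mem_iff, ladder_inj (by omega) (by omega),
      ladder_inj (by omega) (by omega)] at hmem
    omega

theorem eq_of_bottom_mem {e : Sym2 (DonutVertex k)} (h : IsLadderEdge e ∨ e = donutEdge k)
    {b : Bool} (hmem : ladder b 0 ∈ e) :
    e = donutEdge k ∨ e = rail true 0 ∨ e = rail false 0 := by
  rcases h with h | rfl
  · rcases h.of_mem (by omega) hmem with ⟨c, j, hj, hij, hc, rfl⟩ | ⟨h1, -, -⟩
    · obtain rfl : j = 0 := by omega
      cases c <;> tauto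
    · omega
  · tauto

theorem eq_of_top_mem {e : Sym2 (DonutVertex k)} (h : IsLadderEdge e ∨ e = donutEdge k)
    {b : Bool} (hmem : ladder b (2 * k + 1) ∈ e) :
    e = donutEdge k ∨ e = rail true (2 * k) ∨ e = rail false (2 * k) := by
  rcases h with h | rfl
  · rcases h.of_mem (by omega) hmem with ⟨c, j, hj, hij, hc, rfl⟩ | ⟨-, h1, -⟩
    · obtain rfl : j = 2 * k := by omega
      cases c <;> tauto
    · omega
  · tauto

theorem sum_edgeCut_eq {y : Sym2 (DonutVertex k) → ℝ} (hy : VanishesOff y)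
    {S : Finset (DonutVertex k)} {F : Finset (Sym2 (DonutVertex k))} (hF : F ⊆ edgeCut S)
    (h : ∀ e ∈ edgeCut S, IsLadderEdge e ∨ e = donutEdge k → e ∈ F) :
    ∑ e ∈ edgeCut S, y e = ∑ e ∈ F, y e := by
  refine (Finset.sum_subset hF fun e he heF => ?_).symm
  by_contra hc
  refine heF (h e he ?_)
  by_contra hc'
  rw [not_or] at hc'
  exact hc (hy e hc'.1 hc'.2)

theorem mem_of_mem_edgeCut_singleton {V : Type*} [Fintype V] [DecidableEq V] {a : V} {e : Sym2 V}
    (h : e ∈ edgeCut {a}) : a ∈ e := by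
  induction e with
  | _ b c =>
    simp only [mem_edgeCut, Finset.mem_singleton] at h
    rw [Sym2.mem_iff]
    by_cases hb : b = a <;> by_cases hc : c = a <;> simp_all

theorem mem_edgeCut_singleton {V : Type*} [Fintype V] [DecidableEq V] {a : V} {e : Sym2 V}
    (hd : ¬ e.IsDiag) (h : a ∈ e) : e ∈ edgeCut {a} := by
  induction e with
  | _ b c =>
    rw [Sym2.mk_isDiag_iff] at hd
    rw [Sym2.mem_iff] at h
    rw [mem_edgeCut, Finset.mem_singleton, Finset.mem_singleton]
    rcases h with rfl | rfl
    · simpa using fun h => hd h.symm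
    · simpa using hd

theorem sum_edgeCut_ladder (hk : 0 < k) {y : Sym2 (DonutVertex k) → ℝ} (hy : VanishesOff y)
    (b : Bool) {i : ℕ} (h1 : 1 ≤ i) (hi : i ≤ 2 * k) :
    ∑ e ∈ edgeCut {(ladder b i : DonutVertex k)}, y e =
      y (rail b (i - 1)) + y (rail b i) + y (rung i) := by
  rw [sum_edgeCut_eq hy (F := {rail b (i - 1), rail b i, rung i}), Finset.sum_insert,
    Finset.sum_pair, add_assoc]
  · exact rail_ne_rung (by omega) (by omega)
  · rw [Finset.mem_insert, Finset.mem_singleton, rail_inj hk (by omega) (by omega)]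
    rintro (h | h)
    · omega
    · exact rail_ne_rung (by omega) (by omega) h
  · intro e he
    simp only [Finset.mem_insert, Finset.mem_singleton] at he
    rcases he with rfl | rfl | rfl
    · refine mem_edgeCut_singleton (rail_not_isDiag (by omega)) ?_
      rw [rail, Nat.sub_add_cancel h1]
      exact Sym2.mem_mk_right _ _
    · exact mem_edgeCut_singleton (rail_not_isDiag (by omega)) (Sym2.mem_mk_left _ _)
    · refine mem_edgeCut_singleton (rung_not_isDiag h1 hi) ?_
      rw [rung_eq b]
      exact Sym2.mem_mk_left _ _
  · intro e he hl
    simpa using eq_of_ladder_mem hl h1 hi (mem_of_mem_edgeCut_singleton he)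

theorem sum_edgeCut_bottom (hk : 0 < k) {y : Sym2 (DonutVertex k) → ℝ} (hy : VanishesOff y)
    (b : Bool) : ∑ e ∈ edgeCut {(ladder b 0 : DonutVertex k)}, y e =
      y (donutEdge k) + y (rail true 0) + y (rail false 0) := by
  rw [sum_edgeCut_eq hy (F := {donutEdge k, rail true 0, rail false 0}), Finset.sum_insert,
    Finset.sum_pair, add_assoc]
  · rw [Ne, rail_inj hk (by omega) (by omega)]
    simp
  · rw [Finset.mem_insert, Finset.mem_singleton]
    rintro (h | h)
    · exact rail_ne_donutEdge hk (by omega) h.symm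
    · exact rail_ne_donutEdge hk (by omega) h.symm
  · intro e he
    simp only [Finset.mem_insert, Finset.mem_singleton] at he
    rcases he with rfl | rfl | rfl
    · refine mem_edgeCut_singleton donutEdge_not_isDiag ?_
      rw [donutEdge_eq b b]
      exact Sym2.mem_mk_left _ _
    · refine mem_edgeCut_singleton (rail_not_isDiag (by omega)) ?_
      rw [rail, ladder_zero, ladder_zero]
      exact Sym2.mem_mk_left _ _
    · refine mem_edgeCut_singleton (rail_not_isDiag (by omega)) ?_
      rw [rail, ladder_zero, ladder_zero]
      exact Sym2.mem_mk_left _ _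
  · intro e he hl
    simpa using eq_of_bottom_mem hl (mem_of_mem_edgeCut_singleton he)

theorem sum_edgeCut_top (hk : 0 < k) {y : Sym2 (DonutVertex k) → ℝ} (hy : VanishesOff y)
    (b : Bool) : ∑ e ∈ edgeCut {(ladder b (2 * k + 1) : DonutVertex k)}, y e =
      y (donutEdge k) + y (rail true (2 * k)) + y (rail false (2 * k)) := by
  rw [sum_edgeCut_eq hy (F := {donutEdge k, rail true (2 * k), rail false (2 * k)}),
    Finset.sum_insert, Finset.sum_pair, add_assoc]
  · rw [Ne, rail_inj hk (by omega) (by omega)]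
    simp
  · rw [Finset.mem_insert, Finset.mem_singleton]
    rintro (h | h)
    · exact rail_ne_donutEdge hk (by omega) h.symm
    · exact rail_ne_donutEdge hk (by omega) h.symm
  · intro e he
    simp only [Finset.mem_insert, Finset.mem_singleton] at he
    rcases he with rfl | rfl | rfl
    · refine mem_edgeCut_singleton donutEdge_not_isDiag ?_
      rw [donutEdge_eq b b]
      exact Sym2.mem_mk_right _ _
    · refine mem_edgeCut_singleton (rail_not_isDiag (by omega)) ?_
      rw [rail, ladder_top, ladder_top]
      exact Sym2.mem_mk_right _ _
    · refine mem_edgeCut_singleton (rail_not_isDiag (by omega)) ?_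
      rw [rail, ladder_top, ladder_top]
      exact Sym2.mem_mk_right _ _
  · intro e he hl
    simpa using eq_of_top_mem hl (mem_of_mem_edgeCut_singleton he)

/-- The vertices at the heights `j` and `j + 1`. -/
def block (j : ℕ) : Finset (DonutVertex k) :=
  Finset.univ.filter fun a => height a = j ∨ height a = j + 1

theorem ladder_mem_block {b : Bool} {i j : ℕ} (hi : i ≤ 2 * k + 1) :
    (ladder b i : DonutVertex k) ∈ block j ↔ i = j ∨ i = j + 1 := by
  rw [block, Finset.mem_filter, height_ladder b hi]
  simp

theorem sum_edgeCut_block (hk : 0 < k) {y : Sym2 (DonutVertex k) → ℝ} (hy : VanishesOff y)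
    {j : ℕ} (h1 : 1 ≤ j) (hj : j + 1 ≤ 2 * k) :
    ∑ e ∈ edgeCut (block j), y e = y (rail true (j - 1)) + y (rail false (j - 1)) +
      y (rail true (j + 1)) + y (rail false (j + 1)) := by
  rw [sum_edgeCut_eq hy (F := {rail true (j - 1), rail false (j - 1), rail true (j + 1),
    rail false (j + 1)}), Finset.sum_insert, Finset.sum_insert, Finset.sum_pair]
  · ring
  · rw [Ne, rail_inj hk (by omega) (by omega)]
    simp
  · simp only [Finset.mem_insert, Finset.mem_singleton]
    rw [rail_inj hk (by omega) (by omega), rail_inj hk (by omega) (by omega)]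
    omega
  · simp only [Finset.mem_insert, Finset.mem_singleton]
    rw [rail_inj hk (by omega) (by omega), rail_inj hk (by omega) (by omega),
      rail_inj hk (by omega) (by omega)]
    simp
  · intro e he
    simp only [Finset.mem_insert, Finset.mem_singleton] at he
    rcases he with rfl | rfl | rfl | rfl <;>
    · rw [rail, mem_edgeCut, ladder_mem_block (by omega), ladder_mem_block (by omega)]
      omega
  · rintro e he ((⟨b, i, hi, rfl⟩ | ⟨i, hi1, hi, rfl⟩) | rfl)
    · rw [rail, mem_edgeCut, ladder_mem_block (by omega), ladder_mem_block (by omega)] at he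
      obtain rfl | rfl : i = j - 1 ∨ i = j + 1 := by omega
      · cases b <;> simp
      · cases b <;> simp
    · rw [rung, mem_edgeCut, ladder_mem_block (by omega), ladder_mem_block (by omega)] at he
      omega
    · rw [donutEdge_eq true true, mem_edgeCut, ladder_mem_block (by omega),
        ladder_mem_block (by omega)] at he
      omega

theorem vanishesOff_donutPoint (hk : 0 < k) : VanishesOff (donutPoint k) :=
  fun _ h h0 => donutPoint_eq_zero hk h h0

/-- Twice `donutPoint k` is a sum of cycles: one for each side, closed up by the edge `{w₀, w₁}`,
and one for each of the `k` blocks. A cut that separates vertices meets two of them. -/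
theorem two_le_sum_edgeCut (hk : 0 < k) {S : Finset (DonutVertex k)} (hne : S.Nonempty)
    (huniv : S ≠ Finset.univ) : 2 ≤ ∑ e ∈ edgeCut S, donutPoint k e := by
  classical
  set d : DonutVertex k → DonutVertex k → ℝ := fun a b => if (a ∈ S ↔ b ∈ S) then 0 else 1 with hd
  have hd0 : ∀ a b, 0 ≤ d a b := fun a b => by simp only [hd]; split_ifs <;> norm_num
  set y : Sym2 (DonutVertex k) → ℝ := fun e => if e ∈ edgeCut S then donutPoint k e else 0 with hy
  have hyd : ∀ a b, y s(a, b) = donutPoint k s(a, b) * d a b := by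
    intro a b
    simp only [hy, hd, mem_edgeCut]
    split_ifs <;> simp
  have hyv : VanishesOff y := by
    intro e h h0
    simp only [hy, donutPoint_eq_zero hk h h0, ite_self]
  have hsum : ∑ e ∈ edgeCut S, donutPoint k e = ∑ e, y e := by
    rw [← Finset.sum_filter]
    simp
  have hrail : ∀ b m, m < k → y (rail b (2 * m + 1)) = d (ladder b (2 * m + 1)) (ladder b (2 * m + 2)) := by
    intro b m hm
    rw [rail, hyd, ← rail, donutPoint_rail_odd hk b (by omega) ⟨m, rfl⟩, one_mul]
  have hrail' : ∀ b m, m < k + 1 → y (rail b (2 * m)) =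
      1 / 2 * d (ladder b (2 * m)) (ladder b (2 * m + 1)) := by
    intro b m hm
    rw [rail, hyd, ← rail, donutPoint_rail_even hk b (by omega) (even_two_mul m)]
  have hrung : ∀ j, 1 ≤ j → j ≤ 2 * k → y (rung j) = 1 / 2 * d (ladder true j) (ladder false j) := by
    intro j h1 hj
    rw [rung, hyd, ← rung, donutPoint_rung hk h1 hj]
  have hedge : ∀ b, y (donutEdge k) = d (ladder b 0) (ladder b (2 * k + 1)) := by
    intro b
    rw [donutEdge_eq b b, hyd, ← donutEdge_eq, donutPoint_donutEdge hk, one_mul]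
  set C : Bool → ℝ := fun b => ∑ j ∈ Finset.range (2 * k + 1), d (ladder b j) (ladder b (j + 1)) +
    d (ladder b 0) (ladder b (2 * k + 1)) with hC
  set D : ℕ → ℝ := fun m => d (ladder true (2 * m + 1)) (ladder false (2 * m + 1)) +
    d (ladder true (2 * m + 2)) (ladder false (2 * m + 2)) +
    d (ladder true (2 * m + 1)) (ladder true (2 * m + 2)) +
    d (ladder false (2 * m + 1)) (ladder false (2 * m + 2)) with hDdef
  -- $e^+$ lies in both side cycles, a block rail in one side cycle and one square, and every edge
  -- of value 1/2 in a single cycle.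
  have htotal : 2 * ∑ e, y e = C true + C false + ∑ m ∈ Finset.range k, D m := by
    rw [sum_eq_of_vanishesOff hk hyv, sum_range_two_mul_add_one, sum_Icc_two_mul, hC]
    simp only [sum_range_two_mul_add_one, hDdef]
    have e1 : ∑ m ∈ Finset.range k, (y (rail true (2 * m + 1)) + y (rail false (2 * m + 1))) =
        ∑ m ∈ Finset.range k, (d (ladder true (2 * m + 1)) (ladder true (2 * m + 2)) +
          d (ladder false (2 * m + 1)) (ladder false (2 * m + 2))) :=
      Finset.sum_congr rfl fun m hm => by
        rw [hrail _ _ (Finset.mem_range.1 hm), hrail _ _ (Finset.mem_range.1 hm)]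
    have e2 : ∑ m ∈ Finset.range (k + 1), (y (rail true (2 * m)) + y (rail false (2 * m))) =
        ∑ m ∈ Finset.range (k + 1), (1 / 2 * d (ladder true (2 * m)) (ladder true (2 * m + 1)) +
          1 / 2 * d (ladder false (2 * m)) (ladder false (2 * m + 1))) :=
      Finset.sum_congr rfl fun m hm => by
        rw [hrail' _ _ (Finset.mem_range.1 hm), hrail' _ _ (Finset.mem_range.1 hm)]
    have e3 : ∑ m ∈ Finset.range k, (y (rung (2 * m + 1)) + y (rung (2 * m + 2))) =
        ∑ m ∈ Finset.range k, (1 / 2 * d (ladder true (2 * m + 1)) (ladder false (2 * m + 1)) +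
          1 / 2 * d (ladder true (2 * m + 2)) (ladder false (2 * m + 2))) :=
      Finset.sum_congr rfl fun m hm => by
        have := Finset.mem_range.1 hm
        rw [hrung _ (by omega) (by omega), hrung _ (by omega) (by omega)]
    have e4 : 2 * y (donutEdge k) = d (ladder true 0) (ladder true (2 * k + 1)) +
        d (ladder false 0) (ladder false (2 * k + 1)) := by
      rw [← hedge, ← hedge]; ring
    rw [e1, e2, e3]
    simp only [Finset.sum_add_distrib, ← Finset.mul_sum, mul_add]
    rw [e4]
    ring
  have hC0 : ∀ b, 0 ≤ C b := fun b =>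
    add_nonneg (Finset.sum_nonneg fun _ _ => hd0 _ _) (hd0 _ _)
  have hD0 : ∀ m, 0 ≤ D m := fun m => by
    simp only [hDdef]
    linarith [hd0 (ladder true (2 * m + 1)) (ladder false (2 * m + 1)),
      hd0 (ladder true (2 * m + 2)) (ladder false (2 * m + 2)),
      hd0 (ladder true (2 * m + 1)) (ladder true (2 * m + 2)),
      hd0 (ladder false (2 * m + 1)) (ladder false (2 * m + 2))]
  have hCge : ∀ b, (∃ j ≤ 2 * k + 1, ¬ (w₁ ∈ S ↔ ladder b j ∈ S)) → 2 ≤ C b := by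
    rintro b ⟨j, hj, h⟩
    rw [← ladder_zero b] at h
    exact two_le_sum_changes (fun j => ladder b j ∈ S) hj h
  have hDge : ∀ b m, m < k → ∀ j, j = 2 * m + 1 ∨ j = 2 * m + 2 →
      ¬ (ladder b j ∈ S ↔ ladder (!b) j ∈ S) → 2 ≤ D m := by
    intro b m hm j hj h
    have h' : ¬ (ladder true j ∈ S ↔ ladder false j ∈ S) := by
      cases b
      · exact fun hc => h hc.symm
      · exact h
    refine two_le_sum_square _ _ _ _ ?_
    rcases hj with rfl | rfl <;> tauto
  have hDsum : ∀ m, m < k → 2 ≤ D m → 2 ≤ ∑ m ∈ Finset.range k, D m := fun m hm h =>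
    h.trans (Finset.single_le_sum (fun m _ => hD0 m) (Finset.mem_range.2 hm))
  rw [hsum]
  obtain ⟨b, j, hj, hbj⟩ : ∃ b : Bool, ∃ j ≤ 2 * k + 1, ¬ (w₁ ∈ S ↔ ladder b j ∈ S) := by
    by_contra! hc
    have hc' : ∀ a, w₁ ∈ S ↔ a ∈ S := by
      intro a
      obtain ⟨b, j, hj, rfl⟩ := exists_eq_ladder a
      exact hc b j hj
    obtain ⟨a, ha⟩ := hne
    exact huniv (Finset.eq_univ_iff_forall.2 fun c => (hc' c).1 ((hc' a).2 ha))
  have h1 := hCge b ⟨j, hj, hbj⟩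
  have hCsum : C true + C false = C b + C (!b) := by cases b <;> simp [add_comm]
  -- If both side cycles are crossed, they contribute 4. Otherwise the vertex separated from $w_1$
  -- is separated from its partner too, so the square of its block contributes the missing 2.
  by_cases hother : ∃ j ≤ 2 * k + 1, ¬ (w₁ ∈ S ↔ ladder (!b) j ∈ S)
  · have h2 := hCge (!b) hother
    have h3 : 0 ≤ ∑ m ∈ Finset.range k, D m := Finset.sum_nonneg fun m _ => hD0 m
    linarith
  · push Not at hother
    have hj1 : j ≠ 0 := by
      rintro rfl
      exact hbj (by rw [ladder_zero])
    have hj2 : j ≠ 2 * k + 1 := by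
      rintro rfl
      refine hbj ?_
      rw [hother _ hj, ladder_top, ladder_top]
    have h2 := hDsum ((j - 1) / 2) (by omega) (hDge b _ (by omega) j (by omega)
      (by rw [← hother j hj]; tauto))
    have h3 := hC0 (!b)
    linarith

theorem donutPoint_mem_subtourPolytope (hk : 0 < k) :
    donutPoint k ∈ subtourPolytope (DonutVertex k) := by
  have hv := vanishesOff_donutPoint hk
  refine ⟨?_, ?_, fun S => two_le_sum_edgeCut hk, fun e => ⟨donutPoint_nonneg e,
    donutPoint_le_one e⟩⟩
  · intro e he
    exact hv e (fun h => h.not_isDiag he) fun h => donutEdge_not_isDiag (h ▸ he)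
  · intro a
    obtain ⟨b, j, hj, rfl⟩ := exists_eq_ladder a
    rcases Nat.eq_zero_or_pos j with rfl | hj0
    · rw [sum_edgeCut_bottom hk hv, donutPoint_donutEdge hk,
        donutPoint_rail_even hk _ (by omega) (by simp),
        donutPoint_rail_even hk _ (by omega) (by simp)]
      norm_num
    rcases Nat.lt_or_ge (2 * k) j with hlt | hle
    · obtain rfl : j = 2 * k + 1 := by omega
      rw [sum_edgeCut_top hk hv, donutPoint_donutEdge hk,
        donutPoint_rail_even hk _ (by omega) (by simp),
        donutPoint_rail_even hk _ (by omega) (by simp)]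
      norm_num
    · rw [sum_edgeCut_ladder hk hv b hj0 hle, donutPoint_rung hk hj0 hle]
      rcases Nat.even_or_odd j with h | h
      · rw [donutPoint_rail_even hk b hle h, donutPoint_rail_odd hk b (by omega)
          (Nat.Even.sub_odd hj0 h odd_one)]
        norm_num
      · rw [donutPoint_rail_odd hk b hle h, donutPoint_rail_even hk b (by omega)
          (Nat.Odd.sub_odd h odd_one)]
        norm_num

/-- The degree constraints fix the total weight at the number of vertices, and distinct vertices
have distance at least 1. -/
theorem le_lpCost (hk : 0 < k) {y : Sym2 (DonutVertex k) → ℝ}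
    (hy : y ∈ subtourPolytope (DonutVertex k)) : (4 * k + 2 : ℝ) ≤ lpCost (donutCost k) y := by
  have := sum_of_mem_subtourPolytope hy
  rw [card_donutVertex] at this
  push_cast at this
  rw [← this, lpCost]
  refine Finset.sum_le_sum fun e _ => ?_
  by_cases he : e.IsDiag
  · rw [hy.1 e he, mul_zero]
  · exact le_mul_of_one_le_left (hy.2.2.2 e).1 (one_le_donutCost hk he)

theorem lpCost_donutPoint (hk : 0 < k) : lpCost (donutCost k) (donutPoint k) = 4 * k + 2 := by
  have := sum_of_mem_subtourPolytope (donutPoint_mem_subtourPolytope hk)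
  rw [card_donutVertex] at this
  push_cast at this
  rw [← this, lpCost]
  refine Finset.sum_congr rfl fun e _ => ?_
  by_cases he : donutPoint k e = 0
  · rw [he, mul_zero]
  · by_cases h0 : e = donutEdge k
    · rw [h0, donutCost_donutEdge hk, one_mul]
    · rw [donutCost_eq_one_of_ladderEdge hk (isLadderEdge_of_donutPoint_ne_zero hk he h0),
        one_mul]

/-- Once the block rails are 1, the degree constraints make each remaining rail complementary to the
rungs at its ends, and a tight block cut makes the two rungs of the block sum to 1. The degree of
$w_1$ forces the first rung to be 1/2, and this value propagates up the ladder. -/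
theorem eq_donutPoint_of_tight (hk : 0 < k) {y : Sym2 (DonutVertex k) → ℝ}
    (hy : y ∈ subtourPolytope (DonutVertex k)) (h0 : ∀ e, donutPoint k e = 0 → y e = 0)
    (h1 : ∀ e, donutPoint k e = 1 → y e = 1)
    (hblock : ∀ m < k, ∑ e ∈ edgeCut (block (2 * m + 1)), y e = 2) : y = donutPoint k := by
  have hv : VanishesOff y := fun e h he => h0 e (donutPoint_eq_zero hk h he)
  have hodd : ∀ b m, m < k → y (rail b (2 * m + 1)) = 1 := fun b m hm =>
    h1 _ (donutPoint_rail_odd hk b (by omega) ⟨m, rfl⟩)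
  have hdeg := fun (b : Bool) (i : ℕ) (hi1 : 1 ≤ i) (hi : i ≤ 2 * k) =>
    (sum_edgeCut_ladder hk hv b hi1 hi).symm.trans (hy.2.1 _)
  have hL : ∀ b m, m < k → y (rail b (2 * m)) = 1 - y (rung (2 * m + 1)) := by
    intro b m hm
    have := hdeg b (2 * m + 1) (by omega) (by omega)
    rw [hodd b m hm, Nat.add_sub_cancel] at this
    linarith
  have hR : ∀ b m, m < k → y (rail b (2 * m + 2)) = 1 - y (rung (2 * m + 2)) := by
    intro b m hm
    have := hdeg b (2 * m + 2) (by omega) (by omega)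
    rw [show 2 * m + 2 - 1 = 2 * m + 1 by omega, hodd b m hm] at this
    linarith
  have hpair : ∀ m < k, y (rung (2 * m + 1)) + y (rung (2 * m + 2)) = 1 := by
    intro m hm
    have := (sum_edgeCut_block hk hv (j := 2 * m + 1) (by omega) (by omega)).symm.trans
      (hblock m hm)
    rw [Nat.add_sub_cancel, hL _ m hm, hL _ m hm, show 2 * m + 1 + 1 = 2 * m + 2 by omega,
      hR _ m hm, hR _ m hm] at this
    linarith
  have hhalf : ∀ m < k, y (rung (2 * m + 1)) = 1 / 2 := by
    intro m
    induction m with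
    | zero =>
      intro hm
      have := (sum_edgeCut_bottom hk hv true).symm.trans (hy.2.1 _)
      have e1 := hL true 0 hm
      have e2 := hL false 0 hm
      rw [mul_zero] at e1 e2
      rw [h1 _ (donutPoint_donutEdge hk), e1, e2] at this
      linarith
    | succ m ih =>
      intro hm
      have e1 := ih (by omega)
      have e2 := hpair m (by omega)
      have e3 := hR true m (by omega)
      have e4 := hL true (m + 1) hm
      rw [show 2 * (m + 1) = 2 * m + 2 by ring] at e4 ⊢
      linarith
  have hhalf' : ∀ j, 1 ≤ j → j ≤ 2 * k → y (rung j) = 1 / 2 := by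
    intro j hj1 hj
    obtain ⟨m, rfl | rfl⟩ : ∃ m, j = 2 * m + 1 ∨ j = 2 * m + 2 := ⟨(j - 1) / 2, by omega⟩
    · exact hhalf m (by omega)
    · linarith [hhalf m (by omega), hpair m (by omega)]
  funext e
  by_cases he0 : e = donutEdge k
  · rw [he0, donutPoint_donutEdge hk, h1 _ (donutPoint_donutEdge hk)]
  by_cases he : IsLadderEdge e
  · rcases he with ⟨b, j, hj, rfl⟩ | ⟨j, hj1, hj, rfl⟩
    · rcases Nat.even_or_odd j with h | h
      · rw [donutPoint_rail_even hk b hj h]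
        obtain ⟨m, rfl⟩ := h.two_dvd
        rcases Nat.lt_or_ge m k with hm | hm
        · rw [hL b m hm, hhalf m hm]
          norm_num
        · obtain ⟨n, rfl⟩ : ∃ n, m = n + 1 := ⟨m - 1, by omega⟩
          rw [show 2 * (n + 1) = 2 * n + 2 by ring, hR b n (by omega),
            hhalf' _ (by omega) (by omega)]
          norm_num
      · rw [donutPoint_rail_odd hk b hj h, h1 _ (donutPoint_rail_odd hk b hj h)]
    · rw [donutPoint_rung hk hj1 hj, hhalf' j hj1 hj]
  · rw [hv e he he0, donutPoint_eq_zero hk he he0]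

theorem donutPoint_mem_extremePoints (hk : 0 < k) :
    donutPoint k ∈ (subtourPolytope (DonutVertex k)).extremePoints ℝ := by
  rw [mem_extremePoints_iff_left]
  refine ⟨donutPoint_mem_subtourPolytope hk, fun y hy z hz hseg => ?_⟩
  obtain ⟨a, b, ha, hb, hab, hx⟩ := hseg
  have hxe : ∀ e, a * y e + b * z e = donutPoint k e := fun e => by
    simpa using congrFun hx e
  -- In a convex combination with positive weights, a lower bound that is attained by the
  -- combination is attained by both points.
  have tight : ∀ r s c : ℝ, c ≤ r → c ≤ s → a * r + b * s = c → r = c := by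
    intro r s c hr hs h
    have h1 : a * (r - c) + b * (s - c) = 0 := by
      linear_combination h - c * hab
    have h2 := mul_nonneg hb.le (sub_nonneg.2 hs)
    have h3 := mul_nonneg ha.le (sub_nonneg.2 hr)
    have h4 : a * (r - c) = 0 := by linarith
    rcases mul_eq_zero.1 h4 with h | h <;> linarith
  have hv := vanishesOff_donutPoint hk
  refine eq_donutPoint_of_tight hk hy ?_ ?_ ?_
  · intro e he
    exact tight _ (z e) 0 (hy.2.2.2 e).1 (hz.2.2.2 e).1 ((hxe e).trans he)
  · intro e he
    have := tight (-y e) (-z e) (-1) (by linarith [(hy.2.2.2 e).2])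
      (by linarith [(hz.2.2.2 e).2]) (by linarith [hxe e])
    linarith
  · intro m hm
    have hne : (block (2 * m + 1) : Finset (DonutVertex k)).Nonempty :=
      ⟨ladder true (2 * m + 1), (ladder_mem_block (by omega)).2 (Or.inl rfl)⟩
    have huniv : (block (2 * m + 1) : Finset (DonutVertex k)) ≠ Finset.univ := by
      intro h
      have : (ladder true 0 : DonutVertex k) ∈ block (2 * m + 1) := h ▸ Finset.mem_univ _
      rw [ladder_mem_block (by omega)] at this
      omega
    refine tight _ (∑ e ∈ edgeCut (block (2 * m + 1)), z e) 2 (hy.2.2.1 _ hne huniv)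
      (hz.2.2.1 _ hne huniv) ?_
    rw [Finset.mul_sum, Finset.mul_sum, ← Finset.sum_add_distrib,
      Finset.sum_congr rfl fun e _ => hxe e, sum_edgeCut_block hk hv (by omega) (by omega),
      donutPoint_rail_even hk _ (by omega) (by simp), donutPoint_rail_even hk _ (by omega) (by simp),
      donutPoint_rail_even hk _ (by omega) (by simp +decide [Nat.even_add]),
      donutPoint_rail_even hk _ (by omega) (by simp +decide [Nat.even_add])]
    norm_num

end Donut

/-! ### The spanning trees in the support of `donutPoint` -/

namespace Donut

variable {k : ℕ}

/-- Whether the tree with bits `ω` contains the rung at height `j`. -/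
def rungBit (ω : ℕ → Bool) (j : ℕ) : Bool := if j % 2 = 1 then ω j else !ω (j - 1)

theorem rungBit_odd (ω : ℕ → Bool) (m : ℕ) : rungBit ω (2 * m + 1) = ω (2 * m + 1) := by
  rw [rungBit, if_pos (by omega)]

theorem rungBit_even (ω : ℕ → Bool) (m : ℕ) : rungBit ω (2 * m + 2) = !ω (2 * m + 1) := by
  rw [rungBit, if_neg (by omega)]
  rfl

/-- The edges selected by the bits `ω`: all rails at odd heights, one of the two rails at every
even height, and one of the two rungs of every block. -/
def IsSelected (ω : ℕ → Bool) (e : Sym2 (DonutVertex k)) : Prop :=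
  (∃ b, ∃ j ≤ 2 * k, (j % 2 = 1 ∨ ω j = b) ∧ e = rail b j) ∨
    ∃ j, 1 ≤ j ∧ j ≤ 2 * k ∧ rungBit ω j = true ∧ e = rung j

open Classical in
/-- The spanning tree with the bits `ω`. -/
noncomputable def tree (k : ℕ) (ω : ℕ → Bool) : Finset (Sym2 (DonutVertex k)) :=
  (ladderEdges k).filter fun e => IsSelected ω e

theorem mem_tree {ω : ℕ → Bool} {e : Sym2 (DonutVertex k)} : e ∈ tree k ω ↔ IsSelected ω e := by
  classical
  rw [tree, Finset.mem_filter, mem_ladderEdges, and_iff_right_iff_imp]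
  rintro (⟨b, j, hj, -, he⟩ | ⟨j, h1, hj, -, he⟩)
  · exact Or.inl ⟨b, j, hj, he⟩
  · exact Or.inr ⟨j, h1, hj, he⟩

theorem isLadderEdge_of_mem_tree {ω : ℕ → Bool} {e : Sym2 (DonutVertex k)} (h : e ∈ tree k ω) :
    IsLadderEdge e := by
  classical
  exact mem_ladderEdges.1 (Finset.mem_filter.1 h).1

theorem rail_mem_tree (hk : 0 < k) {ω : ℕ → Bool} {b : Bool} {j : ℕ} (hj : j ≤ 2 * k) :
    rail b j ∈ tree k ω ↔ j % 2 = 1 ∨ ω j = b := by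
  rw [mem_tree]
  constructor
  · rintro (⟨b', j', hj', h, he⟩ | ⟨j', -, hj', -, he⟩)
    · obtain ⟨rfl, rfl⟩ := (rail_inj hk hj hj').1 he
      exact h
    · exact absurd he (rail_ne_rung hj (by omega))
  · exact fun h => Or.inl ⟨b, j, hj, h, rfl⟩

theorem rung_mem_tree {ω : ℕ → Bool} {j : ℕ} (h1 : 1 ≤ j) (hj : j ≤ 2 * k) :
    rung j ∈ tree k ω ↔ rungBit ω j = true := by
  rw [mem_tree]
  constructor
  · rintro (⟨b', j', hj', h, he⟩ | ⟨j', -, hj', h, he⟩)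
    · exact absurd he.symm (rail_ne_rung hj' (by omega))
    · obtain rfl := (rung_inj (by omega) (by omega)).1 he
      exact h
  · exact fun h => Or.inr ⟨j, h1, hj, h, rfl⟩

theorem sum_tree {α : Type*} [AddCommMonoid α] (hk : 0 < k) (ω : ℕ → Bool)
    (f : Sym2 (DonutVertex k) → α) :
    ∑ e ∈ tree k ω, f e =
      ∑ m ∈ Finset.range k, (f (rail true (2 * m + 1)) + f (rail false (2 * m + 1)) +
        f (rung (if ω (2 * m + 1) then 2 * m + 1 else 2 * m + 2))) +
      ∑ m ∈ Finset.range (k + 1), f (rail (ω (2 * m)) (2 * m)) := by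
  classical
  have h1 : ∑ e ∈ tree k ω, f e = ∑ e ∈ ladderEdges k, if e ∈ tree k ω then f e else 0 := by
    rw [← Finset.sum_filter]
    congr 1
    ext e
    rw [Finset.mem_filter, mem_ladderEdges]
    exact ⟨fun h => ⟨isLadderEdge_of_mem_tree h, h⟩, fun h => h.2⟩
  rw [h1, sum_ladderEdges hk, sum_range_two_mul_add_one, sum_Icc_two_mul, add_right_comm,
    ← Finset.sum_add_distrib]
  congr 1
  · refine Finset.sum_congr rfl fun m hm => ?_
    have := Finset.mem_range.1 hm
    simp only [rail_mem_tree hk (show 2 * m + 1 ≤ 2 * k by omega),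
      rung_mem_tree (show 1 ≤ 2 * m + 1 by omega) (show 2 * m + 1 ≤ 2 * k by omega),
      rung_mem_tree (show 1 ≤ 2 * m + 2 by omega) (show 2 * m + 2 ≤ 2 * k by omega),
      rungBit_odd, rungBit_even, show (2 * m + 1) % 2 = 1 by omega, true_or, if_true]
    cases ω (2 * m + 1) <;> simp
  · refine Finset.sum_congr rfl fun m hm => ?_
    have := Finset.mem_range.1 hm
    simp only [rail_mem_tree hk (show 2 * m ≤ 2 * k by omega), show ¬ (2 * m) % 2 = 1 by omega,
      false_or]
    cases ω (2 * m) <;> simp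

theorem card_tree (hk : 0 < k) (ω : ℕ → Bool) : (tree k ω).card = 4 * k + 1 := by
  rw [Finset.card_eq_sum_ones, sum_tree hk]
  simp
  omega

/-- The number of edges is one less than the number of vertices, so connectedness suffices. Climbing
from $w_1$, the selected rail reaches one vertex of the next block, and the two block rails with
either rung connect all four. -/
theorem isSpanningTree_tree (hk : 0 < k) (ω : ℕ → Bool) : IsSpanningTree (tree k ω) := by
  refine ⟨fun e he => (isLadderEdge_of_mem_tree he).not_isDiag, ?_⟩
  rw [SimpleGraph.isTree_iff_connected_and_card]
  set G := SimpleGraph.fromEdgeSet (tree k ω : Set (Sym2 (DonutVertex k))) with hG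
  have hadj : ∀ a b : DonutVertex k, s(a, b) ∈ tree k ω → G.Adj a b := by
    intro a b h
    rw [hG, SimpleGraph.fromEdgeSet_adj]
    exact ⟨h, fun hab => (isLadderEdge_of_mem_tree h).not_isDiag (Sym2.mk_isDiag_iff.2 hab)⟩
  have hrail : ∀ b j, j ≤ 2 * k → (j % 2 = 1 ∨ ω j = b) →
      G.Reachable (ladder b j) (ladder b (j + 1)) := fun b j hj h =>
    (hadj _ _ ((rail_mem_tree hk hj).2 h)).reachable
  have hrung : ∀ b b' j, 1 ≤ j → j ≤ 2 * k → rungBit ω j = true →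
      G.Reachable (ladder b j) (ladder b' j) := by
    intro b b' j h1 hj h
    have := (hadj _ _ ((rung_mem_tree h1 hj).2 h)).reachable
    cases b <;> cases b'
    · rfl
    · exact this.symm
    · exact this
    · rfl
  have hblock : ∀ m ≤ k, (∀ b, G.Reachable w₁ (ladder b (2 * m))) ∧
      (0 < m → ∀ b, G.Reachable w₁ (ladder b (2 * m - 1))) := by
    intro m
    induction m with
    | zero => exact fun _ => ⟨fun b => by rw [mul_zero, ladder_zero], by simp⟩
    | succ m ih =>
      intro hm
      have h0 := (ih (by omega)).1
      have h1 := (h0 (ω (2 * m))).trans (hrail (ω (2 * m)) (2 * m) (by omega) (Or.inr rfl))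
      have hodd : ∀ b, G.Reachable (ladder b (2 * m + 1)) (ladder b (2 * m + 2)) := fun b =>
        hrail b (2 * m + 1) (by omega) (Or.inl (by omega))
      have h2 := h1.trans (hodd _)
      have hall : (∀ b, G.Reachable w₁ (ladder b (2 * m + 1))) ∧
          ∀ b, G.Reachable w₁ (ladder b (2 * m + 2)) := by
        cases hw : ω (2 * m + 1)
        · have hr : ∀ b b', G.Reachable (ladder b (2 * m + 2)) (ladder b' (2 * m + 2)) :=
            fun b b' => hrung b b' _ (by omega) (by omega) (by rw [rungBit_even, hw]; rfl)
          have h3 : ∀ b, G.Reachable w₁ (ladder b (2 * m + 2)) := fun b => h2.trans (hr _ b)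
          exact ⟨fun b => (h3 b).trans (hodd b).symm, h3⟩
        · have hr : ∀ b b', G.Reachable (ladder b (2 * m + 1)) (ladder b' (2 * m + 1)) :=
            fun b b' => hrung b b' _ (by omega) (by omega) (by rw [rungBit_odd, hw])
          have h3 : ∀ b, G.Reachable w₁ (ladder b (2 * m + 1)) := fun b => h1.trans (hr _ b)
          exact ⟨h3, fun b => (h3 b).trans (hodd b)⟩
      exact ⟨hall.2, fun _ => hall.1⟩
  have hreach : ∀ a, G.Reachable w₁ a := by
    intro a
    obtain ⟨b, j, hj, rfl⟩ := exists_eq_ladder a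
    obtain ⟨m, rfl | rfl⟩ : ∃ m, j = 2 * m ∨ j = 2 * m + 1 := ⟨j / 2, by omega⟩
    · exact (hblock m (by omega)).1 b
    · rcases Nat.lt_or_ge m k with hm | hm
      · exact (hblock (m + 1) (by omega)).2 (by omega) b
      · obtain rfl : m = k := by omega
        rw [ladder_top, ← ladder_top (ω (2 * m))]
        exact ((hblock m le_rfl).1 _).trans (hrail _ _ le_rfl (Or.inr rfl))
  have : Nonempty (DonutVertex k) := ⟨w₁⟩
  refine ⟨⟨fun a b => (hreach a).symm.trans (hreach b)⟩, ?_⟩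
  have hedge : G.edgeSet = (tree k ω : Set (Sym2 (DonutVertex k))) := by
    rw [hG, SimpleGraph.edgeSet_fromEdgeSet, sdiff_eq_left, Set.disjoint_left]
    exact fun e he => (isLadderEdge_of_mem_tree (Finset.mem_coe.1 he)).not_isDiag
  rw [hedge, Nat.card_eq_fintype_card (α := DonutVertex k), card_donutVertex,
    Nat.card_eq_card_toFinset, Finset.toFinset_coe, card_tree hk]

/-- A spanning tree contains a rail at every height. -/
theorem exists_rail_mem {X : Finset (Sym2 (DonutVertex k))}
    (hX : IsSpanningTree X) (hl : ∀ e ∈ X, IsLadderEdge e) {j : ℕ} (hj : j ≤ 2 * k) :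
    rail true j ∈ X ∨ rail false j ∈ X := by
  by_contra hc
  rw [not_or] at hc
  -- Without a rail at height `j`, no edge leaves the set of heights at most `j`.
  have hstep : ∀ a b, (SimpleGraph.fromEdgeSet (X : Set (Sym2 (DonutVertex k)))).Adj a b →
      height a ≤ j → height b ≤ j := by
    intro a b hab ha
    rw [SimpleGraph.fromEdgeSet_adj, Finset.mem_coe] at hab
    have hmem := hab.1
    rcases hl _ hab.1 with ⟨c, i, hi, he⟩ | ⟨i, hi1, hi, he⟩
    · have hij : i ≠ j := by
        rintro rfl
        rw [he] at hmem
        cases c <;> tauto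
      rcases Sym2.eq_iff.1 he with ⟨rfl, rfl⟩ | ⟨rfl, rfl⟩ <;>
      · rw [height_ladder _ (by omega)] at ha ⊢
        omega
    · rcases Sym2.eq_iff.1 he with ⟨rfl, rfl⟩ | ⟨rfl, rfl⟩ <;>
      · rw [height_ladder _ (by omega)] at ha ⊢
        omega
  have hwalk : ∀ a b, (SimpleGraph.fromEdgeSet (X : Set (Sym2 (DonutVertex k)))).Reachable a b →
      height a ≤ j → height b ≤ j := by
    rintro a b ⟨p⟩
    induction p with
    | nil => exact id
    | cons h p ih => exact fun ha => ih (hstep _ _ h ha)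
  have := hwalk (ladder true 0) (ladder true (j + 1)) (hX.2.connected.preconnected _ _)
    (by rw [height_ladder _ (by omega)]; omega)
  rw [height_ladder _ (by omega)] at this
  omega

/-- A spanning tree that contains the rails of a block contains at most one of its rungs. -/
theorem not_rung_and_rung_mem {X : Finset (Sym2 (DonutVertex k))} (hX : IsSpanningTree X)
    {j : ℕ} (hj : j + 1 ≤ 2 * k) (hr : ∀ b, rail b j ∈ X) :
    ¬ (rung j ∈ X ∧ rung (j + 1) ∈ X) := by
  rintro ⟨ha, hb⟩
  have hne : ∀ {a b : DonutVertex k}, s(a, b) ∈ X → a ≠ b := fun h hab =>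
    hX.1 _ h (Sym2.mk_isDiag_iff.2 hab)
  have hbr := SimpleGraph.isAcyclic_iff_forall_adj_isBridge.1 hX.2.isAcyclic
    (v := ladder true j) (w := ladder false j)
    ((SimpleGraph.fromEdgeSet_adj _).2 ⟨ha, hne ha⟩)
  rw [SimpleGraph.isBridge_iff, SimpleGraph.deleteEdges_fromEdgeSet] at hbr
  refine hbr ?_
  have key : ∀ {a b : DonutVertex k}, s(a, b) ∈ X → s(a, b) ≠ rung j →
      (SimpleGraph.fromEdgeSet ((X : Set (Sym2 (DonutVertex k))) \
        {s(ladder true j, ladder false j)})).Reachable a b := fun h h' =>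
    SimpleGraph.Adj.reachable ((SimpleGraph.fromEdgeSet_adj _).2 ⟨⟨h, h'⟩, hne h⟩)
  -- The other three sides of the square still join the ends of the lower rung, so it is not a
  -- bridge.
  refine (key (hr true) (rail_ne_rung (by omega) (by omega))).trans
    ((key hb ?_).trans (key (hr false) (rail_ne_rung (by omega) (by omega))).symm)
  intro h
  have := (rung_inj (by omega) (by omega)).1 h
  omega

theorem eq_tree (hk : 0 < k) {X : Finset (Sym2 (DonutVertex k))} {ω : ℕ → Bool}
    (hl : ∀ e ∈ X, IsLadderEdge e) (hrail : ∀ b, ∀ j ≤ 2 * k, rail b j ∈ X ↔ j % 2 = 1 ∨ ω j = b)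
    (hrung : ∀ j, 1 ≤ j → j ≤ 2 * k → (rung j ∈ X ↔ rungBit ω j = true)) : X = tree k ω := by
  ext e
  by_cases he : IsLadderEdge e
  · rcases he with ⟨b, j, hj, rfl⟩ | ⟨j, h1, hj, rfl⟩
    · rw [hrail b j hj, rail_mem_tree hk hj]
    · rw [hrung j h1 hj, rung_mem_tree h1 hj]
  · exact ⟨fun h => absurd (hl e h) he, fun h => absurd (isLadderEdge_of_mem_tree h) he⟩

theorem donutEdge_notMem_tree (hk : 0 < k) (ω : ℕ → Bool) : donutEdge k ∉ tree k ω :=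
  fun h => (isLadderEdge_of_mem_tree h).ne_donutEdge hk rfl

end Donut

/-! ### Uniform bits -/

/-- The truth values of membership in `A`. -/
def bits (A : Finset ℕ) (j : ℕ) : Bool := decide (j ∈ A)

theorem bits_symmDiff (A : Finset ℕ) (i j : ℕ) :
    bits (symmDiff A {j}) i = if i = j then !bits A i else bits A i := by
  simp only [bits, Finset.mem_symmDiff, Finset.mem_singleton]
  split_ifs with h
  · subst h
    by_cases hi : i ∈ A <;> simp [hi]
  · simp [h]

theorem sum_powerset_symmDiff {n j : ℕ} (hj : j < n) (f : Finset ℕ → ℝ) :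
    ∑ A ∈ (Finset.range n).powerset, f (symmDiff A {j}) =
      ∑ A ∈ (Finset.range n).powerset, f A := by
  have hmem : ∀ A ∈ (Finset.range n).powerset, symmDiff A {j} ∈ (Finset.range n).powerset := by
    intro A hA
    rw [Finset.mem_powerset] at hA ⊢
    intro i hi
    rw [Finset.mem_symmDiff, Finset.mem_singleton] at hi
    rcases hi with ⟨hi, -⟩ | ⟨rfl, -⟩
    · exact hA hi
    · exact Finset.mem_range.2 hj
  exact Finset.sum_nbij' (fun A => symmDiff A {j}) (fun A => symmDiff A {j}) hmem hmem
    (fun A _ => symmDiff_symmDiff_cancel_right _ _) (fun A _ => symmDiff_symmDiff_cancel_right _ _)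
    fun _ _ => rfl

theorem sum_powerset_eq_zero {n j : ℕ} (hj : j < n) (f : Finset ℕ → ℝ)
    (hf : ∀ A, f (symmDiff A {j}) = - f A) : ∑ A ∈ (Finset.range n).powerset, f A = 0 := by
  have := sum_powerset_symmDiff hj f
  simp only [hf, Finset.sum_neg_distrib] at this
  linarith

/-- Toggling the bit `j` is an involution that exchanges the sets with `P` and those without, so
each kind is half of all. -/
theorem sum_powerset_indicator {n j : ℕ} (hj : j < n) (P : Finset ℕ → Prop) [DecidablePred P]
    (hP : ∀ A, P (symmDiff A {j}) ↔ ¬ P A) :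
    ∑ A ∈ (Finset.range n).powerset, (if P A then (1 : ℝ) else 0) = 2 ^ n / 2 := by
  have := sum_powerset_eq_zero hj (fun A => (if P A then (1 : ℝ) else 0) - 1 / 2) (by
    intro A
    simp only [hP]
    split_ifs <;> norm_num)
  rw [Finset.sum_sub_distrib, Finset.sum_const, Finset.card_powerset, Finset.card_range,
    nsmul_eq_mul] at this
  push_cast at this
  linarith

/-! ### The trees given by free bits and their uniform distribution -/

namespace Donut

variable {k : ℕ}

/-- The configurations of the `2k + 1` bits. -/
abbrev configs (k : ℕ) : Finset (Finset ℕ) := (Finset.range (2 * k + 1)).powerset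

/-- The tree reveals its bits: an even bit is the side of the rail at that height, an odd bit the
presence of the rung there. -/
theorem tree_bits_injOn (hk : 0 < k) :
    Set.InjOn (fun A => tree k (bits A)) (configs k : Set (Finset ℕ)) := by
  intro A hA B hB h
  rw [Finset.mem_coe, Finset.mem_powerset] at hA hB
  have hbit : ∀ j ≤ 2 * k, bits A j = bits B j := by
    intro j hj
    rcases Nat.mod_two_eq_zero_or_one j with h0 | h1
    · have := rail_mem_tree hk (ω := bits A) (b := bits A j) hj
      simp only at h
      rw [h, rail_mem_tree hk hj] at this
      have := this.2 (Or.inr rfl)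
      rw [h0] at this
      exact Eq.symm (by simpa using this)
    · have := rung_mem_tree (k := k) (ω := bits A) (j := j) (by omega) hj
      simp only at h
      rw [h, rung_mem_tree (by omega) hj, rungBit, rungBit, if_pos h1, if_pos h1] at this
      exact (Bool.eq_iff_iff.2 this).symm
  ext j
  by_cases hj : j ≤ 2 * k
  · simpa [bits] using hbit j hj
  · constructor
    · intro h
      have := Finset.mem_range.1 (hA h)
      omega
    · intro h
      have := Finset.mem_range.1 (hB h)
      omega

open Classical in
/-- The uniform distribution on the trees in the support of `donutPoint k`. -/
noncomputable def uniformTree (k : ℕ) (X : Finset (Sym2 (DonutVertex k))) : ℝ :=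
  if X ∈ (configs k).image (fun A => tree k (bits A)) then 1 / 2 ^ (2 * k + 1) else 0

theorem sum_uniformTree (hk : 0 < k) (f : Finset (Sym2 (DonutVertex k)) → ℝ) :
    ∑ X, uniformTree k X * f X =
      1 / 2 ^ (2 * k + 1) * ∑ A ∈ configs k, f (tree k (bits A)) := by
  classical
  simp only [uniformTree, ite_mul, zero_mul]
  rw [← Finset.sum_filter, Finset.filter_mem_eq_inter, Finset.univ_inter, ← Finset.mul_sum,
    Finset.sum_image (tree_bits_injOn hk)]

theorem exists_config_of_uniformTree_ne_zero {X : Finset (Sym2 (DonutVertex k))}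
    (h : uniformTree k X ≠ 0) : ∃ A ∈ configs k, tree k (bits A) = X := by
  classical
  rw [uniformTree, ite_ne_right_iff, Finset.mem_image] at h
  exact h.1

theorem uniformTree_nonneg (X : Finset (Sym2 (DonutVertex k))) : 0 ≤ uniformTree k X := by
  rw [uniformTree]
  split_ifs <;> positivity

open Classical in
theorem sum_filter_uniformTree (hk : 0 < k) (e : Sym2 (DonutVertex k)) :
    ∑ X with e ∈ X, uniformTree k X =
      1 / 2 ^ (2 * k + 1) * ∑ A ∈ configs k, if e ∈ tree k (bits A) then (1 : ℝ) else 0 := by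
  rw [← sum_uniformTree hk fun X => if e ∈ X then (1 : ℝ) else 0, Finset.sum_filter]
  simp

/-- Block rails lie in every tree, and each edge of value 1/2 is governed by a single bit, hence
lies in half of the trees. -/
theorem isTreeDistribution_uniformTree (hk : 0 < k) :
    IsTreeDistribution (donutPoint k) (donutEdge k) (uniformTree k) := by
  classical
  have hpow : (2 : ℝ) ^ (2 * k + 1) ≠ 0 := by positivity
  have hhalf : (1 : ℝ) / 2 ^ (2 * k + 1) * (2 ^ (2 * k + 1) / 2) = 1 / 2 := by field_simp
  refine ⟨uniformTree_nonneg, ?_, ?_, ?_⟩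
  · have := sum_uniformTree hk fun _ => 1
    simp only [mul_one] at this
    rw [this]
    simp
  · intro X hX
    obtain ⟨A, -, rfl⟩ := exists_config_of_uniformTree_ne_zero hX
    refine ⟨isSpanningTree_tree hk (bits A), fun e he => ?_⟩
    have := isLadderEdge_of_mem_tree he
    exact ⟨this.donutPoint_ne_zero hk, this.ne_donutEdge hk⟩
  · intro e he
    rw [sum_filter_uniformTree hk]
    by_cases hl : IsLadderEdge e
    · rcases hl with ⟨b, j, hj, rfl⟩ | ⟨j, h1, hj, rfl⟩
      · simp only [rail_mem_tree hk hj]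
        rcases Nat.even_or_odd j with h | h
        · rw [donutPoint_rail_even hk b hj h, sum_powerset_indicator (j := j) (by omega), hhalf]
          intro A
          have := Nat.even_iff.1 h
          rw [bits_symmDiff, if_pos rfl]
          cases bits A j <;> cases b <;> simp <;> omega
        · rw [donutPoint_rail_odd hk b hj h]
          simp [Nat.odd_iff.1 h]
      · simp only [rung_mem_tree h1 hj]
        -- Both rungs of a block are governed by the bit at its lower height.
        rw [donutPoint_rung hk h1 hj, sum_powerset_indicator
          (j := if j % 2 = 1 then j else j - 1) (by split_ifs <;> omega), hhalf]
        intro A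
        simp only [rungBit]
        split_ifs with h
        · rw [bits_symmDiff, if_pos rfl]
          simp
        · rw [bits_symmDiff, if_pos rfl]
          simp
    · rw [donutPoint_eq_zero hk hl he]
      simp [show ∀ A, e ∉ tree k (bits A) from fun A h => hl (isLadderEdge_of_mem_tree h)]

/-- A nonnegative quantity of mean zero vanishes on the support. This upgrades inequalities valid
for all spanning trees to equalities when the marginals make them tight on average. -/
theorem eq_zero_of_sum_mul_eq_zero {ι : Type*} [Fintype ι] {q f : ι → ℝ} (hq : ∀ i, 0 ≤ q i)
    (hf : ∀ i, q i ≠ 0 → 0 ≤ f i) (h : ∑ i, q i * f i = 0) {i : ι} (hi : q i ≠ 0) : f i = 0 := by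
  have h0 : ∀ j ∈ Finset.univ, 0 ≤ q j * f j := by
    intro j _
    by_cases hj : q j = 0
    · rw [hj, zero_mul]
    · exact mul_nonneg (hq j) (hf j hj)
  have := (Finset.sum_eq_zero_iff_of_nonneg h0).1 h i (Finset.mem_univ i)
  exact (mul_eq_zero.1 this).resolve_left hi

/-- The marginals of `donutPoint k` determine the support of every tree distribution. -/
theorem exists_config_of_ne_zero (hk : 0 < k) {q : Finset (Sym2 (DonutVertex k)) → ℝ}
    (hq : IsTreeDistribution (donutPoint k) (donutEdge k) q) {X : Finset (Sym2 (DonutVertex k))}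
    (hX : q X ≠ 0) : ∃ A ∈ configs k, tree k (bits A) = X := by
  classical
  obtain ⟨hq0, hq1, hqs, hqm⟩ := hq
  have hl : ∀ Y, q Y ≠ 0 → ∀ e ∈ Y, IsLadderEdge e := fun Y hY e he =>
    isLadderEdge_of_donutPoint_ne_zero hk ((hqs Y hY).2 e he).1 ((hqs Y hY).2 e he).2
  have hmarg : ∀ e, IsLadderEdge e → ∑ Y, q Y * (if e ∈ Y then 1 else 0) = donutPoint k e := by
    intro e he
    rw [← hqm e (he.ne_donutEdge hk), Finset.sum_filter]
    simp
  have hrail : ∀ b j, j ≤ 2 * k → IsLadderEdge (rail b j : Sym2 (DonutVertex k)) :=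
    fun b j hj => Or.inl ⟨b, j, hj, rfl⟩
  have hrung : ∀ j, 1 ≤ j → j ≤ 2 * k → IsLadderEdge (rung j : Sym2 (DonutVertex k)) :=
    fun j h1 hj => Or.inr ⟨j, h1, hj, rfl⟩
  have hodd : ∀ Y, q Y ≠ 0 → ∀ b j, j ≤ 2 * k → j % 2 = 1 → rail b j ∈ Y := by
    intro Y hY b j hj h
    have := eq_zero_of_sum_mul_eq_zero hq0 (f := fun Y => 1 - if rail b j ∈ Y then 1 else 0)
      (fun Y _ => by split_ifs <;> norm_num) (by
        simp only [mul_sub, mul_one, Finset.sum_sub_distrib]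
        rw [hq1, hmarg _ (hrail b j hj), donutPoint_rail_odd hk b hj (Nat.odd_iff.2 h), sub_self]) hY
    by_contra hc
    simp [hc] at this
  -- Every tree has at least one of these two rails, and the expected number is 1/2 + 1/2.
  have heven : ∀ j, j ≤ 2 * k → j % 2 = 0 → (rail false j ∈ X ↔ rail true j ∉ X) := by
    intro j hj h
    have := eq_zero_of_sum_mul_eq_zero hq0 (f := fun Y => (if rail true j ∈ Y then (1 : ℝ) else 0) +
        (if rail false j ∈ Y then 1 else 0) - 1)
      (fun Y hY => by
        rcases exists_rail_mem (hqs Y hY).1 (hl Y hY) hj with h | h <;>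
        · rw [if_pos h]
          split_ifs <;> norm_num) (by
        simp only [mul_sub, mul_add, mul_one, Finset.sum_sub_distrib, Finset.sum_add_distrib]
        rw [hq1, hmarg _ (hrail _ j hj), hmarg _ (hrail _ j hj),
          donutPoint_rail_even hk _ hj (Nat.even_iff.2 h),
          donutPoint_rail_even hk _ hj (Nat.even_iff.2 h)]
        norm_num) hX
    by_cases h1 : rail true j ∈ X <;> by_cases h2 : rail false j ∈ X <;> simp [h1, h2] at this ⊢
  -- Every sampled tree has at most one of these two rungs, and the expected number is again 1.
  have hblock : ∀ m < k, (rung (2 * m + 2) ∈ X ↔ rung (2 * m + 1) ∉ X) := by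
    intro m hm
    have := eq_zero_of_sum_mul_eq_zero hq0 (f := fun Y => 1 -
        (if rung (2 * m + 1) ∈ Y then (1 : ℝ) else 0) - (if rung (2 * m + 2) ∈ Y then 1 else 0))
      (fun Y hY => by
        have := not_rung_and_rung_mem (hqs Y hY).1 (j := 2 * m + 1) (by omega)
          fun b => hodd Y hY b _ (by omega) (by omega)
        by_cases h1 : rung (2 * m + 1) ∈ Y
        · rw [if_pos h1, if_neg fun h2 => this ⟨h1, h2⟩]
          norm_num
        · rw [if_neg h1]
          split_ifs <;> norm_num) (by
        simp only [mul_sub, mul_one, Finset.sum_sub_distrib]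
        rw [hq1, hmarg _ (hrung _ (by omega) (by omega)), hmarg _ (hrung _ (by omega) (by omega)),
          donutPoint_rung hk (by omega) (by omega), donutPoint_rung hk (by omega) (by omega)]
        norm_num) hX
    by_cases h1 : rung (2 * m + 1) ∈ X <;> by_cases h2 : rung (2 * m + 2) ∈ X <;>
      simp [h1, h2] at this ⊢
  refine ⟨(Finset.range (2 * k + 1)).filter fun j =>
    if j % 2 = 1 then rung j ∈ X else rail true j ∈ X,
    Finset.mem_powerset.2 (Finset.filter_subset _ _), (eq_tree hk (hl X hX) ?_ ?_).symm⟩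
  · intro b j hj
    rcases Nat.mod_two_eq_zero_or_one j with h | h
    · have := heven j hj h
      cases b
      · simp [bits, h, this, hj]
      · simp [bits, h, hj]
    · simp [h, hodd X hX b j hj h]
  · intro j h1 hj
    obtain ⟨m, rfl | rfl⟩ : ∃ m, j = 2 * m + 1 ∨ j = 2 * m + 2 := ⟨(j - 1) / 2, by omega⟩
    · rw [rungBit_odd]
      simp [bits]
      omega
    · rw [rungBit_even, hblock m (by omega)]
      simp [bits]
      omega

/-! ### Maximality of the uniform distribution -/

/-- This is $\log t\le t-1$ at $t=1/(qN)$, multiplied by $q$. Over $N$ outcomes of total mass 1 the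
right-hand sides add up to $\log N$. -/
theorem neg_mul_log_le {q N : ℝ} (hq : 0 ≤ q) (hN : 0 < N) :
    -(q * Real.log q) ≤ q * Real.log N + 1 / N - q := by
  rcases hq.eq_or_lt with rfl | hq
  · simp [hN.le]
  · have h := Real.log_le_sub_one_of_pos (x := 1 / (q * N)) (by positivity)
    rw [one_div, Real.log_inv, Real.log_mul hq.ne' hN.ne'] at h
    have := mul_le_mul_of_nonneg_left h hq.le
    have e : q * ((q * N)⁻¹ - 1) = 1 / N - q := by field_simp
    linarith

theorem eq_of_neg_mul_log_eq {q N : ℝ} (hq : 0 ≤ q) (hN : 0 < N)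
    (h : -(q * Real.log q) = q * Real.log N + 1 / N - q) : q = 1 / N := by
  rcases hq.eq_or_lt with rfl | hq
  · have : 0 < 1 / N := by positivity
    simp at h
    linarith
  · by_contra hne
    have h1 : 1 / (q * N) ≠ 1 := by
      intro h1
      apply hne
      field_simp at h1 ⊢
      linarith
    have h := Real.log_lt_sub_one_of_pos (x := 1 / (q * N)) (by positivity) h1
    rw [one_div, Real.log_inv, Real.log_mul hq.ne' hN.ne'] at h
    have := mul_lt_mul_of_pos_left h hq
    have e : q * ((q * N)⁻¹ - 1) = 1 / N - q := by field_simp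
    linarith

/-- A probability distribution on `n` outcomes has entropy at most `log n`, with equality only for
the uniform distribution. -/
theorem entropy_le_of_support {ι : Type*} [Fintype ι] {F : Finset ι} (hF : F.Nonempty) {q : ι → ℝ}
    (hq : ∀ i, 0 ≤ q i) (hsum : ∑ i, q i = 1) (hs : ∀ i, q i ≠ 0 → i ∈ F) :
    -∑ i, q i * Real.log (q i) ≤ Real.log F.card ∧
      (-∑ i, q i * Real.log (q i) = Real.log F.card → ∀ i ∈ F, q i = 1 / F.card) := by
  have hN : (0 : ℝ) < F.card := by exact_mod_cast hF.card_pos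
  have h1 : ∑ i ∈ F, q i = 1 := by
    rw [← hsum]
    exact Finset.sum_subset (Finset.subset_univ _) fun i _ hi => by
      by_contra hc
      exact hi (hs i hc)
  have h2 : -∑ i, q i * Real.log (q i) = ∑ i ∈ F, -(q i * Real.log (q i)) := by
    rw [Finset.sum_neg_distrib]
    congr 1
    refine (Finset.sum_subset (Finset.subset_univ _) fun i _ hi => ?_).symm
    rw [show q i = 0 by by_contra hc; exact hi (hs i hc), zero_mul]
  have h3 : ∑ i ∈ F, (q i * Real.log F.card + 1 / F.card - q i) = Real.log F.card := by
    rw [Finset.sum_sub_distrib, Finset.sum_add_distrib, ← Finset.sum_mul, h1, Finset.sum_const,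
      nsmul_eq_mul]
    field_simp
    ring
  have hle : ∀ i ∈ F, -(q i * Real.log (q i)) ≤ q i * Real.log F.card + 1 / F.card - q i :=
    fun i _ => neg_mul_log_le (hq i) hN
  rw [h2]
  refine ⟨(Finset.sum_le_sum hle).trans_eq h3, fun h i hi => ?_⟩
  exact eq_of_neg_mul_log_eq (hq i) hN
    ((Finset.sum_eq_sum_iff_of_le hle).1 (h.trans h3.symm) i hi)

/-- Every competitor lives on the same $2^{2k+1}$ trees, so its entropy is at most the logarithm of
their number, attained only by the uniform distribution. -/
theorem isMaxEntropyDistribution_uniformTree (hk : 0 < k) :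
    IsMaxEntropyDistribution (donutPoint k) (donutEdge k) (uniformTree k) ∧
      ∀ q, IsMaxEntropyDistribution (donutPoint k) (donutEdge k) q → q = uniformTree k := by
  classical
  set F := (configs k).image (fun A => tree k (bits A)) with hF
  have hcard : (F.card : ℝ) = 2 ^ (2 * k + 1) := by
    rw [hF, Finset.card_image_of_injOn (tree_bits_injOn hk), Finset.card_powerset,
      Finset.card_range]
    push_cast
    rfl
  have hne : F.Nonempty := (Finset.powerset_nonempty _).image _
  have hsupp : ∀ q, IsTreeDistribution (donutPoint k) (donutEdge k) q → ∀ X, q X ≠ 0 → X ∈ F := by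
    intro q hq X hX
    obtain ⟨A, hA, rfl⟩ := exists_config_of_ne_zero hk hq hX
    exact Finset.mem_image_of_mem _ hA
  have hle := fun q (hq : IsTreeDistribution (donutPoint k) (donutEdge k) q) =>
    entropy_le_of_support hne hq.1 hq.2.1 (hsupp q hq)
  have hu := isTreeDistribution_uniformTree hk
  have hent : treeEntropy (uniformTree k) = Real.log F.card := by
    have : ∀ X, uniformTree k X * Real.log (uniformTree k X) =
        uniformTree k X * -Real.log F.card := by
      intro X
      rw [uniformTree, ← hF]
      split_ifs
      · rw [hcard, one_div, Real.log_inv]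
      · simp
    rw [treeEntropy, Finset.sum_congr rfl fun X _ => this X, ← Finset.sum_mul, hu.2.1]
    ring
  refine ⟨⟨hu, fun q hq => hent ▸ (hle q hq).1⟩, fun q hq => ?_⟩
  have heq : treeEntropy q = Real.log F.card :=
    le_antisymm (hle q hq.1).1 (hent ▸ hq.2 _ hu)
  have hval := (hle q hq.1).2 heq
  funext X
  rw [uniformTree, ← hF]
  split_ifs with hX
  · rw [hval X hX, hcard]
  · by_contra hc
    exact hX (hsupp q hq.1 X hc)

end Donut

/-! ### The odd vertices of the 1-trees and their matchings -/

namespace Donut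

variable {k : ℕ}

/-- The side of the odd vertex at height `i` of the 1-tree with bits `ω`. -/
def oddBit (ω : ℕ → Bool) (i : ℕ) : Bool :=
  if i % 2 = 1 then ω (i - 1) == ω i else ω (i - 1) != ω i

/-- The odd vertex at height `i` of the 1-tree with bits `ω`. -/
def oddVertex (ω : ℕ → Bool) (i : ℕ) : DonutVertex k := ladder (oddBit ω i) i

theorem oddVertices_aux (hk : 0 < k) (ω : ℕ → Bool) (b : Bool) {i : ℕ} (h1 : 1 ≤ i)
    (hi : i ≤ 2 * k) :
    ((insert (donutEdge k) (tree k ω)).filter fun e => ladder b i ∈ e).card =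
      (if rail b (i - 1) ∈ tree k ω then 1 else 0) + (if rail b i ∈ tree k ω then 1 else 0) +
        if rung i ∈ tree k ω then 1 else 0 := by
  have h : ((insert (donutEdge k) (tree k ω)).filter fun e => ladder b i ∈ e) =
      ({rail b (i - 1), rail b i, rung i} : Finset (Sym2 (DonutVertex k))).filter
        fun e => e ∈ tree k ω := by
    ext e
    simp only [Finset.mem_filter, Finset.mem_insert, Finset.mem_singleton]
    constructor
    · rintro ⟨h, hmem⟩
      refine ⟨eq_of_ladder_mem (h.symm.imp isLadderEdge_of_mem_tree id) h1 hi hmem, ?_⟩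
      rcases h with rfl | h
      · rw [donutEdge_eq true true, Sym2.mem_iff, ladder_inj (by omega) (by omega),
          ladder_inj (by omega) (by omega)] at hmem
        omega
      · exact h
    · rintro ⟨h, hmem⟩
      refine ⟨Or.inr hmem, ?_⟩
      rcases h with rfl | rfl | rfl
      · rw [rail, Nat.sub_add_cancel h1]
        exact Sym2.mem_mk_right _ _
      · exact Sym2.mem_mk_left _ _
      · rw [rung_eq b]
        exact Sym2.mem_mk_left _ _
  rw [h, Finset.card_filter, Finset.sum_insert, Finset.sum_pair, add_assoc]
  · exact rail_ne_rung (by omega) (by omega)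
  · rw [Finset.mem_insert, Finset.mem_singleton, rail_inj hk (by omega) (by omega)]
    rintro (h | h)
    · omega
    · exact rail_ne_rung (by omega) (by omega) h

theorem even_card_bottom (hk : 0 < k) (ω : ℕ → Bool) (b : Bool) :
    ((insert (donutEdge k) (tree k ω)).filter fun e => ladder b 0 ∈ e).card = 2 := by
  have h : ((insert (donutEdge k) (tree k ω)).filter fun e => ladder b 0 ∈ e) =
      {donutEdge k, rail (ω 0) 0} := by
    ext e
    simp only [Finset.mem_filter, Finset.mem_insert, Finset.mem_singleton]
    constructor
    · rintro ⟨h, hmem⟩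
      rcases eq_of_bottom_mem (h.symm.imp isLadderEdge_of_mem_tree id) hmem with rfl | rfl | rfl
      · exact Or.inl rfl
      · have := (rail_mem_tree hk (by omega)).1 (h.resolve_left (rail_ne_donutEdge hk (by omega)))
        simp only [Nat.zero_mod, zero_ne_one, false_or] at this
        rw [this]
        exact Or.inr rfl
      · have := (rail_mem_tree hk (by omega)).1 (h.resolve_left (rail_ne_donutEdge hk (by omega)))
        simp only [Nat.zero_mod, zero_ne_one, false_or] at this
        rw [this]
        exact Or.inr rfl
    · rintro (rfl | rfl)
      · refine ⟨Or.inl rfl, ?_⟩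
        rw [donutEdge_eq b b]
        exact Sym2.mem_mk_left _ _
      · refine ⟨Or.inr ((rail_mem_tree hk (by omega)).2 (Or.inr rfl)), ?_⟩
        rw [rail, ladder_zero, ladder_zero]
        exact Sym2.mem_mk_left _ _
  rw [h, Finset.card_pair (rail_ne_donutEdge hk (by omega)).symm]

theorem even_card_top (hk : 0 < k) (ω : ℕ → Bool) (b : Bool) :
    ((insert (donutEdge k) (tree k ω)).filter fun e => ladder b (2 * k + 1) ∈ e).card = 2 := by
  have h : ((insert (donutEdge k) (tree k ω)).filter fun e => ladder b (2 * k + 1) ∈ e) =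
      {donutEdge k, rail (ω (2 * k)) (2 * k)} := by
    ext e
    simp only [Finset.mem_filter, Finset.mem_insert, Finset.mem_singleton]
    constructor
    · rintro ⟨h, hmem⟩
      rcases eq_of_top_mem (h.symm.imp isLadderEdge_of_mem_tree id) hmem with rfl | rfl | rfl
      · exact Or.inl rfl
      · have := (rail_mem_tree hk (by omega)).1 (h.resolve_left (rail_ne_donutEdge hk (by omega)))
        simp only [Nat.mul_mod_right, zero_ne_one, false_or] at this
        rw [this]
        exact Or.inr rfl
      · have := (rail_mem_tree hk (by omega)).1 (h.resolve_left (rail_ne_donutEdge hk (by omega)))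
        simp only [Nat.mul_mod_right, zero_ne_one, false_or] at this
        rw [this]
        exact Or.inr rfl
    · rintro (rfl | rfl)
      · refine ⟨Or.inl rfl, ?_⟩
        rw [donutEdge_eq b b]
        exact Sym2.mem_mk_right _ _
      · refine ⟨Or.inr ((rail_mem_tree hk (by omega)).2 (Or.inr rfl)), ?_⟩
        rw [rail, ladder_top, ladder_top]
        exact Sym2.mem_mk_right _ _
  rw [h, Finset.card_pair (rail_ne_donutEdge hk (by omega)).symm]

/-- At each height both sides have their block rail and share the rung, while exactly one side has
the other rail. So the two degrees have opposite parity, and exactly one vertex is odd. -/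
theorem ladder_mem_oddVertices (hk : 0 < k) (ω : ℕ → Bool) (b : Bool) {i : ℕ} (h1 : 1 ≤ i)
    (hi : i ≤ 2 * k) :
    ladder b i ∈ oddVertices (insert (donutEdge k) (tree k ω)) ↔ b = oddBit ω i := by
  rw [oddVertices, Finset.mem_filter, and_iff_right (Finset.mem_univ _), oddVertices_aux hk ω b h1 hi]
  simp only [rail_mem_tree hk (show i ≤ 2 * k by omega),
    rail_mem_tree hk (show i - 1 ≤ 2 * k by omega), rung_mem_tree h1 hi, rungBit, oddBit]
  rcases Nat.mod_two_eq_zero_or_one i with h | h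
  · simp only [h, show (i - 1) % 2 = 1 by omega, zero_ne_one, if_false, false_or, true_or, if_true]
    cases b <;> cases ω i <;> cases ω (i - 1) <;> decide
  · simp only [h, show (i - 1) % 2 = 0 by omega, zero_ne_one, if_true, false_or, true_or]
    cases b <;> cases ω i <;> cases ω (i - 1) <;> decide

theorem mem_oddVertices (hk : 0 < k) (ω : ℕ → Bool) (a : DonutVertex k) :
    a ∈ oddVertices (insert (donutEdge k) (tree k ω)) ↔
      ∃ i, 1 ≤ i ∧ i ≤ 2 * k ∧ a = oddVertex ω i := by
  constructor
  · intro h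
    obtain ⟨b, i, hi, rfl⟩ := exists_eq_ladder a
    rcases Nat.eq_zero_or_pos i with rfl | h1
    · rw [oddVertices, Finset.mem_filter, even_card_bottom hk] at h
      exact absurd h.2 (by decide)
    rcases Nat.lt_or_ge (2 * k) i with hlt | hle
    · obtain rfl : i = 2 * k + 1 := by omega
      rw [oddVertices, Finset.mem_filter, even_card_top hk] at h
      exact absurd h.2 (by decide)
    · exact ⟨i, h1, hle, by rw [(ladder_mem_oddVertices hk ω b h1 hle).1 h, oddVertex]⟩
  · rintro ⟨i, h1, hi, rfl⟩
    exact (ladder_mem_oddVertices hk ω _ h1 hi).2 rfl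

theorem oddVertex_inj {ω : ℕ → Bool} {i j : ℕ} (hi : i ≤ 2 * k + 1) (hj : j ≤ 2 * k + 1) :
    (oddVertex ω i : DonutVertex k) = oddVertex ω j ↔ i = j := by
  rw [oddVertex, oddVertex, ladder_inj hi hj]
  constructor
  · exact fun h => h.1
  · rintro rfl
    exact ⟨rfl, Or.inl rfl⟩

/-- The successor in the cycle of the heights `1, …, 2k`. -/
def nxt (k i : ℕ) : ℕ := if i = 2 * k then 1 else i + 1

/-- The predecessor in the cycle of the heights `1, …, 2k`. -/
def prv (k i : ℕ) : ℕ := if i = 1 then 2 * k else i - 1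

/-- The edge between the odd vertices at the height `i` and the next height. -/
def oddEdge (ω : ℕ → Bool) (i : ℕ) : Sym2 (DonutVertex k) :=
  s(oddVertex ω i, oddVertex ω (nxt k i))

/-- The heights of parity `c`. -/
def parityClass (k c : ℕ) : Finset ℕ := (Finset.Icc 1 (2 * k)).filter fun i => i % 2 = c

theorem mem_parityClass {c i : ℕ} : i ∈ parityClass k c ↔ (1 ≤ i ∧ i ≤ 2 * k) ∧ i % 2 = c := by
  rw [parityClass, Finset.mem_filter, Finset.mem_Icc]

/-- The matching of the odd vertices with edges that start at the heights of parity `c`. -/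
def parityMatching (ω : ℕ → Bool) (c : ℕ) : Finset (Sym2 (DonutVertex k)) :=
  (parityClass k c).image (oddEdge ω)

theorem donutOdd_eq (hk : 0 < k) (ω : ℕ → Bool) {j : Fin (2 * k)} {i : ℕ} (h1 : 1 ≤ i) (hi : i ≤ 2 * k)
    (hj : ∀ b, ring b j = ladder b i) :
    donutOdd (insert (donutEdge k) (tree k ω)) j = oddVertex ω i := by
  rw [donutOdd, u, v, hj, hj, oddVertex]
  have hiff := ladder_mem_oddVertices hk ω true h1 hi
  split_ifs with h <;> rw [hiff] at h
  · rw [h]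
  · congr
    cases h' : oddBit ω i
    · rfl
    · exact absurd h'.symm h

theorem donutOdd_edge_eq (hk : 0 < k) (ω : ℕ → Bool) (j : Fin (2 * k)) :
    s(donutOdd (insert (donutEdge k) (tree k ω)) j,
      donutOdd (insert (donutEdge k) (tree k ω)) (nextIdx j)) =
        oddEdge ω (if j.val = 0 then 2 * k else j.val) := by
  have hlt := j.isLt
  rw [oddEdge]
  by_cases h : j.val = 0
  · rw [if_pos h, donutOdd_eq hk ω (i := 2 * k) (by omega) (by omega)
      fun b => ring_eq_ladder_of_zero b h, donutOdd_eq hk ω (i := 1) le_rfl (by omega)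
      fun b => by rw [ring_nextIdx, h], nxt, if_pos rfl]
  · rw [if_neg h, donutOdd_eq hk ω (i := j.val) (by omega) (by omega)
      fun b => ring_eq_ladder b h, donutOdd_eq hk ω (i := j.val + 1) (by omega) (by omega)
      fun b => ring_nextIdx b j, nxt, if_neg (by omega)]

theorem donutMatching₁_eq (hk : 0 < k) (ω : ℕ → Bool) :
    donutMatching₁ (insert (donutEdge k) (tree k ω)) = parityMatching ω 0 := by
  ext e
  simp only [donutMatching₁, parityMatching, Finset.mem_image, Finset.mem_filter,
    Finset.mem_univ, true_and, mem_parityClass, donutOdd_edge_eq hk]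
  constructor
  · rintro ⟨j, hj, rfl⟩
    have := j.isLt
    rw [Nat.even_iff] at hj
    refine ⟨_, ?_, rfl⟩
    split_ifs <;> omega
  · rintro ⟨i, ⟨⟨h1, hi⟩, hp⟩, rfl⟩
    rcases hi.lt_or_eq with hlt | rfl
    · exact ⟨⟨i, hlt⟩, Nat.even_iff.2 hp, by rw [if_neg (by simp; omega)]⟩
    · exact ⟨⟨0, by omega⟩, by simp, by simp⟩

theorem donutMatching₂_eq (hk : 0 < k) (ω : ℕ → Bool) :
    donutMatching₂ (insert (donutEdge k) (tree k ω)) = parityMatching ω 1 := by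
  ext e
  simp only [donutMatching₂, parityMatching, Finset.mem_image, Finset.mem_filter,
    Finset.mem_univ, true_and, mem_parityClass, donutOdd_edge_eq hk]
  constructor
  · rintro ⟨j, hj, rfl⟩
    have := j.isLt
    rw [Nat.odd_iff] at hj
    refine ⟨_, ?_, rfl⟩
    split_ifs <;> omega
  · rintro ⟨i, ⟨⟨h1, hi⟩, hp⟩, rfl⟩
    exact ⟨⟨i, by omega⟩, Nat.odd_iff.2 hp, by rw [if_neg (by simp; omega)]⟩

theorem nxt_bounds (hk : 0 < k) {i : ℕ} (hi : i ≤ 2 * k) :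
    1 ≤ nxt k i ∧ nxt k i ≤ 2 * k ∧ nxt k i % 2 = (i + 1) % 2 := by
  rw [nxt]
  split_ifs <;> omega

theorem prv_bounds (hk : 0 < k) {i : ℕ} (h1 : 1 ≤ i) (hi : i ≤ 2 * k) :
    1 ≤ prv k i ∧ prv k i ≤ 2 * k ∧ prv k i % 2 = (i + 1) % 2 := by
  rw [prv]
  split_ifs <;> omega

theorem nxt_prv {i : ℕ} (h1 : 1 ≤ i) (hi : i ≤ 2 * k) : nxt k (prv k i) = i := by
  rw [nxt, prv]
  split_ifs <;> omega

theorem prv_nxt {i : ℕ} (h1 : 1 ≤ i) : prv k (nxt k i) = i := by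
  rw [nxt, prv]
  split_ifs <;> omega

theorem oddEdge_injOn (hk : 3 ≤ k) (ω : ℕ → Bool) :
    Set.InjOn (oddEdge ω : ℕ → Sym2 (DonutVertex k)) (Finset.Icc 1 (2 * k) : Finset ℕ) := by
  intro i hi j hj h
  rw [Finset.mem_coe, Finset.mem_Icc] at hi hj
  have hni := nxt_bounds (k := k) (by omega) hi.2
  have hnj := nxt_bounds (k := k) (by omega) hj.2
  rw [oddEdge, oddEdge, Sym2.eq_iff, oddVertex_inj (by omega) (by omega),
    oddVertex_inj (by omega) (by omega), oddVertex_inj (by omega) (by omega),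
    oddVertex_inj (by omega) (by omega)] at h
  rcases h with h | ⟨h, h'⟩
  · exact h.1
  · rw [nxt] at h h'
    split_ifs at h h' <;> omega

theorem sum_parityMatching {α : Type*} [AddCommMonoid α] (hk : 3 ≤ k) (ω : ℕ → Bool) (c : ℕ)
    (f : Sym2 (DonutVertex k) → α) :
    ∑ e ∈ parityMatching ω c, f e = ∑ i ∈ parityClass k c, f (oddEdge ω i) := by
  rw [parityMatching, Finset.sum_image]
  exact (oddEdge_injOn hk ω).mono (Finset.coe_subset.2 (Finset.filter_subset _ _))

theorem isPerfectMatchingOn_parityMatching (hk : 3 ≤ k) (ω : ℕ → Bool) {c : ℕ} (hc : c < 2) :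
    IsPerfectMatchingOn (oddVertices (insert (donutEdge k) (tree k ω))) (parityMatching ω c) := by
  constructor
  · intro e he
    obtain ⟨i, hi, rfl⟩ := Finset.mem_image.1 he
    rw [mem_parityClass] at hi
    have hn := nxt_bounds (k := k) (by omega) hi.1.2
    refine ⟨?_, ?_⟩
    · rw [oddEdge, Sym2.mk_isDiag_iff, oddVertex_inj (by omega) (by omega), nxt]
      split_ifs <;> omega
    · intro a ha
      rw [mem_oddVertices (by omega)]
      rcases Sym2.mem_iff.1 ha with rfl | rfl
      · exact ⟨i, hi.1.1, hi.1.2, rfl⟩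
      · exact ⟨nxt k i, hn.1, hn.2.1, rfl⟩
  · intro a ha
    obtain ⟨i, h1, hi, rfl⟩ := (mem_oddVertices (by omega) ω a).1 ha
    have hp := prv_bounds (by omega) h1 hi
    refine ⟨oddEdge ω (if i % 2 = c then i else prv k i), ⟨Finset.mem_image_of_mem _ ?_, ?_⟩, ?_⟩
    · rw [mem_parityClass]
      split_ifs <;> omega
    · split_ifs
      · exact Sym2.mem_mk_left _ _
      · rw [oddEdge, nxt_prv h1 hi]
        exact Sym2.mem_mk_right _ _
    · rintro e ⟨he, hmem⟩
      obtain ⟨j, hj, rfl⟩ := Finset.mem_image.1 he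
      rw [mem_parityClass] at hj
      have hn := nxt_bounds (k := k) (by omega) hj.1.2
      rw [oddEdge, Sym2.mem_iff, oddVertex_inj (by omega) (by omega),
        oddVertex_inj (by omega) (by omega)] at hmem
      rcases hmem with rfl | rfl
      · rw [if_pos hj.2]
      · rw [if_neg (by omega), prv_nxt hj.1.1]

/-- `1` if the odd vertices at the heights `i` and `i + 1` are on different sides. -/
def switch (k : ℕ) (ω : ℕ → Bool) (i : ℕ) : ℕ :=
  if oddBit ω i = oddBit ω (nxt k i) then 0 else 1

theorem donutCost_oddEdge_le (hk : 0 < k) (ω : ℕ → Bool) {i : ℕ} (hi : i ≤ 2 * k) :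
    donutCost k (oddEdge ω i) ≤ 1 + (switch k ω i : ℝ) := by
  have hn := nxt_bounds (k := k) hk hi
  have hadj : (donutGraph k).Adj (ladder (oddBit ω i) i) (ladder (oddBit ω i) (nxt k i)) := by
    rw [nxt]
    split_ifs with h
    · rw [h]
      exact adj_seam hk _
    · exact adj_rail hk _ hi
  refine (donutCost_le_of_adj hk _ (oddBit ω (nxt k i)) hn.1 hn.2.1 hadj).trans_eq ?_
  rw [switch]
  split_ifs <;> simp

/-! ### The minimum cost of a perfect matching on the odd vertices -/

/-- The step from height `i` to the next height is on the shorter way from `a` to `b` around the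
cycle of the heights `1, …, 2k`. -/
def CoversStep (k a b i : ℕ) : Prop := (min a b ≤ i ∧ i < max a b) ↔ max a b - min a b ≤ k

instance (k a b : ℕ) : DecidablePred (CoversStep k a b) := fun _ => by
  unfold CoversStep; infer_instance

/-- The steps between the two heights form one arc. The biconditional in `CoversStep` selects it if
it has length at most $k$, and the complementary arc otherwise. -/
theorem card_coversStep {a b : ℕ} (ha : 1 ≤ a ∧ a ≤ 2 * k) (hb : 1 ≤ b ∧ b ≤ 2 * k) :
    ((Finset.Icc 1 (2 * k)).filter (CoversStep k a b)).card = cycDist k a b := by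
  have hI : Finset.Ico (min a b) (max a b) ⊆ Finset.Icc 1 (2 * k) := by
    intro i hi
    rw [Finset.mem_Ico] at hi
    rw [Finset.mem_Icc]
    omega
  by_cases h : max a b - min a b ≤ k
  · have : (Finset.Icc 1 (2 * k)).filter (CoversStep k a b) = Finset.Ico (min a b) (max a b) := by
      ext i
      rw [Finset.mem_filter, CoversStep, Finset.mem_Ico, Finset.mem_Icc]
      omega
    rw [this, Nat.card_Ico, cycDist]
    omega
  · have : (Finset.Icc 1 (2 * k)).filter (CoversStep k a b) =
        Finset.Icc 1 (2 * k) \ Finset.Ico (min a b) (max a b) := by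
      ext i
      rw [Finset.mem_filter, CoversStep, Finset.mem_sdiff, Finset.mem_Ico, Finset.mem_Icc]
      omega
    rw [this, Finset.card_sdiff_of_subset hI, Nat.card_Ico, Nat.card_Icc, cycDist]
    omega

/-- An arc starts and stops only at its two ends. -/
theorem coversStep_prv_iff {a b i : ℕ} (ha : 1 ≤ a ∧ a ≤ 2 * k) (hb : 1 ≤ b ∧ b ≤ 2 * k)
    (hab : a ≠ b) (hi : 1 ≤ i ∧ i ≤ 2 * k) :
    ¬ (CoversStep k a b (prv k i) ↔ CoversStep k a b i) ↔ i = a ∨ i = b := by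
  rw [CoversStep, CoversStep, prv]
  split_ifs <;> omega

/-- `CoversStep` for the heights of the ends of an edge. -/
def EdgeCovers (e : Sym2 (DonutVertex k)) (i : ℕ) : Prop :=
  Sym2.lift ⟨fun a b => CoversStep k (height a) (height b) i, fun a b => by
    simp only [CoversStep, min_comm, max_comm]⟩ e

/-- `1` if the ends of an edge are on different sides. -/
def sideChange (e : Sym2 (DonutVertex k)) : ℕ :=
  Sym2.lift ⟨fun a b => if side a = side b then 0 else 1, fun a b => by
    simp only [eq_comm]⟩ e

theorem edgeCovers_mk {b b' : Bool} {i j : ℕ} (hi : i ≤ 2 * k + 1) (hj : j ≤ 2 * k + 1) (s : ℕ) :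
    EdgeCovers s((ladder b i : DonutVertex k), ladder b' j) s ↔ CoversStep k i j s := by
  change CoversStep k (height (ladder b i : DonutVertex k)) (height (ladder b' j : DonutVertex k)) s ↔ _
  rw [height_ladder b hi, height_ladder b' hj]

theorem sideChange_mk {b b' : Bool} {i j : ℕ} (hi : 1 ≤ i ∧ i ≤ 2 * k) (hj : 1 ≤ j ∧ j ≤ 2 * k) :
    sideChange s((ladder b i : DonutVertex k), ladder b' j) = if b = b' then 0 else 1 := by
  change (if side (ladder b i : DonutVertex k) = side (ladder b' j : DonutVertex k) then 0 else 1) = _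
  rw [side_ladder b hi.1 hi.2, side_ladder b' hj.1 hj.2]

section MinimumCost

variable {ω : ℕ → Bool} {N : Finset (Sym2 (DonutVertex k))}

theorem exists_of_mem_matching (hk : 0 < k)
    (hN : IsPerfectMatchingOn (oddVertices (insert (donutEdge k) (tree k ω))) N)
    {e : Sym2 (DonutVertex k)} (he : e ∈ N) :
    ∃ a b, (1 ≤ a ∧ a ≤ 2 * k) ∧ (1 ≤ b ∧ b ≤ 2 * k) ∧ a ≠ b ∧
      e = s(oddVertex ω a, oddVertex ω b) := by
  induction e with
  | _ x y =>
    obtain ⟨hd, hm⟩ := hN.1 _ he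
    obtain ⟨a, ha1, ha, rfl⟩ := (mem_oddVertices hk ω x).1 (hm x (Sym2.mem_mk_left _ _))
    obtain ⟨b, hb1, hb, rfl⟩ := (mem_oddVertices hk ω y).1 (hm y (Sym2.mem_mk_right _ _))
    refine ⟨a, b, ⟨ha1, ha⟩, ⟨hb1, hb⟩, ?_, rfl⟩
    rintro rfl
    exact hd (Sym2.mk_isDiag_iff.2 rfl)

open Classical in
/-- The number of edges of `N` that cover the step from height `i` to the next height. -/
noncomputable def coverCount (N : Finset (Sym2 (DonutVertex k))) (i : ℕ) : ℕ :=
  (N.filter fun e => EdgeCovers e i).card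

theorem edgeCovers_prv_iff (hk : 0 < k)
    (hN : IsPerfectMatchingOn (oddVertices (insert (donutEdge k) (tree k ω))) N)
    {e : Sym2 (DonutVertex k)} (he : e ∈ N) {i : ℕ} (hi : 1 ≤ i ∧ i ≤ 2 * k) :
    ¬ (EdgeCovers e (prv k i) ↔ EdgeCovers e i) ↔ oddVertex ω i ∈ e := by
  obtain ⟨a, b, ha, hb, hab, rfl⟩ := exists_of_mem_matching hk hN he
  rw [Sym2.mem_iff, oddVertex_inj (by omega) (by omega), oddVertex_inj (by omega) (by omega),
    oddVertex, oddVertex, edgeCovers_mk (by omega) (by omega), edgeCovers_mk (by omega) (by omega),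
    coversStep_prv_iff ha hb hab hi]

/-- Exactly one edge of `N` ends at height `i`, and it covers one of the two steps at `i`; any other
edge covers both or neither. Hence the parity of the coverage alternates around the cycle. -/
theorem odd_coverCount_add (hk : 0 < k)
    (hN : IsPerfectMatchingOn (oddVertices (insert (donutEdge k) (tree k ω))) N)
    {i : ℕ} (hi : 1 ≤ i ∧ i ≤ 2 * k) : (coverCount N (prv k i) + coverCount N i) % 2 = 1 := by
  classical
  have h1 : (N.filter fun e => oddVertex ω i ∈ e).card = 1 := by
    obtain ⟨e, ⟨he, hie⟩, huniq⟩ := hN.2 (oddVertex ω i)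
      ((mem_oddVertices hk ω _).2 ⟨i, hi.1, hi.2, rfl⟩)
    rw [Finset.card_eq_one]
    refine ⟨e, ?_⟩
    ext e'
    rw [Finset.mem_filter, Finset.mem_singleton]
    exact ⟨fun h => huniq e' h, fun h => h ▸ ⟨he, hie⟩⟩
  have h2 : coverCount N (prv k i) + coverCount N i =
      (N.filter fun e => oddVertex ω i ∈ e).card +
        2 * (N.filter fun e => EdgeCovers e (prv k i) ∧ EdgeCovers e i).card := by
    rw [coverCount, coverCount, Finset.card_filter, Finset.card_filter, Finset.card_filter,
      Finset.card_filter, Finset.mul_sum, ← Finset.sum_add_distrib, ← Finset.sum_add_distrib]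
    refine Finset.sum_congr rfl fun e he => ?_
    simp only [← edgeCovers_prv_iff hk hN he hi]
    by_cases h1 : EdgeCovers e (prv k i) <;> by_cases h2 : EdgeCovers e i <;> simp [h1, h2]
  omega

theorem coverCount_pos {e : Sym2 (DonutVertex k)} (he : e ∈ N) {i : ℕ}
    (h : EdgeCovers e i) : 0 < coverCount N i := by
  classical
  exact Finset.card_pos.2 ⟨e, Finset.mem_filter.2 ⟨he, h⟩⟩

open Classical in
-- The step `i` is covered oddly, its two neighbours evenly. If the direct edge is not in `N`, the
-- edge of `N` at height `i` goes backwards or continues beyond the next height, so a neighbouring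
-- step has positive even coverage, at least 2, which pays for the switch. Everything is doubled
-- because an evenly covered step is shared by two oddly covered ones.
theorem two_add_switch_le (hk : 0 < k)
    (hN : IsPerfectMatchingOn (oddVertices (insert (donutEdge k) (tree k ω))) N)
    {i : ℕ} (hi : 1 ≤ i ∧ i ≤ 2 * k) (h : coverCount N i % 2 = 1) :
    2 + 2 * switch k ω i ≤ 2 * coverCount N i + coverCount N (prv k i) +
      coverCount N (nxt k i) + 2 * if oddEdge ω i ∈ N then switch k ω i else 0 := by
  have hs : switch k ω i ≤ 1 := by
    rw [switch]
    split_ifs <;> omega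
  split_ifs with hmem
  · omega
  have hn := nxt_bounds hk hi.2
  have h1 := odd_coverCount_add hk hN hi
  have h2 := odd_coverCount_add hk hN (i := nxt k i) ⟨hn.1, hn.2.1⟩
  rw [prv_nxt hi.1] at h2
  obtain ⟨e, ⟨he, hie⟩, -⟩ := hN.2 (oddVertex ω i)
    ((mem_oddVertices hk ω _).2 ⟨i, hi.1, hi.2, rfl⟩)
  have hcov := (edgeCovers_prv_iff hk hN he hi).2 hie
  by_cases hp : EdgeCovers e (prv k i)
  · have := coverCount_pos he hp
    omega
  · have hci : EdgeCovers e i := by tauto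
    have hni : oddVertex ω (nxt k i) ∉ e := by
      intro hne
      refine hmem ?_
      have : e = oddEdge ω i := by
        refine ((Sym2.mem_and_mem_iff ?_).1 ⟨hie, hne⟩)
        rw [Ne, oddVertex_inj (by omega) (by omega)]
        rw [nxt]
        split_ifs <;> omega
      exact this ▸ he
    have hcn := (edgeCovers_prv_iff hk hN he (i := nxt k i) ⟨hn.1, hn.2.1⟩).not.2 hni
    rw [prv_nxt hi.1, not_not] at hcn
    have := coverCount_pos he (hcn.1 hci)
    omega

theorem sum_parityClass_nxt (hk : 0 < k) {c : ℕ} (hc : c < 2) (f : ℕ → ℕ) :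
    ∑ i ∈ parityClass k c, f (nxt k i) = ∑ i ∈ parityClass k (1 - c), f i := by
  refine Finset.sum_nbij' (nxt k) (prv k) ?_ ?_ ?_ ?_ fun _ _ => rfl
  · intro i hi
    rw [mem_parityClass] at hi ⊢
    have := nxt_bounds hk hi.1.2
    omega
  · intro i hi
    rw [mem_parityClass] at hi ⊢
    have := prv_bounds hk hi.1.1 hi.1.2
    omega
  · intro i hi
    rw [mem_parityClass] at hi
    exact prv_nxt hi.1.1
  · intro i hi
    rw [mem_parityClass] at hi
    exact nxt_prv hi.1.1 hi.1.2

theorem sum_parityClass_prv (hk : 0 < k) {c : ℕ} (hc : c < 2) (f : ℕ → ℕ) :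
    ∑ i ∈ parityClass k c, f (prv k i) = ∑ i ∈ parityClass k (1 - c), f i := by
  have := sum_parityClass_nxt hk (c := 1 - c) (by omega) fun i => f (prv k i)
  rw [show 1 - (1 - c) = c by omega] at this
  rw [← this]
  refine Finset.sum_congr rfl fun i hi => ?_
  rw [mem_parityClass] at hi
  rw [prv_nxt hi.1.1]

theorem sum_parityClass_add {c : ℕ} (hc : c < 2) (f : ℕ → ℕ) :
    ∑ i ∈ parityClass k c, f i + ∑ i ∈ parityClass k (1 - c), f i =
      ∑ i ∈ Finset.Icc 1 (2 * k), f i := by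
  rw [← Finset.sum_filter_add_sum_filter_not (Finset.Icc 1 (2 * k)) (fun i => i % 2 = c),
    parityClass, parityClass]
  congr 2
  ext i
  rw [Finset.mem_filter, Finset.mem_filter, and_congr_right_iff]
  intro _
  omega

theorem sum_parityClass {α : Type*} [AddCommMonoid α] (f : ℕ → α) :
    ∑ i ∈ parityClass k 0, f i = ∑ m ∈ Finset.range k, f (2 * m + 2) ∧
      ∑ i ∈ parityClass k 1, f i = ∑ m ∈ Finset.range k, f (2 * m + 1) := by
  rw [parityClass, parityClass, Finset.sum_filter, Finset.sum_filter, sum_Icc_two_mul,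
    sum_Icc_two_mul]
  constructor <;> refine Finset.sum_congr rfl fun m _ => ?_
  · rw [if_neg (by omega), if_pos (by omega), zero_add]
  · rw [if_pos (by omega), if_neg (by omega), add_zero]

theorem card_parityClass {c : ℕ} (hc : c < 2) : (parityClass k c).card = k := by
  rw [Finset.card_eq_sum_ones]
  interval_cases c
  · rw [(sum_parityClass _).1]; simp
  · rw [(sum_parityClass _).2]; simp

/-- Every perfect matching on the odd vertices costs at least as much as one of the two parity
matchings. -/
theorem exists_le_cost (hk : 3 ≤ k)
    (hN : IsPerfectMatchingOn (oddVertices (insert (donutEdge k) (tree k ω))) N) :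
    ∃ c < 2, k + ∑ i ∈ parityClass k c, (switch k ω i : ℝ) ≤ ∑ e ∈ N, donutCost k e := by
  classical
  have hk0 : 0 < k := by omega
  -- An edge costs at least the length of its shorter arc plus 1 if it changes sides; the arc
  -- lengths are then counted step by step.
  have hcost : ((∑ i ∈ Finset.Icc 1 (2 * k), coverCount N i + ∑ e ∈ N, sideChange e : ℕ) : ℝ) ≤
      ∑ e ∈ N, donutCost k e := by
    have : ∑ i ∈ Finset.Icc 1 (2 * k), coverCount N i =
        ∑ e ∈ N, ((Finset.Icc 1 (2 * k)).filter fun i => EdgeCovers e i).card := by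
      simp only [coverCount, Finset.card_filter]
      exact Finset.sum_comm
    rw [this, ← Finset.sum_add_distrib]
    push_cast
    refine Finset.sum_le_sum fun e he => ?_
    obtain ⟨a, b, ha, hb, hab, rfl⟩ := exists_of_mem_matching hk0 hN he
    rw [oddVertex, oddVertex, sideChange_mk ha hb]
    have hc := card_coversStep ha hb
    have : ((Finset.Icc 1 (2 * k)).filter fun i =>
        EdgeCovers s((ladder (oddBit ω a) a : DonutVertex k), ladder (oddBit ω b) b) i) =
        (Finset.Icc 1 (2 * k)).filter (CoversStep k a b) :=
      Finset.filter_congr fun i _ => edgeCovers_mk (by omega) (by omega) i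
    rw [this, hc]
    refine le_trans (le_of_eq ?_) (le_donutCost hk0 _ _ ha.1 ha.2 hb.1 hb.2)
    push_cast
    rfl
  obtain ⟨c, hc, hpar⟩ : ∃ c < 2, ∀ i, 1 ≤ i → i ≤ 2 * k →
      (coverCount N i % 2 = 1 ↔ i % 2 = c) := by
    -- Coverage alternates in parity, so the value at step 1 decides which parity class is covered
    -- oddly.
    refine ⟨coverCount N 1 % 2, by omega, fun i => ?_⟩
    induction i with
    | zero => omega
    | succ i ih =>
      intro _ hi
      rcases Nat.eq_zero_or_pos i with rfl | h0
      · have : coverCount N 1 % 2 < 2 := by omega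
        rw [zero_add]
        omega
      · have h1 := odd_coverCount_add hk0 hN (i := i + 1) ⟨by omega, hi⟩
        rw [prv, if_neg (by omega), Nat.add_sub_cancel] at h1
        have := ih h0 (by omega)
        omega
  refine ⟨c, hc, le_trans ?_ hcost⟩
  have hmain : ∑ i ∈ parityClass k c, (2 + 2 * switch k ω i) ≤
      ∑ i ∈ parityClass k c, (2 * coverCount N i + coverCount N (prv k i) +
        coverCount N (nxt k i) + 2 * if oddEdge ω i ∈ N then switch k ω i else 0) := by
    refine Finset.sum_le_sum fun i hi => ?_
    rw [mem_parityClass] at hi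
    exact two_add_switch_le hk0 hN hi.1 ((hpar i hi.1.1 hi.1.2).2 hi.2)
  have hside : ∑ i ∈ parityClass k c, (if oddEdge ω i ∈ N then switch k ω i else 0) ≤
      ∑ e ∈ N, sideChange e := by
    rw [← Finset.sum_filter]
    have h1 : ∀ i ∈ (parityClass k c).filter fun i => oddEdge ω i ∈ N,
        switch k ω i = sideChange (oddEdge ω i : Sym2 (DonutVertex k)) := by
      intro i hi
      rw [Finset.mem_filter, mem_parityClass] at hi
      have hn := nxt_bounds hk0 hi.1.1.2
      rw [oddEdge, oddVertex, oddVertex, sideChange_mk hi.1.1 ⟨hn.1, hn.2.1⟩, switch]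
    rw [Finset.sum_congr rfl h1, ← Finset.sum_image (f := sideChange)
      ((oddEdge_injOn hk ω).mono (by
        intro i hi
        rw [Finset.mem_coe, Finset.mem_filter, mem_parityClass] at hi
        rw [Finset.mem_coe, Finset.mem_Icc]
        exact hi.1.1))]
    refine Finset.sum_le_sum_of_subset ?_
    intro e he
    obtain ⟨i, hi, rfl⟩ := Finset.mem_image.1 he
    exact (Finset.mem_filter.1 hi).2
  simp only [Finset.sum_add_distrib, ← Finset.mul_sum, Finset.sum_const,
    card_parityClass hc, smul_eq_mul] at hmain
  -- Both shifted sums run over the evenly covered class, which therefore also receives the factor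
  -- 2.
  rw [sum_parityClass_nxt hk0 hc, sum_parityClass_prv hk0 hc] at hmain
  have hadd := sum_parityClass_add (k := k) hc (coverCount N)
  have : k + ∑ i ∈ parityClass k c, switch k ω i ≤
      ∑ i ∈ Finset.Icc 1 (2 * k), coverCount N i + ∑ e ∈ N, sideChange e := by omega
  exact_mod_cast this

theorem cost_parityMatching_le (hk : 3 ≤ k) (ω : ℕ → Bool) {c : ℕ} (hc : c < 2) :
    ∑ e ∈ parityMatching ω c, donutCost k e ≤ k + ∑ i ∈ parityClass k c, (switch k ω i : ℝ) := by
  rw [sum_parityMatching hk]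
  refine (Finset.sum_le_sum fun i hi => donutCost_oddEdge_le (by omega) ω
    (mem_parityClass.1 hi).1.2).trans_eq ?_
  rw [Finset.sum_add_distrib, Finset.sum_const, card_parityClass hc]
  simp

/-- If neither were optimal, `exists_le_cost` would make each of the two parity matchings strictly
more expensive than one of the two, which is impossible. -/
theorem exists_isMinCost_parityMatching (hk : 3 ≤ k) (ω : ℕ → Bool) :
    ∃ c < 2, IsMinCostPerfectMatchingOn (donutCost k)
      (oddVertices (insert (donutEdge k) (tree k ω))) (parityMatching ω c) := by
  by_contra! hc
  have key : ∀ c < 2, ∃ c' < 2, ∑ e ∈ parityMatching ω c', donutCost k e <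
      ∑ e ∈ parityMatching ω c, donutCost k e := by
    intro c hc2
    have := hc c hc2
    rw [IsMinCostPerfectMatchingOn, not_and] at this
    have := this (isPerfectMatchingOn_parityMatching hk ω hc2)
    push Not at this
    obtain ⟨N, hN, hlt⟩ := this
    obtain ⟨c', hc', hle⟩ := exists_le_cost hk hN
    exact ⟨c', hc', ((cost_parityMatching_le hk ω hc').trans hle).trans_lt hlt⟩
  obtain ⟨c, hc2, h⟩ := key 0 (by omega)
  obtain ⟨c', hc2', h'⟩ := key 1 (by omega)
  interval_cases c
  · exact lt_irrefl _ h
  · interval_cases c'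
    · exact lt_asymm h h'
    · exact lt_irrefl _ h'

end MinimumCost

end Donut

/-! ### Eulerian tours whose shortcuts are expensive -/

theorem sum_range_succ_ends {α : Type*} [AddCommMonoid α] {k : ℕ} (hk : 0 < k) (f : ℕ → α) :
    ∑ m ∈ Finset.range (k + 1), f m = f 0 + ∑ m ∈ Finset.range (k - 1), f (m + 1) + f k := by
  obtain ⟨n, rfl⟩ : ∃ n, k = n + 1 := ⟨k - 1, by omega⟩
  rw [Finset.sum_range_succ, Finset.sum_range_succ', Nat.add_sub_cancel]
  abel

theorem sum_range_pred_add {α : Type*} [AddCommMonoid α] {k : ℕ} (hk : 0 < k) (f : ℕ → α) :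
    ∑ m ∈ Finset.range k, f m = ∑ m ∈ Finset.range (k - 1), f m + f (k - 1) := by
  obtain ⟨n, rfl⟩ : ∃ n, k = n + 1 := ⟨k - 1, by omega⟩
  rw [Finset.sum_range_succ, Nat.add_sub_cancel]

theorem shortcut_closed {V : Type*} [DecidableEq V] {l : List V} {a b : V} (hab : b ≠ a)
    (ha : a ∉ l) (hb : b ∉ l) : shortcut (a :: (l ++ [b, a])) = a :: (shortcut l ++ [b]) := by
  have hf : (l ++ [b, a]).filter (fun x => !x == a) = l ++ [b] := by
    rw [List.filter_append, List.filter_eq_self.2]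
    · simp [hab]
    · intro x hx
      simpa using fun h : x = a => ha (h ▸ hx)
  rw [shortcut, List.eraseDups_cons, hf, ← shortcut, shortcut_append_of_disjoint,
    shortcut_eq_self (l := [b]) (by simp)]
  intro x hx
  rwa [List.mem_singleton.1 hx]

namespace Donut

variable {k : ℕ}

/-- The multiset of the edges of a walk, as a `pathSum`. -/
abbrev edgeSingleton (a b : DonutVertex k) : Multiset (Sym2 (DonutVertex k)) := {s(a, b)}

/-- The cost of a step of a walk. -/
noncomputable abbrev stepCost (a b : DonutVertex k) : ℝ := donutCost k s(a, b)

theorem add_le_stepCost (hk : 0 < k) (b b' : Bool) {i d : ℕ} (h1 : 1 ≤ i) (hi : i + d ≤ 2 * k)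
    (hd : d ≤ k) : (d : ℝ) + (if b = b' then 0 else 1) ≤
      stepCost (ladder b i) (ladder b' (i + d) : DonutVertex k) := by
  have := le_donutCost hk b b' h1 (by omega : i ≤ 2 * k) (by omega : 1 ≤ i + d) hi
  rwa [show cycDist k i (i + d) = d by rw [cycDist]; omega] at this

theorem add_le_stepCost' (hk : 0 < k) (b b' : Bool) {i d : ℕ} (h1 : 1 ≤ i) (hi : i + d ≤ 2 * k)
    (hd : d ≤ k) : (d : ℝ) + (if b = b' then 0 else 1) ≤
      stepCost (ladder b (i + d)) (ladder b' i : DonutVertex k) := by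
  have := le_donutCost hk b b' (by omega : 1 ≤ i + d) hi h1 (by omega : i ≤ 2 * k)
  rwa [show cycDist k (i + d) i = d by rw [cycDist]; omega] at this

theorem stepCost_nonneg (a b : DonutVertex k) : 0 ≤ stepCost a b := donutCost_nonneg _

theorem pathSum_stepCost_nonneg (l : List (DonutVertex k)) : 0 ≤ pathSum stepCost l := by
  induction l with
  | nil => exact le_rfl
  | cons a l ih =>
    cases l with
    | nil => exact le_rfl
    | cons b l => exact add_nonneg (stepCost_nonneg a b) ih

theorem oddBit_odd (ω : ℕ → Bool) (m : ℕ) : oddBit ω (2 * m + 1) = (ω (2 * m) == ω (2 * m + 1)) := by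
  rw [oddBit, if_pos (by omega)]
  rfl

theorem oddBit_even (ω : ℕ → Bool) (m : ℕ) :
    oddBit ω (2 * m + 2) = (ω (2 * m + 1) != ω (2 * m + 2)) := by
  rw [oddBit, if_neg (by omega)]
  rfl

theorem val_tree (hk : 0 < k) (ω : ℕ → Bool) :
    (insert (donutEdge k) (tree k ω)).val = {donutEdge k} +
      (∑ m ∈ Finset.range k, ({rail true (2 * m + 1)} + {rail false (2 * m + 1)} +
        {rung (if ω (2 * m + 1) then 2 * m + 1 else 2 * m + 2)}) +
      ∑ m ∈ Finset.range (k + 1), {rail (ω (2 * m)) (2 * m)}) := by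
  rw [Finset.insert_val_of_notMem (donutEdge_notMem_tree hk ω), ← Multiset.singleton_add,
    ← Finset.sum_multiset_singleton (tree k ω), sum_tree hk]

theorem val_parityMatching (hk : 3 ≤ k) (ω : ℕ → Bool) :
    (parityMatching ω 0 : Finset (Sym2 (DonutVertex k))).val =
        ∑ m ∈ Finset.range k, {oddEdge ω (2 * m + 2)} ∧
      (parityMatching ω 1 : Finset (Sym2 (DonutVertex k))).val =
        ∑ m ∈ Finset.range k, {oddEdge ω (2 * m + 1)} := by
  rw [← Finset.sum_multiset_singleton (parityMatching ω 0), sum_parityMatching hk,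
    (sum_parityClass _).1, ← Finset.sum_multiset_singleton (parityMatching ω 1),
    sum_parityMatching hk, (sum_parityClass _).2]
  exact ⟨rfl, rfl⟩

/-! #### Matchings inside the blocks -/

/-- The walk through the block at the heights `j`, `j + 1` that is entered on side `a` and left on
side `b`, where `r` tells whether the rung at height `j` is present. -/
def zigzag (a r b : Bool) (j : ℕ) : List (DonutVertex k) :=
  if r then [ladder a j, ladder (!b) (j + 1), ladder (!b) j, ladder b j, ladder b (j + 1)]
  else [ladder a j, ladder a (j + 1), ladder (!a) (j + 1), ladder (!a) j, ladder b (j + 1)]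

/-- The first visits of `zigzag`. -/
def zigzagShort (a r b : Bool) (j : ℕ) : List (DonutVertex k) :=
  if r then [ladder a j, ladder (!b) (j + 1), ladder (!a) j, ladder b (j + 1)]
  else [ladder a j, ladder a (j + 1), ladder (!a) (j + 1), ladder (!a) j]

/-- The walk makes five visits to four vertices. The repeated vertex is the entry if the lower rung
is present, and the exit otherwise. -/
theorem shortcut_zigzag (a r b : Bool) {j : ℕ} (h1 : 1 ≤ j) (hj : j + 1 ≤ 2 * k) :
    shortcut (zigzag a r b j : List (DonutVertex k)) = zigzagShort a r b j := by
  have e1 : ∀ b b', (ladder b j : DonutVertex k) = ladder b' j ↔ b = b' := fun b b' => by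
    rw [ladder_inj (by omega) (by omega)]; simp; omega
  have e2 : ∀ b b', (ladder b (j + 1) : DonutVertex k) = ladder b' (j + 1) ↔ b = b' :=
    fun b b' => by rw [ladder_inj (by omega) (by omega)]; simp; omega
  have e3 : ∀ b b', (ladder b (j + 1) : DonutVertex k) ≠ ladder b' j := fun b b' h => by
    rw [ladder_inj (by omega) (by omega)] at h; omega
  have e4 : ∀ b b', (ladder b j : DonutVertex k) ≠ ladder b' (j + 1) := fun b b' h =>
    e3 _ _ h.symm
  cases a <;> cases r <;> cases b <;>
    simp [zigzag, zigzagShort, shortcut, List.eraseDups_cons, e1, e2, e3, e4]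

theorem height_of_mem_zigzag (a r b : Bool) {j : ℕ} (hj : j + 1 ≤ 2 * k) {x : DonutVertex k}
    (hx : x ∈ zigzag a r b j) : height x = j ∨ height x = j + 1 := by
  have e1 : ∀ b, height (ladder b j : DonutVertex k) = j := fun b => height_ladder b (by omega)
  have e2 : ∀ b, height (ladder b (j + 1) : DonutVertex k) = j + 1 :=
    fun b => height_ladder b (by omega)
  rw [zigzag] at hx
  split_ifs at hx <;>
  · simp only [List.mem_cons, List.not_mem_nil, or_false] at hx
    rcases hx with rfl | rfl | rfl | rfl | rfl <;> simp [e1, e2]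

theorem oddEdge_odd (ω : ℕ → Bool) (m : ℕ) :
    (oddEdge ω (2 * m + 1) : Sym2 (DonutVertex k)) =
      s(ladder (ω (2 * m) == ω (2 * m + 1)) (2 * m + 1),
        ladder (ω (2 * m + 1) != ω (2 * m + 2)) (2 * m + 1 + 1)) := by
  rw [oddEdge, nxt, if_neg (show ¬ 2 * m + 1 = 2 * k by omega), oddVertex, oddVertex, oddBit_odd,
    ← oddBit_even]

theorem oddEdge_even (ω : ℕ → Bool) {m : ℕ} (hm : m + 1 < k) :
    (oddEdge ω (2 * m + 2) : Sym2 (DonutVertex k)) =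
      s(ladder (ω (2 * m + 1) != ω (2 * m + 2)) (2 * m + 2),
        ladder (ω (2 * m + 2) == ω (2 * m + 3)) (2 * m + 2 + 1)) := by
  rw [oddEdge, nxt, if_neg (show ¬ 2 * m + 2 = 2 * k by omega), oddVertex, oddVertex, oddBit_even]
  have := oddBit_odd ω (m + 1)
  rw [show 2 * (m + 1) = 2 * m + 2 by ring] at this
  rw [this]

theorem oddEdge_top (hk : 0 < k) (ω : ℕ → Bool) :
    (oddEdge ω (2 * (k - 1) + 2) : Sym2 (DonutVertex k)) =
      s(ladder (ω (2 * (k - 1) + 1) != ω (2 * (k - 1) + 2)) (2 * (k - 1) + 1 + 1),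
        ladder (ω 0 == ω 1) 1) := by
  rw [oddEdge, nxt, if_pos (show 2 * (k - 1) + 2 = 2 * k by omega), oddVertex, oddVertex, oddBit_even]
  have := oddBit_odd ω 0
  rw [mul_zero, zero_add] at this
  rw [this]

theorem edge_swap (b b' : Bool) (j : ℕ) :
    s((ladder b (j + 1) : DonutVertex k), ladder b' j) = s(ladder b' j, ladder b (j + 1)) :=
  Sym2.eq_swap

theorem rung_swap (j : ℕ) :
    s((ladder false j : DonutVertex k), ladder true j) = s(ladder true j, ladder false j) :=
  Sym2.eq_swap

theorem pathSum_edgeSingleton_zigzag (ω : ℕ → Bool) (m : ℕ) :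
    pathSum edgeSingleton (zigzag (ω (2 * m)) (ω (2 * m + 1)) (ω (2 * m + 2)) (2 * m + 1) :
      List (DonutVertex k)) = {rail true (2 * m + 1)} + {rail false (2 * m + 1)} +
        {rung (if ω (2 * m + 1) then 2 * m + 1 else 2 * m + 2)} + {oddEdge ω (2 * m + 1)} := by
  rw [oddEdge_odd ω m]
  cases ω (2 * m) <;> cases ω (2 * m + 1) <;> cases ω (2 * m + 2) <;>
  · simp only [zigzag, edgeSingleton, rail, rung, pathSum_cons_cons, pathSum_singleton, if_true,
      Bool.false_eq_true, if_false, Bool.not_true, Bool.not_false, edge_swap, rung_swap,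
      beq_self_eq_true, bne_self_eq_false, Bool.false_beq, Bool.true_beq, Bool.false_bne,
      Bool.true_bne]
    abel

theorem head?_zigzag (a r b : Bool) (j : ℕ) :
    (zigzag a r b j : List (DonutVertex k)).head? = some (ladder a j) := by
  cases r <;> rfl

theorem getLast?_zigzag (a r b : Bool) (j : ℕ) :
    (zigzag a r b j : List (DonutVertex k)).getLast? = some (ladder b (j + 1)) := by
  cases r <;> rfl

/-- The last vertex of `zigzagShort`. -/
def zigzagLast (a r b : Bool) (j : ℕ) : DonutVertex k :=
  if r then ladder b (j + 1) else ladder (!a) j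

theorem head?_zigzagShort (a r b : Bool) (j : ℕ) :
    (zigzagShort a r b j : List (DonutVertex k)).head? = some (ladder a j) := by
  cases r <;> rfl

theorem getLast?_zigzagShort (a r b : Bool) (j : ℕ) :
    (zigzagShort a r b j : List (DonutVertex k)).getLast? = some (zigzagLast a r b j) := by
  cases r <;> rfl

/-- With the upper rung there are three unit steps and a jump of cost $2+[a=b]$ into the next block.
With the lower rung the four steps cost at least $1+[a=b]$, $1+[a\ne b]$, $1+[a=b]$ and $1$. Both
totals are $5+[a=b]$. -/
theorem le_cost_zigzagShort (hk : 3 ≤ k) (a r b : Bool) {j : ℕ} (h1 : 1 ≤ j) (hj : j + 3 ≤ 2 * k) :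
    (5 : ℝ) + (if a = b then 1 else 0) ≤ pathSum stepCost (zigzagShort a r b j : List (DonutVertex k)) +
      stepCost (zigzagLast a r b j : DonutVertex k) (ladder b (j + 2)) := by
  have hk0 : 0 < k := by omega
  cases r
  · have c1 := add_le_stepCost hk0 a a (d := 1) h1 (by omega) (by omega)
    have c2 := add_le_stepCost hk0 a (!a) (d := 0) (i := j + 1) (by omega) (by omega) (by omega)
    have c3 := add_le_stepCost' hk0 (!a) (!a) (d := 1) h1 (by omega) (by omega)
    have c4 := add_le_stepCost hk0 (!a) b (d := 2) h1 (by omega) (by omega)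
    simp only [zigzagShort, zigzagLast, pathSum_cons_cons, pathSum_singleton, Bool.false_eq_true,
      if_false]
    cases a <;> cases b <;> norm_num at c1 c2 c3 c4 ⊢ <;> linarith
  · have c1 := add_le_stepCost hk0 a (!b) (d := 1) h1 (by omega) (by omega)
    have c2 := add_le_stepCost' hk0 (!b) (!a) (d := 1) h1 (by omega) (by omega)
    have c3 := add_le_stepCost hk0 (!a) b (d := 1) h1 (by omega) (by omega)
    have c4 := add_le_stepCost hk0 b b (d := 1) (i := j + 1) (by omega) (by omega) (by omega)
    simp only [zigzagShort, zigzagLast, pathSum_cons_cons, pathSum_singleton, if_true]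
    cases a <;> cases b <;> norm_num at c1 c2 c3 c4 ⊢ <;> linarith

theorem height_w₀ : height (w₀ : DonutVertex k) = 2 * k + 1 := rfl

theorem height_w₁ : height (w₁ : DonutVertex k) = 0 := rfl

theorem w₀_ne_w₁ : (w₀ : DonutVertex k) ≠ w₁ := fun h => by
  have := congrArg height h
  rw [height_w₀, height_w₁] at this
  omega

/-- These matching edges stay inside the blocks, so the tour zigzags once through all blocks from
$w_1$ to $w_0$ and returns along $e^+$. Only the first $k-1$ blocks with their outgoing links are
counted. The constant is weaker than the resulting $5k-5$ so as to agree with the bound for the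
other matching. -/
theorem exists_tour_of_odd (hk : 3 ≤ k) (ω : ℕ → Bool) :
    ∃ t, IsEulerianTour ((insert (donutEdge k) (tree k ω)).val + (parityMatching ω 1).val) t ∧
      (5 * k - 10 + ∑ m ∈ Finset.range (k - 1), (if ω (2 * m) = ω (2 * m + 2) then 1 else 0) : ℝ) ≤
        tourCost (donutCost k) (shortcut t) := by
  have hk0 : 0 < k := by omega
  set T : ℕ → List (DonutVertex k) := fun m =>
    zigzag (ω (2 * m)) (ω (2 * m + 1)) (ω (2 * m + 2)) (2 * m + 1) with hT
  set S : ℕ → List (DonutVertex k) := fun m =>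
    zigzagShort (ω (2 * m)) (ω (2 * m + 1)) (ω (2 * m + 2)) (2 * m + 1) with hS
  set fst : ℕ → DonutVertex k := fun m => ladder (ω (2 * m)) (2 * m + 1) with hfst
  set lst : ℕ → DonutVertex k := fun m => ladder (ω (2 * m + 2)) (2 * m + 1 + 1) with hlst
  set slst : ℕ → DonutVertex k := fun m =>
    zigzagLast (ω (2 * m)) (ω (2 * m + 1)) (ω (2 * m + 2)) (2 * m + 1) with hslst
  have hTh : ∀ m < k, (T m).head? = some (fst m) := fun m _ => head?_zigzag _ _ _ _
  have hTl : ∀ m < k, (T m).getLast? = some (lst m) := fun m _ => getLast?_zigzag _ _ _ _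
  have hSh : ∀ m < k, (S m).head? = some (fst m) := fun m _ => head?_zigzagShort _ _ _ _
  have hSl : ∀ m < k, (S m).getLast? = some (slst m) := fun m _ => getLast?_zigzagShort _ _ _ _
  have hheight : ∀ m < k, ∀ x ∈ T m, height x = 2 * m + 1 ∨ height x = 2 * m + 2 :=
    fun m hm x hx => height_of_mem_zigzag _ _ _ (by omega) hx
  have hheight' : ∀ x ∈ (List.range k).flatMap T, 1 ≤ height x ∧ height x ≤ 2 * k := by
    intro x hx
    obtain ⟨m, hm, hx⟩ := List.mem_flatMap.1 hx
    have h1 := List.mem_range.1 hm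
    have := hheight m h1 x hx
    omega
  refine ⟨w₁ :: ((List.range k).flatMap T ++ [w₀, w₁]), ?_, ?_⟩
  · rw [isEulerianTour_iff_pathSum]
    refine ⟨by simp, by rw [List.getLast?_cons, List.getLast?_append]; rfl, ?_⟩
    change pathSum edgeSingleton _ = _
    have hhead : ((List.range k).flatMap T ++ [w₀, w₁]).head? = some (fst 0) := by
      rw [List.head?_append, head?_flatMap_range hk0 hTh]
      rfl
    rw [pathSum_cons _ hhead, pathSum_append _ (getLast?_flatMap_range hk0 hTl) rfl,
      pathSum_flatMap_range _ hTh hTl, val_tree hk0, (val_parityMatching hk ω).2,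
      sum_range_succ_ends hk0, Finset.sum_congr rfl fun m _ =>
      pathSum_edgeSingleton_zigzag ω m]
    have hlink : ∀ m, edgeSingleton (lst m) (fst (m + 1)) =
        {rail (ω (2 * (m + 1))) (2 * (m + 1))} := fun m => rfl
    have hbot : edgeSingleton w₁ (fst 0) = {rail (ω (2 * 0)) (2 * 0)} := by
      rw [edgeSingleton, rail, mul_zero, ladder_zero]
      rfl
    have htop : edgeSingleton (lst (k - 1)) w₀ = {rail (ω (2 * k)) (2 * k)} := by
      rw [edgeSingleton, rail, hlst, ladder_top]
      simp only [show 2 * (k - 1) + 1 + 1 = 2 * k by omega]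
    simp only [hlink, Finset.sum_add_distrib]
    rw [hbot, htop, pathSum_cons_cons, pathSum_singleton,
      show edgeSingleton w₀ w₁ = {donutEdge k} from rfl]
    abel
  · have hshort : shortcut (w₁ :: ((List.range k).flatMap T ++ [w₀, w₁])) =
        w₁ :: ((List.range k).flatMap S ++ [w₀]) := by
      rw [shortcut_closed w₀_ne_w₁, shortcut_flatMap_range]
      · have : (List.range k).flatMap (fun m => shortcut (T m)) = (List.range k).flatMap S := by
          refine List.flatMap_congr fun m hm => ?_
          have := List.mem_range.1 hm
          exact shortcut_zigzag _ _ _ (by omega) (by omega)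
        rw [this]
      · intro m hm m' hm' x hx hx'
        have h2 := hheight m hm x hx
        have h3 := hheight m' (by omega) x hx'
        omega
      · exact fun h => absurd (hheight' _ h).1 (by rw [height_w₁]; omega)
      · exact fun h => absurd (hheight' _ h).2 (by rw [height_w₀]; omega)
    have hhead : ((List.range k).flatMap S ++ ([w₀] ++ [w₁])).head? = some (fst 0) := by
      rw [List.head?_append, head?_flatMap_range hk0 hSh]
      rfl
    rw [hshort, tourCost_cons]
    change _ ≤ pathSum stepCost _
    rw [List.cons_append, List.append_assoc, pathSum_cons _ hhead,
      pathSum_append _ (getLast?_flatMap_range hk0 hSl) rfl, pathSum_flatMap_range _ hSh hSl,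
      sum_range_pred_add hk0, add_right_comm _ (pathSum stepCost (S (k - 1))),
      ← Finset.sum_add_distrib]
    have hblock : ∑ m ∈ Finset.range (k - 1), ((5 : ℝ) + if ω (2 * m) = ω (2 * m + 2) then 1 else 0) ≤
        ∑ m ∈ Finset.range (k - 1), (pathSum stepCost (S m) + stepCost (slst m) (fst (m + 1))) := by
      refine Finset.sum_le_sum fun m hm => ?_
      have := Finset.mem_range.1 hm
      exact le_cost_zigzagShort hk _ _ _ (by omega) (by omega)
    rw [Finset.sum_add_distrib, Finset.sum_const, Finset.card_range, nsmul_eq_mul,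
      Nat.cast_sub (by omega)] at hblock
    push_cast at hblock
    have n1 := stepCost_nonneg (w₁ : DonutVertex k) (fst 0)
    have n2 := pathSum_stepCost_nonneg (S (k - 1))
    have n3 := stepCost_nonneg (slst (k - 1)) w₀
    have n4 := pathSum_stepCost_nonneg ([w₀] ++ [w₁] : List (DonutVertex k))
    linarith

end Donut

/-- In two rounds through disjoint blocks, what the second round skips in a block depends only on
the first visit to that block, so shortcutting is computed block by block. -/
theorem shortcut_flatMap_append_flatMap {V : Type*} [DecidableEq V] {f g h : ℕ → List V} {n : ℕ}
    (hf : ∀ m < n, (f m).Nodup) (hh : ∀ m < n, shortcut (f m ++ g m) = f m ++ h m)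
    (hff : ∀ m < n, ∀ m' < n, m ≠ m' → ∀ a ∈ f m, a ∉ f m')
    (hgg : ∀ m < n, ∀ m' < n, m ≠ m' → ∀ a ∈ g m, a ∉ g m')
    (hgf : ∀ m < n, ∀ m' < n, m ≠ m' → ∀ a ∈ g m, a ∉ f m') :
    shortcut ((List.range n).flatMap f ++ (List.range n).flatMap g) =
      (List.range n).flatMap f ++ (List.range n).flatMap h := by
  have h1 : (List.range n).flatMap (fun m => shortcut (f m)) = (List.range n).flatMap f :=
    List.flatMap_congr fun m hm => shortcut_eq_self (hf m (List.mem_range.1 hm))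
  have h2 : ((List.range n).flatMap g).filter (fun a => a ∉ (List.range n).flatMap f) =
      (List.range n).flatMap fun m => (g m).filter fun a => a ∉ f m := by
    rw [List.filter_flatMap]
    refine List.flatMap_congr fun m hm => List.filter_congr fun a ha => ?_
    have hm := List.mem_range.1 hm
    rw [decide_eq_decide, List.mem_flatMap, not_iff_not]
    refine ⟨fun ⟨m', hm', ha'⟩ => ?_, fun ha' => ⟨m, List.mem_range.2 hm, ha'⟩⟩
    by_contra h
    exact hgf m hm m' (List.mem_range.1 hm') (fun e => h (e ▸ ha')) a ha ha'
  have h3 : (List.range n).flatMap (fun m => shortcut ((g m).filter fun a => a ∉ f m)) =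
      (List.range n).flatMap h := by
    refine List.flatMap_congr fun m hm => ?_
    have := hh m (List.mem_range.1 hm)
    rwa [shortcut_append, shortcut_eq_self (hf m (List.mem_range.1 hm)),
      List.append_cancel_left_eq] at this
  rw [shortcut_append, h2, shortcut_flatMap_range, shortcut_flatMap_range, h1, h3]
  · exact fun m hm m' hm' a ha ha' => hgg m hm m' (by omega) (by omega) a
      (List.mem_of_mem_filter ha) (List.mem_of_mem_filter ha')
  · exact fun m hm m' hm' => hff m hm m' (by omega) (by omega)

namespace Donut

variable {k : ℕ}

/-! #### Matchings between the blocks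

Here the tour runs twice through all the blocks. Every block has one vertex of degree four: the end
of its rung at which a rail to another block is attached. The first pass visits all of these. -/

/-- The walk through the block at the heights `j`, `j + 1` that uses the rail on side `s`. -/
def pass (a r b s : Bool) (j : ℕ) : List (DonutVertex k) :=
  if r then if s = a then [ladder s j, ladder s (j + 1)]
    else [ladder a j, ladder s j, ladder s (j + 1)]
  else if s = b then [ladder s j, ladder s (j + 1)]
    else [ladder s j, ladder s (j + 1), ladder b (j + 1)]

/-- The first vertex of `pass`. -/
def passFirst (a r s : Bool) (j : ℕ) : DonutVertex k := ladder (if r then a else s) j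

/-- The last vertex of `pass`. -/
def passLast (r b s : Bool) (j : ℕ) : DonutVertex k := ladder (if r then s else b) (j + 1)

/-- The vertices of `pass` apart from the vertex of degree four. -/
def passRest (a r b s : Bool) (j : ℕ) : List (DonutVertex k) :=
  if r then if s = a then [ladder s (j + 1)] else [ladder s j, ladder s (j + 1)]
  else if s = b then [ladder s j] else [ladder s j, ladder s (j + 1)]

/-- The first vertex of `passRest`. -/
def restFirst (a r s : Bool) (j : ℕ) : DonutVertex k :=
  ladder s (if r ∧ s = a then j + 1 else j)

/-- The last vertex of `passRest`. -/
def restLast (r b s : Bool) (j : ℕ) : DonutVertex k :=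
  ladder s (if ¬ r ∧ s = b then j else j + 1)

theorem head?_pass (a r b s : Bool) (j : ℕ) :
    (pass a r b s j : List (DonutVertex k)).head? = some (passFirst a r s j) := by
  cases a <;> cases r <;> cases b <;> cases s <;> rfl

theorem getLast?_pass (a r b s : Bool) (j : ℕ) :
    (pass a r b s j : List (DonutVertex k)).getLast? = some (passLast r b s j) := by
  cases a <;> cases r <;> cases b <;> cases s <;> rfl

theorem head?_passRest (a r b s : Bool) (j : ℕ) :
    (passRest a r b s j : List (DonutVertex k)).head? = some (restFirst a r s j) := by
  cases a <;> cases r <;> cases b <;> cases s <;> rfl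

theorem getLast?_passRest (a r b s : Bool) (j : ℕ) :
    (passRest a r b s j : List (DonutVertex k)).getLast? = some (restLast r b s j) := by
  cases a <;> cases r <;> cases b <;> cases s <;> rfl

theorem ladder_eq_iff {j : ℕ} (h1 : 1 ≤ j) (hj : j + 1 ≤ 2 * k) (b b' : Bool) :
    ((ladder b j : DonutVertex k) = ladder b' j ↔ b = b') ∧
    ((ladder b (j + 1) : DonutVertex k) = ladder b' (j + 1) ↔ b = b') ∧
    ((ladder b (j + 1) : DonutVertex k) = ladder b' j ↔ False) ∧
    ((ladder b j : DonutVertex k) = ladder b' (j + 1) ↔ False) := by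
  rw [ladder_inj (by omega) (by omega), ladder_inj (by omega) (by omega),
    ladder_inj (by omega) (by omega), ladder_inj (by omega) (by omega)]
  simp
  omega

theorem nodup_pass {j : ℕ} (h1 : 1 ≤ j) (hj : j + 1 ≤ 2 * k) (a r b s : Bool) :
    (pass a r b s j : List (DonutVertex k)).Nodup := by
  have e := ladder_eq_iff h1 hj
  cases a <;> cases r <;> cases b <;> cases s <;> simp [pass, e]

theorem shortcut_pass {j : ℕ} (h1 : 1 ≤ j) (hj : j + 1 ≤ 2 * k) (a r b s : Bool) :
    shortcut (pass a r b (!s) j ++ pass a r b s j : List (DonutVertex k)) =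
      pass a r b (!s) j ++ passRest a r b s j := by
  have e := ladder_eq_iff h1 hj
  cases a <;> cases r <;> cases b <;> cases s <;>
    simp [pass, passRest, shortcut, List.eraseDups_cons, e]

theorem height_of_mem_pass {j : ℕ} (hj : j + 1 ≤ 2 * k) (a r b s : Bool) {x : DonutVertex k}
    (hx : x ∈ pass a r b s j) : height x = j ∨ height x = j + 1 := by
  have e1 : ∀ b, height (ladder b j : DonutVertex k) = j := fun b => height_ladder b (by omega)
  have e2 : ∀ b, height (ladder b (j + 1) : DonutVertex k) = j + 1 :=
    fun b => height_ladder b (by omega)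
  rw [pass] at hx
  split_ifs at hx <;>
  · simp only [List.mem_cons, List.not_mem_nil, or_false] at hx
    rcases hx with rfl | rfl | rfl <;> simp [e1, e2]

theorem pathSum_edgeSingleton_pass (a r b s : Bool) (j : ℕ) :
    pathSum edgeSingleton (pass a r b (!s) j : List (DonutVertex k)) +
      pathSum edgeSingleton (pass a r b s j) =
        {rail true j} + {rail false j} + {rung (if r then j else j + 1)} := by
  cases a <;> cases r <;> cases b <;> cases s <;>
  · simp only [pass, edgeSingleton, rail, rung, pathSum_cons_cons, pathSum_singleton, if_true,
      Bool.false_eq_true, if_false, Bool.not_true, Bool.not_false, rung_swap, reduceCtorEq]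
    abel

/-- The two passes use the two edges between consecutive blocks. -/
theorem edgeSingleton_link (r b r' s s' : Bool) (i : ℕ) (h : r = true → r' = false → s = s') :
    edgeSingleton (passLast r b (!s) i) (passFirst b r' (!s') (i + 2)) +
      edgeSingleton (passLast r b s i) (passFirst b r' s' (i + 2)) =
        {(rail b (i + 1) : Sym2 (DonutVertex k))} +
          {s(ladder (r != b) (i + 1), ladder (b == r') (i + 2))} := by
  -- With the lower rung before and the upper rung after the link, the passes leave and arrive at
  -- distinct vertices, and both links have to go straight. In all other cases the two links share
  -- an end, so no condition on the sides is needed.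
  cases r <;> cases b <;> cases r' <;> cases s <;> cases s' <;> simp at h <;>
  · simp [passLast, passFirst, edgeSingleton, rail]
    try exact Multiset.pair_comm _ _

/-- Together the two lists visit the four vertices of the block once, which leaves two steps inside
it. -/
theorem cost_pass (hk : 0 < k) (a r b s : Bool) {j : ℕ} (h1 : 1 ≤ j) (hj : j + 1 ≤ 2 * k) :
    (2 : ℝ) ≤ pathSum stepCost (pass a r b (!s) j : List (DonutVertex k)) +
      pathSum stepCost (passRest a r b s j : List (DonutVertex k)) := by
  have c1 := fun b b' => add_le_stepCost hk b b' (d := 1) h1 (by omega) (by omega)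
  have c2 := fun b => add_le_stepCost hk b (!b) (d := 0) h1 (by omega) (by omega)
  have c3 := fun b => add_le_stepCost hk b (!b) (d := 0) (i := j + 1) (by omega) (by omega)
    (by omega)
  have c1t := c1 true true
  have c1f := c1 false false
  have c2t := c2 true
  have c2f := c2 false
  have c3t := c3 true
  have c3f := c3 false
  norm_num at c1t c1f c2t c2f c3t c3f
  cases a <;> cases r <;> cases b <;> cases s <;> simp [pass, passRest] <;> linarith

/-- The second pass does not gain by skipping the vertices of degree four. -/
theorem cost_link (hk : 3 ≤ k) (r b r' s s' : Bool) {j : ℕ} (h1 : 1 ≤ j) (hj : j + 3 ≤ 2 * k)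
    (hs0 : r = false → s = b) (hs1 : r = true → r' = true → s = b)
    (hs2 : r = true → r' = false → s = s') :
    (2 + (if r = r' then 1 else 0) + (if r then 0 else 1) + (if r' then 1 else 0) : ℝ) ≤
      stepCost (passLast r b (!s) j : DonutVertex k) (passFirst b r' (!s') (j + 2)) +
        stepCost (restLast r b s j : DonutVertex k) (restFirst b r' s' (j + 2)) := by
  have hk0 : 0 < k := by omega
  have c1 := fun b b' => add_le_stepCost hk0 b b' (d := 1) (i := j + 1) (by omega) (by omega)
    (by omega)
  have c2 := fun b b' => add_le_stepCost hk0 b b' (d := 2) (i := j) (by omega) (by omega)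
    (by omega)
  have c3 := fun b b' => add_le_stepCost hk0 b b' (d := 2) (i := j + 1) (by omega) (by omega)
    (by omega)
  have c4 := fun b b' => add_le_stepCost hk0 b b' (d := 3) (i := j) (by omega) (by omega)
    (by omega)
  simp only [add_assoc, Nat.reduceAdd] at c1 c2 c3 c4
  -- The bound is 2 for the lower rung followed by the upper rung, where both links are straight. In
  -- the other three cases it is 4: skipping a vertex of degree four lengthens the second link, or a
  -- change of side occurs.
  cases r
  · obtain rfl := hs0 rfl
    cases r'
    · have d1 := c1 s (!s')
      have d2 := c2 s s'
      cases s <;> cases s' <;>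
        simp [passLast, passFirst, restLast, restFirst] at d1 d2 ⊢ <;> linarith
    · have d1 := c1 s s
      have d2 := c2 s s'
      have d3 := c4 s s'
      cases s <;> cases s' <;>
        simp [passLast, passFirst, restLast, restFirst] at d1 d2 d3 ⊢ <;> linarith
  · cases r'
    · obtain rfl := hs2 rfl rfl
      have d1 := c1 (!s) (!s)
      have d2 := c1 s s
      cases s <;>
        simp [passLast, passFirst, restLast, restFirst] at d1 d2 ⊢ <;> linarith
    · obtain rfl := hs1 rfl rfl
      have d1 := c1 (!s) s
      have d2 := c1 s s'
      have d3 := c3 s s'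
      cases s <;> cases s' <;>
        simp [passLast, passFirst, restLast, restFirst] at d1 d2 d3 ⊢ <;> linarith

/-- The side on which the second pass runs through the block `m`. -/
def strand (k : ℕ) (ω : ℕ → Bool) (m : ℕ) : Bool :=
  if ω (2 * m + 1) then
    if m + 1 = k ∨ ω (2 * m + 3) = true then ω (2 * m + 2) else ω (2 * m + 4)
  else if m = 0 then !ω 0 else ω (2 * m + 2)

/-- The two single-bit terms of `cost_link` telescope over consecutive blocks to `n` up to a
boundary term. So they contribute about 1 per block for every tree, and only the equality indicator
remains random. -/
theorem sum_bool_telescope (f : ℕ → Bool) (n : ℕ) :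
    (n - 1 : ℝ) ≤ ∑ m ∈ Finset.range n, ((if f m then 0 else 1) + (if f (m + 1) then 1 else 0) : ℝ) := by
  have h : (n : ℝ) + (if f n then 1 else 0) - (if f 0 then 1 else 0) =
      ∑ m ∈ Finset.range n, ((if f m then 0 else 1) + (if f (m + 1) then 1 else 0) : ℝ) := by
    induction n with
    | zero => simp
    | succ n ih =>
      rw [Finset.sum_range_succ, ← ih]
      push_cast
      by_cases h : f n <;> simp [h] <;> ring
  rw [← h]
  split_ifs <;> linarith

end Donut

/-! ### The Eulerian tour for the matching between the blocks -/

namespace Donut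

variable {k : ℕ}

/-- The first round has to start at the upper end of the tree's rail at $w_1$. With the upper rung
it enters the first block on the side opposite to `strand`. -/
theorem strand_zero (ω : ℕ → Bool) (h : ω 1 = false) : strand k ω 0 = !ω 0 := by
  simp [strand, h]

/-- The second round has to end where the tree's rail to $w_0$ is attached. -/
theorem strand_last (hk : 0 < k) (ω : ℕ → Bool) (h : ω (2 * (k - 1) + 1) = true) :
    strand k ω (k - 1) = ω (2 * k) := by
  rw [strand, if_pos h, if_pos (Or.inl (by omega)), show 2 * (k - 1) + 2 = 2 * k by omega]

/-- This is the one condition that `edgeSingleton_link` puts on the sides. -/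
theorem strand_succ {m : ℕ} (hm : m + 1 < k) (ω : ℕ → Bool) (h : ω (2 * m + 1) = true)
    (h' : ω (2 * m + 3) = false) : strand k ω m = strand k ω (m + 1) := by
  rw [strand, if_pos h, if_neg (by simp [h']; omega), strand,
    if_neg (by simpa [mul_add] using h'), if_neg (by omega)]
  rfl

/-- Consecutive blocks are joined by a rail and a matching edge, one link for each round. The tour
runs from $w_1$ through all blocks, returns from the last block to the first by the matching edge
across the seam, runs through all blocks again to $w_0$, and closes along $e^+$. -/
theorem exists_tour_of_even (hk : 3 ≤ k) (ω : ℕ → Bool) :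
    ∃ t, IsEulerianTour ((insert (donutEdge k) (tree k ω)).val + (parityMatching ω 0).val) t ∧
      (5 * k - 10 + ∑ m ∈ Finset.range (k - 1),
        (if ω (2 * m + 1) = ω (2 * m + 3) then 1 else 0) : ℝ) ≤
        tourCost (donutCost k) (shortcut t) := by
  have hk0 : 0 < k := by omega
  set s := strand k ω with hs
  set T : ℕ → List (DonutVertex k) := fun m =>
    pass (ω (2 * m)) (ω (2 * m + 1)) (ω (2 * m + 2)) (!s m) (2 * m + 1) with hT
  set U : ℕ → List (DonutVertex k) := fun m =>
    pass (ω (2 * m)) (ω (2 * m + 1)) (ω (2 * m + 2)) (s m) (2 * m + 1) with hU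
  set R : ℕ → List (DonutVertex k) := fun m =>
    passRest (ω (2 * m)) (ω (2 * m + 1)) (ω (2 * m + 2)) (s m) (2 * m + 1) with hR
  set Tf : ℕ → DonutVertex k := fun m =>
    passFirst (ω (2 * m)) (ω (2 * m + 1)) (!s m) (2 * m + 1) with hTf
  set Tl : ℕ → DonutVertex k := fun m =>
    passLast (ω (2 * m + 1)) (ω (2 * m + 2)) (!s m) (2 * m + 1) with hTl
  set Uf : ℕ → DonutVertex k := fun m =>
    passFirst (ω (2 * m)) (ω (2 * m + 1)) (s m) (2 * m + 1) with hUf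
  set Ul : ℕ → DonutVertex k := fun m =>
    passLast (ω (2 * m + 1)) (ω (2 * m + 2)) (s m) (2 * m + 1) with hUl
  set Rf : ℕ → DonutVertex k := fun m =>
    restFirst (ω (2 * m)) (ω (2 * m + 1)) (s m) (2 * m + 1) with hRf
  set Rl : ℕ → DonutVertex k := fun m =>
    restLast (ω (2 * m + 1)) (ω (2 * m + 2)) (s m) (2 * m + 1) with hRl
  have eTf : ∀ m < k, (T m).head? = some (Tf m) := fun m _ => head?_pass _ _ _ _ _
  have eTl : ∀ m < k, (T m).getLast? = some (Tl m) := fun m _ => getLast?_pass _ _ _ _ _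
  have eUf : ∀ m < k, (U m).head? = some (Uf m) := fun m _ => head?_pass _ _ _ _ _
  have eUl : ∀ m < k, (U m).getLast? = some (Ul m) := fun m _ => getLast?_pass _ _ _ _ _
  have eRf : ∀ m < k, (R m).head? = some (Rf m) := fun m _ => head?_passRest _ _ _ _ _
  have eRl : ∀ m < k, (R m).getLast? = some (Rl m) := fun m _ => getLast?_passRest _ _ _ _ _
  have hTh : ∀ m < k, ∀ x ∈ T m, height x = 2 * m + 1 ∨ height x = 2 * m + 2 :=
    fun m hm x hx => height_of_mem_pass (by omega) _ _ _ _ hx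
  have hUh : ∀ m < k, ∀ x ∈ U m, height x = 2 * m + 1 ∨ height x = 2 * m + 2 :=
    fun m hm x hx => height_of_mem_pass (by omega) _ _ _ _ hx
  have hheight : ∀ x ∈ (List.range k).flatMap T ++ (List.range k).flatMap U,
      1 ≤ height x ∧ height x ≤ 2 * k := by
    intro x hx
    rcases List.mem_append.1 hx with hx | hx <;> obtain ⟨m, hm, hx⟩ := List.mem_flatMap.1 hx <;>
      have h1 := List.mem_range.1 hm
    · have := hTh m h1 x hx
      omega
    · have := hUh m h1 x hx
      omega
  refine ⟨w₁ :: (((List.range k).flatMap T ++ (List.range k).flatMap U) ++ [w₀, w₁]), ?_, ?_⟩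
  · rw [isEulerianTour_iff_pathSum]
    refine ⟨by simp, by rw [List.getLast?_cons, List.getLast?_append]; rfl, ?_⟩
    change pathSum edgeSingleton _ = _
    have hhead' : ((List.range k).flatMap U ++ [w₀, w₁]).head? = some (Uf 0) := by
      rw [List.head?_append, head?_flatMap_range hk0 eUf]
      rfl
    have hhead : ((List.range k).flatMap T ++ ((List.range k).flatMap U ++ [w₀, w₁])).head? =
        some (Tf 0) := by
      rw [List.head?_append, head?_flatMap_range hk0 eTf]
      rfl
    have hpass : ∀ m, pathSum edgeSingleton (T m) + pathSum edgeSingleton (U m) =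
        {rail true (2 * m + 1)} + {rail false (2 * m + 1)} +
          {rung (if ω (2 * m + 1) then 2 * m + 1 else 2 * m + 2)} :=
      fun m => pathSum_edgeSingleton_pass _ _ _ _ _
    have hlink : ∀ m < k - 1, edgeSingleton (Tl m) (Tf (m + 1)) + edgeSingleton (Ul m) (Uf (m + 1)) =
        {rail (ω (2 * (m + 1))) (2 * (m + 1))} + {oddEdge ω (2 * m + 2)} := by
      intro m hm
      rw [oddEdge_even ω (by omega)]
      exact edgeSingleton_link _ _ _ _ _ (2 * m + 1) fun h h' => strand_succ (by omega) ω h h'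
    have hbot : edgeSingleton w₁ (Tf 0) = {rail (ω (2 * 0)) (2 * 0)} := by
      have : Tf 0 = ladder (ω 0) 1 := by
        cases h : ω 1
        · simp [hTf, passFirst, h, hs, strand_zero (k := k) ω h]
        · simp [hTf, passFirst, h]
      rw [this, edgeSingleton, rail, mul_zero, ladder_zero]
    have htop : edgeSingleton (Ul (k - 1)) w₀ = {rail (ω (2 * k)) (2 * k)} := by
      have : Ul (k - 1) = ladder (ω (2 * k)) (2 * k) := by
        cases h : ω (2 * (k - 1) + 1)
        · simp [hUl, passLast, h, show 2 * (k - 1) + 2 = 2 * k by omega]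
        · simp [hUl, passLast, h, hs, strand_last hk0 ω h,
            show 2 * (k - 1) + 1 + 1 = 2 * k by omega]
      rw [this, edgeSingleton, rail, ladder_top]
    -- The matching edge between heights $2k$ and 1 joins the two rounds.
    have hmid : edgeSingleton (Tl (k - 1)) (Uf 0) = {oddEdge ω (2 * (k - 1) + 2)} := by
      have h1 : Uf 0 = ladder (ω 0 == ω 1) 1 := by
        cases h : ω 1
        · simp [hUf, passFirst, h, hs, strand_zero (k := k) ω h]
        · simp [hUf, passFirst, h]
      have h2 : Tl (k - 1) = ladder (ω (2 * (k - 1) + 1) != ω (2 * (k - 1) + 2))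
          (2 * (k - 1) + 1 + 1) := by
        cases h : ω (2 * (k - 1) + 1)
        · simp [hTl, passLast, h]
        · simp [hTl, passLast, h, hs, strand_last hk0 ω h,
            show 2 * (k - 1) + 2 = 2 * k by omega]
      rw [oddEdge_top hk0, h1, h2]
    have hpasses := Finset.sum_congr (rfl : Finset.range k = _) fun m _ => hpass m
    have hlinks := Finset.sum_congr (rfl : Finset.range (k - 1) = _) fun m hm =>
      hlink m (Finset.mem_range.1 hm)
    rw [List.append_assoc, pathSum_cons _ hhead,
      pathSum_append _ (getLast?_flatMap_range hk0 eTl) hhead',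
      pathSum_append _ (getLast?_flatMap_range hk0 eUl) rfl,
      pathSum_flatMap_range _ eTf eTl, pathSum_flatMap_range _ eUf eUl, val_tree hk0,
      (val_parityMatching hk ω).1, sum_range_succ_ends hk0,
      sum_range_pred_add hk0 fun m => ({oddEdge ω (2 * m + 2)} : Multiset (Sym2 (DonutVertex k))),
      ← hpasses, hbot, htop, hmid, pathSum_cons_cons, pathSum_singleton,
      show edgeSingleton w₀ w₁ = {donutEdge k} from rfl]
    rw [Finset.sum_add_distrib, Finset.sum_add_distrib] at hlinks
    rw [Finset.sum_add_distrib]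
    trans (∑ m ∈ Finset.range k, pathSum edgeSingleton (T m) +
      ∑ m ∈ Finset.range k, pathSum edgeSingleton (U m)) +
      (∑ m ∈ Finset.range (k - 1), edgeSingleton (Tl m) (Tf (m + 1)) +
        ∑ m ∈ Finset.range (k - 1), edgeSingleton (Ul m) (Uf (m + 1))) +
      {rail (ω (2 * 0)) (2 * 0)} + {oddEdge ω (2 * (k - 1) + 2)} + {rail (ω (2 * k)) (2 * k)} +
      {donutEdge k}
    · abel
    · rw [hlinks]
      abel
  · have hshort : shortcut (w₁ :: (((List.range k).flatMap T ++ (List.range k).flatMap U) ++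
        [w₀, w₁])) = w₁ :: (((List.range k).flatMap T ++ (List.range k).flatMap R) ++ [w₀]) := by
      rw [shortcut_closed w₀_ne_w₁ (fun h => absurd (hheight _ h).1 (by rw [height_w₁]; omega))
        (fun h => absurd (hheight _ h).2 (by rw [height_w₀]; omega)),
        shortcut_flatMap_append_flatMap (h := R)]
      · exact fun m hm => nodup_pass (by omega) (by omega) _ _ _ _
      · exact fun m hm => shortcut_pass (by omega) (by omega) _ _ _ _
      all_goals
        intro m hm m' hm' hne x hx hx'
        first
        | have h2 := hTh m hm x hx
        | have h2 := hUh m hm x hx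
        first
        | have h3 := hTh m' hm' x hx'
          omega
        | have h3 := hUh m' hm' x hx'
          omega
    have hhead' : ((List.range k).flatMap R ++ ([w₀] ++ [w₁])).head? = some (Rf 0) := by
      rw [List.head?_append, head?_flatMap_range hk0 eRf]
      rfl
    have hhead : ((List.range k).flatMap T ++ ((List.range k).flatMap R ++ ([w₀] ++ [w₁]))).head? =
        some (Tf 0) := by
      rw [List.head?_append, head?_flatMap_range hk0 eTf]
      rfl
    rw [hshort, tourCost_cons]
    change _ ≤ pathSum stepCost _
    rw [List.cons_append, List.append_assoc, List.append_assoc, pathSum_cons _ hhead,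
      pathSum_append _ (getLast?_flatMap_range hk0 eTl) hhead',
      pathSum_append _ (getLast?_flatMap_range hk0 eRl) rfl,
      pathSum_flatMap_range _ eTf eTl, pathSum_flatMap_range _ eRf eRl,
      sum_range_pred_add hk0 fun m => pathSum stepCost (T m),
      sum_range_pred_add hk0 fun m => pathSum stepCost (R m)]
    have hblock : ∑ m ∈ Finset.range (k - 1), (2 : ℝ) ≤
        ∑ m ∈ Finset.range (k - 1), (pathSum stepCost (T m) + pathSum stepCost (R m)) := by
      refine Finset.sum_le_sum fun m hm => ?_
      have := Finset.mem_range.1 hm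
      exact cost_pass hk0 _ _ _ _ (by omega) (by omega)
    -- In the first block `strand` is dictated by the rail at $w_1$ and may violate the hypotheses
    -- of `cost_link`. That link is bounded by 0 instead, at a loss of at most 4.
    have hlink : ∑ m ∈ Finset.range (k - 1), ((2 : ℝ) +
        (if ω (2 * m + 1) = ω (2 * m + 3) then 1 else 0) +
        ((if ω (2 * m + 1) then 0 else 1) + (if ω (2 * (m + 1) + 1) then 1 else 0)) -
          if m = 0 then 4 else 0) ≤
        ∑ m ∈ Finset.range (k - 1), (stepCost (Tl m) (Tf (m + 1)) +
          stepCost (Rl m) (Rf (m + 1))) := by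
      refine Finset.sum_le_sum fun m hm => ?_
      have := Finset.mem_range.1 hm
      by_cases hm0 : m = 0
      · have n1 := stepCost_nonneg (Tl m) (Tf (m + 1))
        have n2 := stepCost_nonneg (Rl m) (Rf (m + 1))
        refine le_trans ?_ (add_nonneg n1 n2)
        rw [if_pos hm0]
        change (2 : ℝ) + (if ω (2 * m + 1) = ω (2 * m + 3) then 1 else 0) +
          ((if ω (2 * m + 1) then 0 else 1) + (if ω (2 * m + 3) then 1 else 0)) - 4 ≤ 0
        cases ω (2 * m + 1) <;> cases ω (2 * m + 3) <;> norm_num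
      · rw [if_neg hm0, sub_zero, ← add_assoc]
        refine cost_link hk _ _ _ _ _ (by omega) (by omega) (fun h => ?_) (fun h h' => ?_)
          fun h h' => strand_succ (by omega) ω h h'
        · rw [hs, strand, if_neg (by simp [h]), if_neg hm0]
        · rw [hs, strand, if_pos h, if_pos (Or.inr h')]
    -- The deterministic part is $2(k-1)+2(k-1)-4+(k-2)=5k-10$.
    have htel := sum_bool_telescope (fun m => ω (2 * m + 1)) (k - 1)
    rw [Finset.sum_sub_distrib, Finset.sum_ite_eq', if_pos (Finset.mem_range.2 (by omega)),
      Finset.sum_add_distrib, Finset.sum_add_distrib, Finset.sum_const, Finset.card_range,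
      nsmul_eq_mul, Finset.sum_add_distrib (f := fun m => stepCost (Tl m) (Tf (m + 1)))] at hlink
    rw [Finset.sum_const, Finset.card_range, nsmul_eq_mul, Finset.sum_add_distrib] at hblock
    rw [Nat.cast_sub (by omega)] at hblock hlink htel
    push_cast at hblock hlink htel
    have n1 := stepCost_nonneg (w₁ : DonutVertex k) (Tf 0)
    have n2 := pathSum_stepCost_nonneg (T (k - 1))
    have n3 := pathSum_stepCost_nonneg (R (k - 1))
    have n4 := stepCost_nonneg (Tl (k - 1)) (Rf 0)
    have n5 := stepCost_nonneg (Rl (k - 1)) w₀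
    have n6 := pathSum_stepCost_nonneg ([w₀] ++ [w₁] : List (DonutVertex k))
    linarith

end Donut

/-! ### Tours -/

theorem mem_of_mem_pathSum_singleton {V : Type*} {l : List V} {e : Sym2 V} {v : V}
    (he : e ∈ pathSum (fun a b => ({s(a, b)} : Multiset (Sym2 V))) l) (hv : v ∈ e) : v ∈ l := by
  induction l with
  | nil => simp at he
  | cons a l ih =>
    cases l with
    | nil => simp at he
    | cons b l =>
      rw [pathSum_cons_cons, Multiset.mem_add, Multiset.mem_singleton] at he
      rcases he with rfl | he
      · rcases Sym2.mem_iff.1 hv with rfl | rfl <;> simp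
      · exact List.mem_cons_of_mem _ (ih he)

theorem IsTour.length_eq_card {V : Type*} [Fintype V] {h : List V} (hh : IsTour h) :
    h.length = Fintype.card V := by
  classical
  rw [← List.toFinset_card_of_nodup hh.1, ← Finset.card_univ]
  congr 1
  ext v
  simp [hh.2 v]

theorem isTour_of_length_le {V : Type*} [Fintype V] {h : List V} (hh : ∀ v, v ∈ h)
    (hl : h.length ≤ Fintype.card V) : IsTour h := by
  classical
  refine ⟨?_, hh⟩
  have : h.toFinset = Finset.univ := by
    ext v
    simp [hh v]
  have h1 := congrArg Finset.card this
  rw [Finset.card_univ] at h1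
  have h2 := List.toFinset_card_le h
  rw [← Multiset.coe_nodup, ← Multiset.toFinset_card_eq_card_iff_nodup]
  exact le_antisymm h2 (by rw [Multiset.coe_card]; exact hl.trans_eq h1.symm)

/-- A tour costs at least the number of its vertices, if every edge costs at least one. -/
theorem IsTour.card_le_tourCost {V : Type*} [Fintype V] {c : Sym2 V → ℝ} {h : List V}
    (hh : IsTour h) (hV : 1 < Fintype.card V) (hc : ∀ e, ¬ e.IsDiag → 1 ≤ c e) :
    (Fintype.card V : ℝ) ≤ tourCost c h := by
  have hlen := hh.length_eq_card
  have := List.card_nsmul_le_sum (List.zipWith (fun a b => c s(a, b)) h (h.rotate 1)) 1 (by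
    intro x hx
    obtain ⟨i, hi, rfl⟩ := List.mem_iff_getElem.1 hx
    rw [List.length_zipWith, List.length_rotate, min_self] at hi
    rw [List.getElem_zipWith, List.getElem_rotate]
    refine hc _ fun hd => ?_
    rw [Sym2.mk_isDiag_iff, hh.1.getElem_inj_iff] at hd
    by_cases h1 : i + 1 < h.length
    · rw [Nat.mod_eq_of_lt h1] at hd
      omega
    · rw [show i + 1 = h.length by omega, Nat.mod_self] at hd
      omega)
  rwa [List.length_zipWith, List.length_rotate, min_self, hlen, nsmul_eq_mul, mul_one] at this

namespace Donut

variable {k : ℕ}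

/-- Every vertex lies on $e^+$ or on a block rail, and all of these belong to the 1-tree. -/
theorem isTour_shortcut (hk : 0 < k) {ω : ℕ → Bool} {B : Multiset (Sym2 (DonutVertex k))}
    {t : List (DonutVertex k)}
    (ht : IsEulerianTour ((insert (donutEdge k) (tree k ω)).val + B) t) :
    IsTour (shortcut t) := by
  refine ⟨nodup_shortcut t, fun v => mem_shortcut.2 ?_⟩
  rw [isEulerianTour_iff_pathSum] at ht
  have key : ∀ e ∈ insert (donutEdge k) (tree k ω), v ∈ e → v ∈ t := fun e he hv =>
    mem_of_mem_pathSum_singleton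
      (by rw [ht.2.2]; exact Multiset.mem_add.2 (Or.inl he)) hv
  obtain ⟨b, j, hj, rfl⟩ := exists_eq_ladder v
  by_cases h0 : j = 0
  · subst h0
    exact key _ (Finset.mem_insert_self _ _) (by rw [donutEdge_eq b b]; exact Sym2.mem_mk_left _ _)
  by_cases ht : j = 2 * k + 1
  · subst ht
    exact key _ (Finset.mem_insert_self _ _) (by rw [donutEdge_eq b b]; exact Sym2.mem_mk_right _ _)
  rcases Nat.mod_two_eq_zero_or_one j with h | h
  · refine key (rail b (j - 1)) (Finset.mem_insert_of_mem ?_) ?_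
    · exact (rail_mem_tree hk (by omega)).2 (Or.inl (by omega))
    · rw [rail, Nat.sub_add_cancel (by omega)]
      exact Sym2.mem_mk_right _ _
  · exact key (rail b j) (Finset.mem_insert_of_mem ((rail_mem_tree hk (by omega)).2 (Or.inl h)))
      (Sym2.mem_mk_left _ _)

/-- A Hamiltonian cycle of the donut itself: each block is walked along rung, inner rail, rung, the
links are outer rails, and $e^+$ closes the cycle. -/
theorem exists_isTour_tourCost_eq (hk : 0 < k) :
    ∃ h : List (DonutVertex k), IsTour h ∧ tourCost (donutCost k) h = 4 * k + 2 := by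
  set F : ℕ → List (DonutVertex k) := fun m => [ladder true (2 * m + 1), ladder false (2 * m + 1),
    ladder false (2 * m + 2), ladder true (2 * m + 2)] with hF
  have hf : ∀ m < k, (F m).head? = some (ladder true (2 * m + 1)) := fun m _ => rfl
  have hl : ∀ m < k, (F m).getLast? = some (ladder true (2 * m + 2)) := fun m _ => rfl
  have hup : ∀ b, ∀ j ≤ 2 * k, stepCost (ladder b j : DonutVertex k) (ladder b (j + 1)) = 1 :=
    fun b j hj => donutCost_eq_one (adj_rail hk b hj)
  have hrung : ∀ b j, 1 ≤ j → j ≤ 2 * k →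
      stepCost (ladder b j : DonutVertex k) (ladder (!b) j) = 1 :=
    fun b j h1 hj => donutCost_eq_one (adj_rung hk b h1 hj)
  have hlen : ((List.range k).flatMap F).length = 4 * k := by
    rw [List.length_flatMap]
    simp [hF, mul_comm]
  refine ⟨w₁ :: ((List.range k).flatMap F ++ [w₀]), isTour_of_length_le ?_ ?_, ?_⟩
  · intro v
    obtain ⟨b, j, hj, rfl⟩ := exists_eq_ladder v
    by_cases h0 : j = 0
    · rw [h0, ladder_zero]
      simp
    by_cases ht : j = 2 * k + 1
    · rw [ht, ladder_top]
      simp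
    refine List.mem_cons_of_mem _ (List.mem_append_left _ (List.mem_flatMap.2
      ⟨(j - 1) / 2, List.mem_range.2 (by omega), ?_⟩))
    rcases Nat.mod_two_eq_zero_or_one j with h | h
    · obtain ⟨m, rfl⟩ : ∃ m, j = 2 * m + 2 := ⟨(j - 2) / 2, by omega⟩
      rw [show (2 * m + 2 - 1) / 2 = m by omega]
      cases b <;> simp [hF]
    · obtain ⟨m, rfl⟩ : ∃ m, j = 2 * m + 1 := ⟨(j - 1) / 2, by omega⟩
      rw [show (2 * m + 1 - 1) / 2 = m by omega]
      cases b <;> simp [hF]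
  · rw [List.length_cons, List.length_append, hlen, card_donutVertex, List.length_singleton]
  · have hhead : ((List.range k).flatMap F ++ ([w₀] ++ [w₁])).head? = some (ladder true 1) := by
      rw [List.head?_append, head?_flatMap_range hk hf]
      rfl
    have hblock : ∀ m ∈ Finset.range k, pathSum stepCost (F m) = 3 := by
      intro m hm
      have := Finset.mem_range.1 hm
      have c1 := hrung true (2 * m + 1) (by omega) (by omega)
      have c2 := hup false (2 * m + 1) (by omega)
      have c3 := hrung false (2 * m + 2) (by omega) (by omega)
      simp only [Bool.not_true, Bool.not_false] at c1 c3
      rw [hF]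
      simp only [pathSum_cons_cons, pathSum_singleton]
      rw [c1, c2, c3]
      norm_num
    have hlink : ∀ m ∈ Finset.range (k - 1), stepCost (ladder true (2 * m + 2) : DonutVertex k)
        (ladder true (2 * (m + 1) + 1)) = 1 := by
      intro m hm
      have := Finset.mem_range.1 hm
      exact hup true (2 * m + 2) (by omega)
    have hbot : stepCost (w₁ : DonutVertex k) (ladder true 1) = 1 := by
      have := hup true 0 (by omega)
      rwa [ladder_zero] at this
    have htop : stepCost (ladder true (2 * (k - 1) + 2) : DonutVertex k) w₀ = 1 := by
      have := hup true (2 * k) le_rfl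
      rwa [ladder_top, show 2 * k = 2 * (k - 1) + 2 by omega] at this
    rw [tourCost_cons]
    change pathSum stepCost _ = _
    rw [List.cons_append, List.append_assoc, pathSum_cons _ hhead,
      pathSum_append _ (getLast?_flatMap_range hk hl) rfl, pathSum_flatMap_range _ hf hl,
      Finset.sum_congr rfl hblock, Finset.sum_congr rfl hlink, hbot, htop, List.singleton_append,
      pathSum_cons_cons, pathSum_singleton,
      show stepCost w₀ (w₁ : DonutVertex k) = 1 from donutCost_donutEdge hk]
    simp only [Finset.sum_const, Finset.card_range, nsmul_eq_mul]
    rw [Nat.cast_sub (by omega)]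
    push_cast
    ring

theorem isLeast_tourCost (hk : 0 < k) :
    IsLeast {r : ℝ | ∃ h : List (DonutVertex k), IsTour h ∧ tourCost (donutCost k) h = r}
      (4 * k + 2) := by
  refine ⟨exists_isTour_tourCost_eq hk, ?_⟩
  rintro _ ⟨h, hh, rfl⟩
  have := hh.card_le_tourCost (c := donutCost k) (by rw [card_donutVertex]; omega)
    fun e he => one_le_donutCost hk he
  rw [card_donutVertex] at this
  exact_mod_cast this

end Donut

/-! ### The expected cost -/

/-- The sign of a bit. -/
def boolSign (b : Bool) : ℝ := if b then 1 else -1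

theorem boolSign_not (b : Bool) : boolSign (!b) = - boolSign b := by cases b <;> simp [boolSign]

theorem boolSign_mul_self (b : Bool) : boolSign b * boolSign b = 1 := by
  cases b <;> simp [boolSign]

theorem ite_eq_boolSign (b b' : Bool) :
    (if b = b' then 1 else 0 : ℝ) = 1 / 2 + boolSign b * boolSign b' / 2 := by
  cases b <;> cases b' <;> norm_num [boolSign]

/-- The sum of the products of the signs at distance two. -/
def signCorrelation (ω : ℕ → Bool) (d n : ℕ) : ℝ :=
  ∑ m ∈ Finset.range n, boolSign (ω (2 * m + d)) * boolSign (ω (2 * m + d + 2))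

theorem sum_ite_eq_signCorrelation (ω : ℕ → Bool) (d n : ℕ) :
    ∑ m ∈ Finset.range n, (if ω (2 * m + d) = ω (2 * m + d + 2) then 1 else 0 : ℝ) =
      n / 2 + signCorrelation ω d n / 2 := by
  simp only [ite_eq_boolSign]
  rw [Finset.sum_add_distrib, signCorrelation, Finset.sum_div, Finset.sum_const,
    Finset.card_range, nsmul_eq_mul, mul_one_div]

/-- The correlations at different places are orthogonal. -/
theorem sum_signCorrelation_sq (N d n : ℕ) (h : 2 * n + d < N) :
    ∑ A ∈ (Finset.range N).powerset, signCorrelation (bits A) d n ^ 2 = 2 ^ N * n := by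
  induction n with
  | zero => simp [signCorrelation]
  | succ n ih =>
    -- The bit at `2 * n + d + 2` occurs in no earlier term, so toggling it reverses the sign of the
    -- cross product.
    have hcross := sum_powerset_eq_zero (n := N) (j := 2 * n + d + 2) (by omega)
      (fun A => signCorrelation (bits A) d n *
        (boolSign (bits A (2 * n + d)) * boolSign (bits A (2 * n + d + 2)))) (by
      intro A
      have h1 : signCorrelation (bits (symmDiff A {2 * n + d + 2})) d n =
          signCorrelation (bits A) d n := by
        refine Finset.sum_congr rfl fun m hm => ?_
        have := Finset.mem_range.1 hm
        rw [bits_symmDiff, bits_symmDiff, if_neg (by omega), if_neg (by omega)]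
      rw [h1, bits_symmDiff, bits_symmDiff, if_neg (by omega), if_pos rfl, boolSign_not]
      ring)
    have hsq : ∀ A, signCorrelation (bits A) d (n + 1) ^ 2 = signCorrelation (bits A) d n ^ 2 +
        2 * (signCorrelation (bits A) d n *
          (boolSign (bits A (2 * n + d)) * boolSign (bits A (2 * n + d + 2)))) + 1 := by
      intro A
      have e1 := boolSign_mul_self (bits A (2 * n + d))
      have e2 := boolSign_mul_self (bits A (2 * n + d + 2))
      rw [signCorrelation, Finset.sum_range_succ, ← signCorrelation]
      linear_combination e1 * boolSign (bits A (2 * n + d + 2)) ^ 2 + e2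
    simp only [hsq]
    rw [Finset.sum_add_distrib, Finset.sum_add_distrib, ih (by omega), ← Finset.mul_sum, hcross,
      Finset.sum_const, Finset.card_powerset, Finset.card_range, nsmul_eq_mul]
    push_cast
    ring

/-- This is $(x+r)^2\ge0$. It bounds a correlation below by its square, whose mean is known, and
works for each tree separately. -/
theorem neg_le_half_of_sq {x r : ℝ} (hr : 0 < r) : -((x ^ 2 / r + r) / 2) ≤ x := by
  have : 0 ≤ (x + r) ^ 2 / r := by positivity
  have e : (x + r) ^ 2 / r = x ^ 2 / r + 2 * x + r := by
    field_simp
    ring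
  linarith

namespace Donut

variable {k : ℕ}

/-- A lower bound for the cost that does not depend on the matching. -/
noncomputable def tourBound (k : ℕ) (A : Finset ℕ) : ℝ :=
  5.5 * k - 10.5 - √k / 4 - (signCorrelation (bits A) 0 (k - 1) ^ 2 +
    signCorrelation (bits A) 1 (k - 1) ^ 2) / (4 * √k)

/-- The $k-1$ indicators sum to $(k-1)/2$ plus half a correlation, to which `neg_le_half_of_sq`
applies with $r=\sqrt k$. Subtracting the squares of both correlations makes the bound valid for
either matching. -/
theorem tourBound_le (hk : 0 < k) (A : Finset ℕ) {d : ℕ} (hd : d = 0 ∨ d = 1) :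
    tourBound k A ≤ 5 * k - 10 + ∑ m ∈ Finset.range (k - 1),
      (if bits A (2 * m + d) = bits A (2 * m + d + 2) then 1 else 0 : ℝ) := by
  have hr : (0 : ℝ) < √k := Real.sqrt_pos.2 (by exact_mod_cast hk)
  rw [sum_ite_eq_signCorrelation, tourBound, Nat.cast_sub hk]
  have h0 := neg_le_half_of_sq (x := signCorrelation (bits A) d (k - 1)) hr
  have n0 : 0 ≤ signCorrelation (bits A) 0 (k - 1) ^ 2 / √k := by positivity
  have n1 : 0 ≤ signCorrelation (bits A) 1 (k - 1) ^ 2 / √k := by positivity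
  rw [mul_comm 4, ← div_div, add_div]
  rcases hd with rfl | rfl <;> push_cast <;> linarith

/-- Each squared correlation has mean $k-1$, so the mean is at least $5.5k-10.5-\frac34\sqrt k$.
Here $5.5k=1.375\cdot4k$, and the term $4/\sqrt k$ gives away at least $16\sqrt k$, which covers the
remaining losses. -/
theorem sum_tourBound (hk : 3 ≤ k) :
    (1.375 - 4 / √k) * (4 * k + 2) ≤
      1 / 2 ^ (2 * k + 1) * ∑ A ∈ configs k, tourBound k A := by
  have hk1 : (1 : ℝ) ≤ k := by exact_mod_cast (by omega : 1 ≤ k)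
  have hr : (1 : ℝ) ≤ √k := Real.one_le_sqrt.2 hk1
  have hrr : √k * √k = k := Real.mul_self_sqrt (by positivity)
  have hsum : ∑ A ∈ configs k, tourBound k A = 2 ^ (2 * k + 1) *
      (5.5 * k - 10.5 - √k / 4 - 2 * (k - 1) / (4 * √k)) := by
    simp only [tourBound]
    rw [Finset.sum_sub_distrib, ← Finset.sum_div, Finset.sum_add_distrib,
      sum_signCorrelation_sq _ _ _ (by omega), sum_signCorrelation_sq _ _ _ (by omega),
      Finset.sum_const, Finset.card_powerset, Finset.card_range, nsmul_eq_mul,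
      Nat.cast_sub (by omega)]
    push_cast
    ring
  rw [hsum, ← mul_assoc, one_div_mul_cancel (by positivity), one_mul]
  have e1 : 2 * ((k : ℝ) - 1) / (4 * √k) ≤ √k / 2 := by
    rw [div_le_div_iff₀ (by positivity) (by norm_num)]
    nlinarith
  have e2 : 16 * √k ≤ 4 / √k * (4 * k + 2) := by
    rw [div_mul_eq_mul_div, le_div_iff₀ (by positivity)]
    nlinarith
  linarith

theorem exists_tour (hk : 3 ≤ k) (A : Finset ℕ) {M : Finset (Sym2 (DonutVertex k))}
    (hM : M = donutMatching₁ (insert (donutEdge k) (tree k (bits A))) ∨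
      M = donutMatching₂ (insert (donutEdge k) (tree k (bits A)))) :
    ∃ t, IsEulerianTour ((insert (donutEdge k) (tree k (bits A))).val + M.val) t ∧
      tourBound k A ≤ tourCost (donutCost k) (shortcut t) := by
  rcases hM with rfl | rfl
  · obtain ⟨t, h1, h2⟩ := exists_tour_of_even hk (bits A)
    rw [donutMatching₁_eq (by omega)]
    exact ⟨t, h1, (tourBound_le (by omega) A (Or.inr rfl)).trans h2⟩
  · obtain ⟨t, h1, h2⟩ := exists_tour_of_odd hk (bits A)
    rw [donutMatching₂_eq (by omega)]
    exact ⟨t, h1, (tourBound_le (by omega) A (Or.inl rfl)).trans h2⟩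

theorem uniformTree_tree_ne_zero {A : Finset ℕ} (hA : A ∈ configs k) :
    uniformTree k (tree k (bits A)) ≠ 0 := by
  classical
  rw [uniformTree, if_pos (Finset.mem_image_of_mem _ hA)]
  positivity

theorem exists_isDonutMatchingRule (hk : 3 ≤ k) : ∃ M, IsDonutMatchingRule k (uniformTree k) M := by
  have : ∀ X, ∃ M, uniformTree k X ≠ 0 →
      IsMinCostPerfectMatchingOn (donutCost k) (oddVertices (insert (donutEdge k) X)) M ∧
      (M = donutMatching₁ (insert (donutEdge k) X) ∨
        M = donutMatching₂ (insert (donutEdge k) X)) := by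
    intro X
    by_cases hX : uniformTree k X = 0
    · exact ⟨∅, fun h => absurd hX h⟩
    · obtain ⟨A, -, rfl⟩ := exists_config_of_uniformTree_ne_zero hX
      obtain ⟨c, hc, hmin⟩ := exists_isMinCost_parityMatching hk (bits A)
      refine ⟨parityMatching (bits A) c, fun _ => ⟨hmin, ?_⟩⟩
      rw [donutMatching₁_eq (by omega), donutMatching₂_eq (by omega)]
      interval_cases c
      · exact Or.inl rfl
      · exact Or.inr rfl
  choose M hM using this
  exact ⟨M, hM⟩

/-- A suitable Eulerian tour is chosen tree by tree for whichever matching the rule prescribes.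
Since `tourBound` depends only on the bits, its average bounds the expected cost for every rule. -/
theorem exists_isMaxEntropyRun (hk : 3 ≤ k)
    {M : Finset (Sym2 (DonutVertex k)) → Finset (Sym2 (DonutVertex k))}
    (hM : IsDonutMatchingRule k (uniformTree k) M) :
    ∃ t : Finset (Sym2 (DonutVertex k)) → List (DonutVertex k),
      IsMaxEntropyRun (donutCost k) (donutPoint k) (donutEdge k) (uniformTree k) M t ∧
      (∀ X, uniformTree k X ≠ 0 → IsTour (shortcut (t X))) ∧
      (1.375 - 4 / √k) * (4 * k + 2) ≤ expectedTourCost (donutCost k) (uniformTree k) t := by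
  have hk0 : 0 < k := by omega
  have : ∀ X, ∃ t, uniformTree k X ≠ 0 →
      IsEulerianTour ((insert (donutEdge k) X).val + (M X).val) t ∧
        ∀ A ∈ configs k, tree k (bits A) = X →
          tourBound k A ≤ tourCost (donutCost k) (shortcut t) := by
    intro X
    by_cases hX : uniformTree k X = 0
    · exact ⟨[], fun h => absurd hX h⟩
    · obtain ⟨A, hA, rfl⟩ := exists_config_of_uniformTree_ne_zero hX
      obtain ⟨t, h1, h2⟩ := exists_tour hk A (hM _ hX).2
      refine ⟨t, fun _ => ⟨h1, fun B hB h => ?_⟩⟩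
      rwa [tree_bits_injOn hk0 hB hA h]
  choose t ht using this
  refine ⟨t, ⟨donutPoint_mem_extremePoints hk0, fun y hy => ?_, donutPoint_donutEdge hk0,
    (isMaxEntropyDistribution_uniformTree hk0).1, fun X hX => (hM X hX).1,
    fun X hX => (ht X hX).1⟩, fun X hX => ?_, ?_⟩
  · rw [lpCost_donutPoint hk0]
    exact le_lpCost hk0 hy
  · have h := (ht X hX).1
    obtain ⟨A, -, rfl⟩ := exists_config_of_uniformTree_ne_zero hX
    exact isTour_shortcut hk0 h
  · rw [expectedTourCost, sum_uniformTree hk0 fun X => tourCost (donutCost k) (shortcut (t X))]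
    refine (sum_tourBound hk).trans (mul_le_mul_of_nonneg_left ?_ (by positivity))
    exact Finset.sum_le_sum fun A hA => (ht _ (uniformTree_tree_ne_zero hA)).2 A hA rfl

end Donut

theorem mainTheorem1 :
    ∃ ε : ℕ → ℝ, Filter.Tendsto ε Filter.atTop (nhds 0) ∧
      ∀ k : ℕ, 3 ≤ k →
        Fintype.card (DonutVertex k) = 4 * k + 2 ∧
        (donutGraph k).Connected ∧
        IsLeast {r : ℝ | ∃ h : List (DonutVertex k), IsTour h ∧ tourCost (donutCost k) h = r}
          (4 * k + 2) ∧
        IsLeast (lpCost (donutCost k) '' subtourPolytope (DonutVertex k)) (4 * k + 2) ∧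
        ∃ p : Finset (Sym2 (DonutVertex k)) → ℝ,
          IsMaxEntropyDistribution (donutPoint k) (donutEdge k) p ∧
          (∀ q, IsMaxEntropyDistribution (donutPoint k) (donutEdge k) q → q = p) ∧
          (∃ M, IsDonutMatchingRule k p M) ∧
          ∀ M, IsDonutMatchingRule k p M →
            ∃ t : Finset (Sym2 (DonutVertex k)) → List (DonutVertex k),
              IsMaxEntropyRun (donutCost k) (donutPoint k) (donutEdge k) p M t ∧
              (∀ X, p X ≠ 0 → IsTour (shortcut (t X))) ∧
              (1.375 - ε k) * (4 * k + 2) ≤ expectedTourCost (donutCost k) p t := by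
  refine ⟨fun k => 4 / √k, ?_, fun k hk => ?_⟩
  · exact (Real.tendsto_sqrt_atTop.comp tendsto_natCast_atTop_atTop).const_div_atTop 4
  have hk0 : 0 < k := by omega
  refine ⟨Donut.card_donutVertex, Donut.connected_donutGraph hk0, Donut.isLeast_tourCost hk0,
    ⟨⟨_, Donut.donutPoint_mem_subtourPolytope hk0, Donut.lpCost_donutPoint hk0⟩, ?_⟩,
    Donut.uniformTree k, (Donut.isMaxEntropyDistribution_uniformTree hk0).1,
    (Donut.isMaxEntropyDistribution_uniformTree hk0).2, Donut.exists_isDonutMatchingRule hk,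
    fun M hM => Donut.exists_isMaxEntropyRun hk hM⟩
  rintro _ ⟨y, hy, rfl⟩
  exact Donut.le_lpCost hk0 hy
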